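/- **Conventions.** $\mu$ denotes a nonnegative Borel measure on $\mathbb{C}$, $\operatorname{supp}(\mu)$ its support, and $B(z,r)$ the open disc with centre $z$ and radius $r>0$. Let $\mathcal{D}$ be the set of all dyadic squares $[k2^j,(k+1)2^j)\times[l2^j,(l+1)2^j)$ with $j,k,l\in\mathbb{Z}$; for $Q\in\mathcal{D}$, $\ell(Q)$ is its side length and $z_Q$ its centre. Let $C_0,c_0>0$ and $\tau\in(0,1)$. - $\mu$ is *$C_0$-nice* if $\mu(B(z,r))\le C_0r$ for all $z\in\mathbb{C}$, $r>0$. - $\mu$ is *$C_0$-good* if it is $C_0$-nice and for every $\delta>0$ the operator $$\mathcal{C}_{\mu,\delta}f(z)=\int_{\mathbb{C}}\frac{\overline{z-\xi}}{\max(\delta,|z-\xi|)^2}\,f(\xi)\,d\mu(\xi)$$ is bounded from $L^2(\mu)$ to $L^2(\mu)$ with norm at most $C_0$. - A nice measure $\mu$ is *AD-regular with constant $c_0$* if $\mu(B(z,r))\ge c_0r$ for all $z\in\operatorname{supp}(\mu)$, $r>0$. - $Q\in\mathcal{D}$ is *bad* (for $\mu$ and $\tau$) if there are $\zeta,\xi\in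 B(z_Q,10\ell(Q))\cap\operatorname{supp}(\mu)$ with $|\zeta-\xi|\ge\ell(Q)/2$ and a point $z$ of the segment $[\zeta,\xi]$ with $B(z,\tau\ell(Q))\cap\operatorname{supp}(\mu)=\varnothing$. **Proposition.** (a) There is a constant $C>0$ depending only on $\tau,C_0,c_0$ such that, for every $C_0$-good measure $\mu$ that is AD-regular with constant $c_0$, and every $P\in\mathcal{D}$, $$\sum_{Q\in\mathcal{D},\ Q\text{ bad},\ Q\subset P}\ell(Q)\le C\,\ell(P).\tag{1}$$ (b) Suppose that $\tau<\tfrac1{16}$. For every $C>0$ there is $M>0$ depending only on $\tau,C_0,c_0,C$ with the following property. If $\mu$ is $C_0$-nice, AD-regular with constant $c_0$, and (1) holds with this $C$ for every $P\in\mathcal{D}$, then $\operatorname{supp}(\mu)$ is uniformly rectifiable with constant $M$: for every $Q\in\mathcal{D}$ there is a Lipschitz map $F:[0,1]\to\mathbb{C}$ with Lipschitz norm at most $M\ell(Q)$ and $\operatorname{supp}(\mu)\cap Q\subset F([0,1])$. -/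

import Mathlib

open MeasureTheory
open scoped ENNReal NNReal

noncomputable section

namespace CauchyUR

/-- The dyadic square `[k 2^j, (k+1) 2^j) × [l 2^j, (l+1) 2^j)` of the complex plane, given by its
indices. Different indices give different squares, so this type is the dyadic lattice. -/
structure DyadicSquare where
  j : ℤ
  k : ℤ
  l : ℤ

namespace DyadicSquare

/-- The side length `2^j`. -/
def side (Q : DyadicSquare) : ℝ := (2 : ℝ) ^ Q.j

/-- The centre of the square. -/
def center (Q : DyadicSquare) : ℂ :=
  ⟨((Q.k : ℝ) + 1 / 2) * Q.side, ((Q.l : ℝ) + 1 / 2) * Q.side⟩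

/-- The square as a (half-open) subset of the plane. -/
def toSet (Q : DyadicSquare) : Set ℂ :=
  {z | (Q.k : ℝ) * Q.side ≤ z.re ∧ z.re < ((Q.k : ℝ) + 1) * Q.side ∧
       (Q.l : ℝ) * Q.side ≤ z.im ∧ z.im < ((Q.l : ℝ) + 1) * Q.side}

end DyadicSquare

/-- `μ` is `C₀`-nice: `μ(B(z,r)) ≤ C₀ r` for every open disc. -/
def IsNice (C₀ : ℝ) (μ : Measure ℂ) : Prop :=
  ∀ (z : ℂ) (r : ℝ), 0 < r → μ (Metric.ball z r) ≤ ENNReal.ofReal (C₀ * r)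

/-- The regularized Cauchy kernel `K_δ(z) = conj z / max(δ, |z|)²`. -/
def cauchyKernel (δ : ℝ) (z : ℂ) : ℂ :=
  (starRingEnd ℂ) z / (((max δ ‖z‖) ^ 2 : ℝ) : ℂ)

/-- The `δ`-regularized Cauchy transform of `f μ`. For nice `μ`, `δ > 0` and `f ∈ L²(μ)`
the integral converges absolutely at every `z`. -/
def cauchyTransform (μ : Measure ℂ) (δ : ℝ) (f : ℂ → ℂ) (z : ℂ) : ℂ :=
  ∫ ξ, cauchyKernel δ (z - ξ) * f ξ ∂μ

/-- `μ` is `C₀`-good: it is `C₀`-nice, and for every `δ > 0` the `δ`-regularized Cauchy transform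
maps `L²(μ)` to `L²(μ)` with operator norm at most `C₀`. -/
def IsGood (C₀ : ℝ) (μ : Measure ℂ) : Prop :=
  IsNice C₀ μ ∧
    ∀ δ : ℝ, 0 < δ → ∀ f : ℂ → ℂ, MemLp f 2 μ →
      MemLp (cauchyTransform μ δ f) 2 μ ∧
        eLpNorm (cauchyTransform μ δ f) 2 μ ≤ ENNReal.ofReal C₀ * eLpNorm f 2 μ

/-- Lower Ahlfors-David regularity with constant `c₀`: `μ(B(z,r)) ≥ c₀ r` for every disc
centred on the support. (A measure is AD-regular when it is nice and satisfies this.) -/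
def IsLowerADRegular (c₀ : ℝ) (μ : Measure ℂ) : Prop :=
  ∀ z ∈ μ.support, ∀ r : ℝ, 0 < r → ENNReal.ofReal (c₀ * r) ≤ μ (Metric.ball z r)

/-- `Q` is a bad square for `μ`, with parameter `τ`. -/
def IsBad (τ : ℝ) (μ : Measure ℂ) (Q : DyadicSquare) : Prop :=
  ∃ ζ ∈ Metric.ball Q.center (10 * Q.side) ∩ μ.support,
    ∃ ξ ∈ Metric.ball Q.center (10 * Q.side) ∩ μ.support,
      Q.side / 2 ≤ ‖ζ - ξ‖ ∧
        ∃ z ∈ segment ℝ ζ ξ, Metric.ball z (τ * Q.side) ∩ μ.support = ∅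

/-- The set of bad squares. -/
def badSquares (τ : ℝ) (μ : Measure ℂ) : Set DyadicSquare := {Q | IsBad τ μ Q}

/-- A family `S` of dyadic squares is a Carleson family with constant `C`:
`∑_{Q ∈ S, Q ⊂ P} ℓ(Q) ≤ C ℓ(P)` for every dyadic square `P`. The sum is taken in `[0,∞]`. -/
def IsCarleson (C : ℝ) (S : Set DyadicSquare) : Prop :=
  ∀ P : DyadicSquare,
    ∑' Q : {Q : DyadicSquare // Q ∈ S ∧ Q.toSet ⊆ P.toSet}, ENNReal.ofReal Q.1.side
      ≤ ENNReal.ofReal (C * P.side)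

/-- `E` is uniformly rectifiable with constant `M`: for each dyadic square `Q`, the set `E ∩ Q`
lies in the image of a Lipschitz map `F : [0,1] → ℂ` of Lipschitz norm at most `M ℓ(Q)`. -/
def IsUniformlyRectifiable (M : ℝ) (E : Set ℂ) : Prop :=
  ∀ Q : DyadicSquare, ∃ F : Set.Icc (0 : ℝ) 1 → ℂ,
    LipschitzWith (M * Q.side).toNNReal F ∧ E ∩ Q.toSet ⊆ Set.range F

end CauchyUR

end

namespace CauchyUR

namespace DyadicSquare

lemma side_pos (Q : DyadicSquare) : 0 < Q.side := zpow_pos two_pos _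

/-- The dyadic square of side `2 ^ j` that contains `x`. -/
noncomputable def ofPoint (j : ℤ) (x : ℂ) : DyadicSquare :=
  ⟨j, ⌊x.re / (2 : ℝ) ^ j⌋, ⌊x.im / (2 : ℝ) ^ j⌋⟩

@[simp] lemma ofPoint_j (j : ℤ) (x : ℂ) : (ofPoint j x).j = j := rfl

lemma mem_ofPoint (j : ℤ) (x : ℂ) : x ∈ (ofPoint j x).toSet := by
  have h : (0 : ℝ) < 2 ^ j := zpow_pos two_pos _
  refine ⟨?_, ?_, ?_, ?_⟩
  · exact (le_div_iff₀ h).1 (Int.floor_le _)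
  · exact (div_lt_iff₀ h).1 (Int.lt_floor_add_one _)
  · exact (le_div_iff₀ h).1 (Int.floor_le _)
  · exact (div_lt_iff₀ h).1 (Int.lt_floor_add_one _)

lemma center_mem (Q : DyadicSquare) : Q.center ∈ Q.toSet := by
  have := Q.side_pos
  refine ⟨?_, ?_, ?_, ?_⟩ <;> simp only [center] <;> nlinarith

lemma norm_sub_le_of_mem {Q : DyadicSquare} {x y : ℂ} (hx : x ∈ Q.toSet) (hy : y ∈ Q.toSet) :
    ‖x - y‖ ≤ 3 / 2 * Q.side := by
  have hs := Q.side_pos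
  obtain ⟨h1, h2, h3, h4⟩ := hx
  obtain ⟨g1, g2, g3, g4⟩ := hy
  have h : ‖x - y‖ ^ 2 ≤ (3 / 2 * Q.side) ^ 2 := by
    rw [Complex.sq_norm, Complex.normSq_apply]
    have e1 : |(x - y).re| ≤ Q.side := by rw [abs_le]; simp; constructor <;> linarith
    have e2 : |(x - y).im| ≤ Q.side := by rw [abs_le]; simp; constructor <;> linarith
    have := sq_le_sq' (by linarith [abs_nonneg (x - y).re]) e1
    have := sq_le_sq' (by linarith [abs_nonneg (x - y).im]) e2
    rw [sq_abs] at *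
    nlinarith
  exact le_of_sq_le_sq h (by positivity)

lemma norm_sub_center_le {Q : DyadicSquare} {x : ℂ} (hx : x ∈ Q.toSet) :
    ‖x - Q.center‖ ≤ Q.side := by
  have hs := Q.side_pos
  obtain ⟨h1, h2, h3, h4⟩ := hx
  have h : ‖x - Q.center‖ ^ 2 ≤ Q.side ^ 2 := by
    rw [Complex.sq_norm, Complex.normSq_apply]
    have e1 : |(x - Q.center).re| ≤ Q.side / 2 := by
      rw [abs_le]; simp [center]; constructor <;> linarith
    have e2 : |(x - Q.center).im| ≤ Q.side / 2 := by
      rw [abs_le]; simp [center]; constructor <;> linarith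
    have := sq_le_sq' (by linarith [abs_nonneg (x - Q.center).re]) e1
    have := sq_le_sq' (by linarith [abs_nonneg (x - Q.center).im]) e2
    rw [sq_abs] at *
    nlinarith
  exact le_of_sq_le_sq h (by positivity)

lemma side_le_of_subset {Q P : DyadicSquare} (h : Q.toSet ⊆ P.toSet) : Q.side ≤ P.side := by
  by_contra! hlt
  have hP := P.side_pos
  have hQ := Q.side_pos
  have h1 : (⟨Q.k * Q.side, Q.l * Q.side⟩ : ℂ) ∈ Q.toSet := by
    refine ⟨?_, ?_, ?_, ?_⟩ <;> simp only <;> nlinarith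
  have h2 : (⟨Q.k * Q.side + P.side, Q.l * Q.side⟩ : ℂ) ∈ Q.toSet := by
    refine ⟨?_, ?_, ?_, ?_⟩ <;> simp only <;> nlinarith
  have g1 := (h h1).1
  have g2 := (h h2).2.1
  simp only at g1 g2
  linarith

/-- Every dyadic square lies in a dyadic square of each larger scale. -/
lemma subset_ofPoint {Q : DyadicSquare} {j : ℤ} (hj : Q.j ≤ j) :
    Q.toSet ⊆ (ofPoint j Q.center).toSet := by
  obtain ⟨i, hi⟩ := Int.le.dest hj
  have hs := Q.side_pos
  have hside : (2 : ℝ) ^ j = (2 : ℝ) ^ i * Q.side := by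
    rw [← hi, zpow_add₀ two_ne_zero, mul_comm]; simp [side]
  have key : ∀ (n m : ℤ), (m : ℝ) * 2 ^ j ≤ ((n : ℝ) + 1 / 2) * Q.side →
      ((n : ℝ) + 1 / 2) * Q.side < ((m : ℝ) + 1) * 2 ^ j →
      (m : ℝ) * 2 ^ j ≤ n * Q.side ∧ ((n : ℝ) + 1) * Q.side ≤ ((m : ℝ) + 1) * 2 ^ j := by
    intro n m h1 h2
    rw [hside, ← mul_assoc] at *
    rw [mul_le_mul_iff_left₀ hs, mul_lt_mul_iff_left₀ hs] at *
    have a1 : m * 2 ^ i < n + 1 := by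
      have : (m : ℝ) * 2 ^ i < n + 1 := by linarith
      exact_mod_cast this
    have a2 : n < (m + 1) * 2 ^ i := by
      have : (n : ℝ) < (m + 1) * 2 ^ i := by linarith
      exact_mod_cast this
    rw [← mul_assoc, mul_le_mul_iff_left₀ hs]
    constructor
    · exact_mod_cast Int.lt_add_one_iff.1 a1
    · exact_mod_cast Int.add_one_le_iff.2 a2
  have hc := mem_ofPoint j Q.center
  obtain ⟨c1, c2, c3, c4⟩ := hc
  have A := key Q.k _ c1 c2
  have B := key Q.l _ c3 c4
  rintro x ⟨x1, x2, x3, x4⟩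
  exact ⟨A.1.trans x1, x2.trans_le A.2, B.1.trans x3, x4.trans_le B.2⟩

lemma card_Icc_ceil_floor_le (α β : ℝ) (h : α ≤ β) :
    ((Finset.Icc ⌈α⌉ ⌊β⌋).card : ℝ) ≤ β - α + 1 := by
  rw [Int.card_Icc]
  rcases le_or_gt 0 (⌊β⌋ + 1 - ⌈α⌉) with h0 | h0
  · have : (((⌊β⌋ + 1 - ⌈α⌉).toNat : ℤ) : ℝ) = ((⌊β⌋ + 1 - ⌈α⌉ : ℤ) : ℝ) := by
      rw [Int.toNat_of_nonneg h0]
    have e : (((⌊β⌋ + 1 - ⌈α⌉).toNat : ℕ) : ℝ) = ((⌊β⌋ + 1 - ⌈α⌉ : ℤ) : ℝ) := by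
      exact_mod_cast this
    rw [e]
    push_cast
    linarith [Int.floor_le β, Int.le_ceil α]
  · rw [Int.toNat_of_nonpos h0.le]
    simp; linarith

/-- There are boundedly many dyadic squares of a given scale near a given point. -/
lemma card_le_of_near {F : Finset DyadicSquare} {j : ℤ} {x : ℂ} {K : ℝ} (hK : 0 ≤ K)
    (hF : ∀ Q ∈ F, Q.j = j ∧ ‖Q.center - x‖ ≤ K * (2 : ℝ) ^ j) :
    (F.card : ℝ) ≤ (2 * K + 1) ^ 2 := by
  classical
  have h : (0 : ℝ) < 2 ^ j := zpow_pos two_pos _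
  set I : ℝ → Finset ℤ := fun t => Finset.Icc ⌈t / 2 ^ j - 1 / 2 - K⌉ ⌊t / 2 ^ j - 1 / 2 + K⌋
  have hI : ∀ t, ((I t).card : ℝ) ≤ 2 * K + 1 := fun t =>
    (card_Icc_ceil_floor_le _ _ (by linarith)).trans (by linarith)
  have key : ∀ (n : ℤ) (t : ℝ), |((n : ℝ) + 1 / 2) * 2 ^ j - t| ≤ K * 2 ^ j → n ∈ I t := by
    intro n t hn
    rw [abs_le] at hn
    have e : t = t / 2 ^ j * 2 ^ j := by field_simp
    have h1 : (t / 2 ^ j - 1 / 2 - K) ≤ n := by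
      rw [e] at hn
      by_contra! hc
      nlinarith [mul_lt_mul_of_pos_right hc h]
    have h2 : (n : ℝ) ≤ (t / 2 ^ j - 1 / 2 + K) := by
      rw [e] at hn
      by_contra! hc
      nlinarith [mul_lt_mul_of_pos_right hc h]
    exact Finset.mem_Icc.2 ⟨Int.ceil_le.2 h1, Int.le_floor.2 h2⟩
  have hcard : F.card ≤ (I x.re ×ˢ I x.im).card := by
    refine Finset.card_le_card_of_injOn (fun Q => (Q.k, Q.l)) ?_ ?_
    · intro Q hQ
      obtain ⟨rfl, hn⟩ := hF Q hQ
      rw [Finset.mem_coe, Finset.mem_product]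
      exact ⟨key _ _ ((Complex.abs_re_le_norm (Q.center - x)).trans hn),
        key _ _ ((Complex.abs_im_le_norm (Q.center - x)).trans hn)⟩
    · intro Q hQ Q' hQ' heq
      have h1 := (hF Q hQ).1
      have h2 := (hF Q' hQ').1
      obtain ⟨_, _, _⟩ := Q
      obtain ⟨_, _, _⟩ := Q'
      simp_all
  calc (F.card : ℝ) ≤ (I x.re).card * (I x.im).card := by
        rw [Finset.card_product] at hcard; exact_mod_cast hcard
    _ ≤ (2 * K + 1) * (2 * K + 1) := by gcongr <;> apply hI
    _ = _ := by ring

lemma finite_near (j : ℤ) (x : ℂ) (ρ : ℝ) :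
    {Q : DyadicSquare | Q.j = j ∧ ‖Q.center - x‖ ≤ ρ}.Finite := by
  by_contra hinf
  have h : (0 : ℝ) < 2 ^ j := zpow_pos two_pos _
  obtain ⟨n, hn⟩ := exists_nat_gt ((2 * (|ρ| / 2 ^ j) + 1) ^ 2)
  obtain ⟨F, hF, hc⟩ := Set.Infinite.exists_subset_card_eq hinf n
  have := card_le_of_near (F := F) (j := j) (x := x) (K := |ρ| / 2 ^ j) (by positivity)
    (fun Q hQ => ⟨(hF hQ).1, by
      rw [div_mul_cancel₀ _ h.ne']; exact (hF hQ).2.trans (le_abs_self _)⟩)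
  rw [hc] at this
  linarith

/-- There are boundedly many dyadic squares of size comparable to `d` near a given point. -/
lemma exists_card_le_of_comparable (K : ℝ) (hK : 1 ≤ K) :
    ∃ N : ℕ, ∀ (F : Finset DyadicSquare) (x : ℂ) (d : ℝ), 0 < d →
      (∀ Q ∈ F, d ≤ K * Q.side ∧ Q.side ≤ K * d ∧ ‖Q.center - x‖ ≤ K * Q.side) →
      F.card ≤ N := by
  classical
  obtain ⟨i, hi⟩ := pow_unbounded_of_one_lt K one_lt_two
  refine ⟨(2 * i + 2) * ⌈(2 * K + 1) ^ 2⌉₊, fun F x d hd hF => ?_⟩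
  set j₀ := Int.log 2 d
  have l1 : (2 : ℝ) ^ j₀ ≤ d := Int.zpow_log_le_self one_lt_two hd
  have l2 : d < (2 : ℝ) ^ (j₀ + 1) := Int.lt_zpow_succ_log_self one_lt_two d
  have hmap : ∀ Q ∈ F, Q.j ∈ Finset.Icc (j₀ - i) (j₀ + i + 1) := by
    intro Q hQ
    obtain ⟨h1, h2, -⟩ := hF Q hQ
    have hs := Q.side_pos
    rw [Finset.mem_Icc]
    constructor
    · have : (2 : ℝ) ^ j₀ < 2 ^ (Q.j + i) := by
        rw [zpow_add₀ two_ne_zero, zpow_natCast]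
        calc (2 : ℝ) ^ j₀ ≤ K * Q.side := l1.trans h1
          _ < 2 ^ i * Q.side := by gcongr
          _ = _ := mul_comm _ _
      have := (zpow_lt_zpow_iff_right₀ one_lt_two).1 this
      linarith
    · have : (2 : ℝ) ^ Q.j < 2 ^ (j₀ + 1 + i) := by
        rw [zpow_add₀ two_ne_zero _ (i : ℤ), zpow_natCast]
        calc (2 : ℝ) ^ Q.j ≤ K * d := h2
          _ < 2 ^ i * 2 ^ (j₀ + 1) := by gcongr
          _ = _ := mul_comm _ _
      have := (zpow_lt_zpow_iff_right₀ one_lt_two).1 this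
      linarith
  calc F.card ≤ ∑ j ∈ Finset.Icc (j₀ - i) (j₀ + i + 1), (F.filter (fun Q => Q.j = j)).card :=
        (Finset.card_eq_sum_card_fiberwise hmap).le
    _ ≤ ∑ j ∈ Finset.Icc (j₀ - i) (j₀ + i + 1), ⌈(2 * K + 1) ^ 2⌉₊ := by
        refine Finset.sum_le_sum fun j _ => ?_
        have := card_le_of_near (F := F.filter (fun Q => Q.j = j)) (j := j) (x := x) (K := K)
          (by linarith) (fun Q hQ => by
            obtain ⟨hQ', rfl⟩ := Finset.mem_filter.1 hQ
            exact ⟨rfl, (hF Q hQ').2.2⟩)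
        exact_mod_cast this.trans (Nat.le_ceil _)
    _ = _ := by
        rw [Finset.sum_const, Int.card_Icc, smul_eq_mul]
        congr 1
        omega

end DyadicSquare

/-- If each point lies in at most `N` of the sets `E i ⊆ B`, then `∑ μ (E i) ≤ N μ B`. -/
lemma sum_measure_le_of_overlap {α ι : Type*} [MeasurableSpace α] (μ : Measure α) (F : Finset ι)
    (E : ι → Set α) (B : Set α) (N : ℕ) (hE : ∀ i ∈ F, MeasurableSet (E i))
    (hB : MeasurableSet B) (hEB : ∀ i ∈ F, E i ⊆ B)
    (hN : ∀ y, ∀ G ⊆ F, (∀ i ∈ G, y ∈ E i) → G.card ≤ N) :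
    ∑ i ∈ F, μ (E i) ≤ N * μ B := by
  classical
  have h1 : ∀ i ∈ F, μ (E i) = ∫⁻ y, (E i).indicator 1 y ∂μ := fun i hi =>
    (lintegral_indicator_one (hE i hi)).symm
  rw [Finset.sum_congr rfl h1, ← lintegral_finsetSum' _
    (fun i hi => (measurable_one.indicator (hE i hi)).aemeasurable), ← lintegral_indicator_one hB,
    ← lintegral_const_mul _ (measurable_one.indicator hB)]
  refine lintegral_mono fun y => ?_
  by_cases hy : y ∈ B
  · have e : ∑ i ∈ F, (E i).indicator (1 : α → ℝ≥0∞) y = (F.filter (fun i => y ∈ E i)).card := by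
      rw [Finset.card_filter, Nat.cast_sum]
      refine Finset.sum_congr rfl fun i _ => ?_
      by_cases h : y ∈ E i <;> simp [h]
    rw [e]
    simp only [Set.indicator_of_mem hy, Pi.one_apply, mul_one]
    exact_mod_cast hN y _ (Finset.filter_subset _ _) (fun i hi => (Finset.mem_filter.1 hi).2)
  · rw [Finset.sum_eq_zero]
    · positivity
    · exact fun i hi => Set.indicator_of_notMem (fun h => hy (hEB i hi h)) _

lemma IsNice.measure_ball_lt_top {C₀ : ℝ} {μ : Measure ℂ} (h : IsNice C₀ μ) (z : ℂ) (r : ℝ) :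
    μ (Metric.ball z r) < ⊤ := by
  rcases le_or_gt r 0 with hr | hr
  · simp [Metric.ball_eq_empty.2 hr]
  · exact (h z r hr).trans_lt ENNReal.ofReal_lt_top

lemma IsNice.isLocallyFiniteMeasure {C₀ : ℝ} {μ : Measure ℂ} (h : IsNice C₀ μ) :
    IsLocallyFiniteMeasure μ :=
  ⟨fun z => ⟨Metric.ball z 1, Metric.ball_mem_nhds z one_pos, h.measure_ball_lt_top z 1⟩⟩

lemma IsNice.real_ball_le {C₀ : ℝ} {μ : Measure ℂ} (h : IsNice C₀ μ) (hC₀ : 0 < C₀) (z : ℂ)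
    {r : ℝ} (hr : 0 < r) : μ.real (Metric.ball z r) ≤ C₀ * r :=
  ENNReal.toReal_le_of_le_ofReal (by positivity) (h z r hr)

lemma IsLowerADRegular.le_real_ball {C₀ c₀ : ℝ} {μ : Measure ℂ} (h : IsLowerADRegular c₀ μ)
    (hn : IsNice C₀ μ) {z : ℂ} (hz : z ∈ μ.support) {r : ℝ} (hr : 0 < r) :
    c₀ * r ≤ μ.real (Metric.ball z r) :=
  (ENNReal.ofReal_le_iff_le_toReal (hn.measure_ball_lt_top z r).ne).1 (h z hz r hr)

/-- Number of dyadic squares of a given scale that are close to the support, inside a disc. -/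
lemma card_mul_le_of_near_support {C₀ c₀ : ℝ} (hC₀ : 0 < C₀) {μ : Measure ℂ}
    (hn : IsNice C₀ μ) (hl : IsLowerADRegular c₀ μ) {F : Finset DyadicSquare} {j : ℤ} {x : ℂ}
    {K ρ : ℝ} (hK : 0 ≤ K) (hρ : 0 ≤ ρ)
    (hF : ∀ Q ∈ F, Q.j = j ∧ (∃ e ∈ μ.support, ‖e - Q.center‖ ≤ K * (2 : ℝ) ^ j) ∧
      ‖Q.center - x‖ ≤ ρ) :
    F.card * (c₀ * (2 : ℝ) ^ j) ≤ ((2 * K + 3) ^ 2 + 1) * (C₀ * (ρ + (K + 1) * (2 : ℝ) ^ j)) := by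
  classical
  have h : (0 : ℝ) < 2 ^ j := zpow_pos two_pos _
  have hF' : ∀ Q, ∃ e, Q ∈ F → e ∈ μ.support ∧ ‖e - Q.center‖ ≤ K * (2 : ℝ) ^ j := fun Q => by
    by_cases hQ : Q ∈ F
    · obtain ⟨e, he⟩ := (hF Q hQ).2.1
      exact ⟨e, fun _ => he⟩
    · exact ⟨0, fun h => absurd h hQ⟩
  choose e he using hF'
  set N : ℕ := ⌈(2 * (K + 1) + 1) ^ 2⌉₊ with hN
  have hR : 0 < ρ + (K + 1) * (2 : ℝ) ^ j := by positivity
  have key := sum_measure_le_of_overlap μ F (fun Q => Metric.ball (e Q) ((2 : ℝ) ^ j))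
    (Metric.ball x (ρ + (K + 1) * (2 : ℝ) ^ j)) N (fun _ _ => measurableSet_ball)
    measurableSet_ball ?_ ?_
  · have h1 : ∑ Q ∈ F, μ.real (Metric.ball (e Q) ((2 : ℝ) ^ j))
        ≤ N * μ.real (Metric.ball x (ρ + (K + 1) * (2 : ℝ) ^ j)) := by
      have := ENNReal.toReal_mono (ENNReal.mul_ne_top (ENNReal.natCast_ne_top N)
        (hn.measure_ball_lt_top x _).ne) key
      rw [ENNReal.toReal_sum (fun Q _ => (hn.measure_ball_lt_top _ _).ne), ENNReal.toReal_mul,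
        ENNReal.toReal_natCast] at this
      exact this
    calc (F.card : ℝ) * (c₀ * (2 : ℝ) ^ j) = ∑ Q ∈ F, c₀ * (2 : ℝ) ^ j := by simp
      _ ≤ ∑ Q ∈ F, μ.real (Metric.ball (e Q) ((2 : ℝ) ^ j)) :=
          Finset.sum_le_sum fun Q hQ => hl.le_real_ball hn (he Q hQ).1 h
      _ ≤ _ := h1
      _ ≤ N * (C₀ * (ρ + (K + 1) * (2 : ℝ) ^ j)) := by
          gcongr; exact hn.real_ball_le hC₀ x hR
      _ ≤ _ := by
          gcongr
          exact (Nat.ceil_lt_add_one (by positivity)).le.trans (by ring_nf; rfl)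
  · intro Q hQ y hy
    rw [Metric.mem_ball, dist_eq_norm] at *
    have h1 := (he Q hQ).2
    have h2 := (hF Q hQ).2.2
    have : y - x = (y - e Q) + (e Q - Q.center) + (Q.center - x) := by ring
    rw [this]
    have := norm_add₃_le (a := y - e Q) (b := e Q - Q.center) (c := Q.center - x)
    linarith
  · intro y G hG hy
    have := DyadicSquare.card_le_of_near (F := G) (j := j) (x := y) (K := K + 1) (by linarith)
      (fun Q hQ => ⟨(hF Q (hG hQ)).1, by
        have h1 := (he Q (hG hQ)).2
        have h2 := hy Q hQ
        rw [Metric.mem_ball, dist_eq_norm] at h2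
        have : Q.center - y = -((y - e Q) + (e Q - Q.center)) := by ring
        rw [this, norm_neg]
        have := norm_add_le (y - e Q) (e Q - Q.center)
        linarith⟩)
    exact_mod_cast this.trans (Nat.le_ceil _)


section Kernel

variable {δ : ℝ}

lemma norm_cauchyKernel (δ : ℝ) (z : ℂ) : ‖cauchyKernel δ z‖ = ‖z‖ / (max δ ‖z‖) ^ 2 := by
  rw [cauchyKernel, norm_div, RCLike.norm_conj, Complex.norm_real, Real.norm_eq_abs,
    abs_of_nonneg (sq_nonneg _)]

lemma norm_cauchyKernel_le (hδ : 0 < δ) (z : ℂ) : ‖cauchyKernel δ z‖ ≤ 1 / δ := by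
  have h : 0 < max δ ‖z‖ := lt_max_of_lt_left hδ
  rw [norm_cauchyKernel, div_le_div_iff₀ (by positivity) hδ]
  nlinarith [le_max_left δ ‖z‖, le_max_right δ ‖z‖, norm_nonneg z]

lemma continuous_cauchyKernel (hδ : 0 < δ) : Continuous (cauchyKernel δ) := by
  unfold cauchyKernel
  refine Continuous.div (by fun_prop) (by fun_prop) fun z => ?_
  have h : 0 < max δ ‖z‖ := lt_max_of_lt_left hδ
  exact_mod_cast (pow_pos h 2).ne'

lemma cauchyKernel_neg (z : ℂ) : cauchyKernel δ (-z) = -cauchyKernel δ z := by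
  simp [cauchyKernel, neg_div]

/-- `Re (K_δ(u) conj K_δ(v))` in terms of side lengths. -/
lemma re_cauchyKernel_mul_conj (u v : ℂ) :
    (cauchyKernel δ u * (starRingEnd ℂ) (cauchyKernel δ v)).re =
      (‖u‖ ^ 2 + ‖v‖ ^ 2 - ‖u - v‖ ^ 2) / (2 * ((max δ ‖u‖) ^ 2 * (max δ ‖v‖) ^ 2)) := by
  have h : cauchyKernel δ u * (starRingEnd ℂ) (cauchyKernel δ v) =
      ((starRingEnd ℂ) u * v) / (((max δ ‖u‖) ^ 2 * (max δ ‖v‖) ^ 2 : ℝ) : ℂ) := by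
    rw [cauchyKernel, cauchyKernel, map_div₀, Complex.conj_conj, Complex.conj_ofReal,
      div_mul_div_comm]
    push_cast; rfl
  rw [h, Complex.div_ofReal_re]
  have e : ((starRingEnd ℂ) u * v).re = (‖u‖ ^ 2 + ‖v‖ ^ 2 - ‖u - v‖ ^ 2) / 2 := by
    simp only [Complex.sq_norm, Complex.normSq_apply, Complex.mul_re, Complex.conj_re,
      Complex.conj_im, Complex.sub_re, Complex.sub_im]
    ring
  rw [e, div_div]

/-- The function whose cyclic symmetrization is `curvature`. -/
noncomputable def kernelProduct (δ : ℝ) (p : ℂ × ℂ × ℂ) : ℝ :=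
  (cauchyKernel δ (p.1 - p.2.1) * (starRingEnd ℂ) (cauchyKernel δ (p.1 - p.2.2))).re

/-- A `δ`-regularized version of half of the squared Menger curvature. -/
noncomputable def curvature (δ : ℝ) (p : ℂ × ℂ × ℂ) : ℝ :=
  kernelProduct δ p + kernelProduct δ (p.2.1, p.2.2, p.1) + kernelProduct δ (p.2.2, p.1, p.2.1)

lemma curvature_eq (hδ : 0 < δ) (x y z : ℂ) :
    curvature δ (x, y, z) =
      ((‖x - y‖ ^ 2 + ‖x - z‖ ^ 2 - ‖y - z‖ ^ 2) * (max δ ‖y - z‖) ^ 2 +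
        (‖x - y‖ ^ 2 + ‖y - z‖ ^ 2 - ‖x - z‖ ^ 2) * (max δ ‖x - z‖) ^ 2 +
        (‖x - z‖ ^ 2 + ‖y - z‖ ^ 2 - ‖x - y‖ ^ 2) * (max δ ‖x - y‖) ^ 2) /
      (2 * ((max δ ‖x - y‖) ^ 2 * (max δ ‖x - z‖) ^ 2 * (max δ ‖y - z‖) ^ 2)) := by
  have h1 : 0 < max δ ‖x - y‖ := lt_max_of_lt_left hδ
  have h2 : 0 < max δ ‖x - z‖ := lt_max_of_lt_left hδ
  have h3 : 0 < max δ ‖y - z‖ := lt_max_of_lt_left hδ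
  simp only [curvature, kernelProduct, re_cauchyKernel_mul_conj]
  have e1 : x - y - (x - z) = z - y := by ring
  have e2 : y - z - (y - x) = x - z := by ring
  have e3 : z - x - (z - y) = y - x := by ring
  rw [e1, e2, e3, norm_sub_rev z y, norm_sub_rev y x, norm_sub_rev z x]
  field_simp
  ring

lemma curvature_numerator_nonneg {α β γ d : ℝ} (hα : 0 ≤ α) (hβ : 0 ≤ β) (hαγ : α ≤ γ)
    (hβγ : β ≤ γ) (hS : 0 ≤ 2 * α * β + 2 * β * γ + 2 * γ * α - α ^ 2 - β ^ 2 - γ ^ 2) (hd : 0 ≤ d) :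
    0 ≤ (α + β - γ) * max d γ + (α + γ - β) * max d β + (β + γ - α) * max d α := by
  rcases le_total d γ with h | h
  · rw [max_eq_right h]
    have h1 := mul_le_mul_of_nonneg_left (le_max_right d β) (by linarith : 0 ≤ α + γ - β)
    have h2 := mul_le_mul_of_nonneg_left (le_max_right d α) (by linarith : 0 ≤ β + γ - α)
    nlinarith
  · rw [max_eq_left h, max_eq_left (by linarith), max_eq_left (by linarith)]
    nlinarith [mul_nonneg hd hα, mul_nonneg hd hβ, mul_nonneg hd (hα.trans hαγ)]

lemma heron (x y z : ℂ) :
    2 * ‖x - y‖ ^ 2 * ‖x - z‖ ^ 2 + 2 * ‖x - z‖ ^ 2 * ‖y - z‖ ^ 2 + 2 * ‖y - z‖ ^ 2 * ‖x - y‖ ^ 2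
      - (‖x - y‖ ^ 2) ^ 2 - (‖x - z‖ ^ 2) ^ 2 - (‖y - z‖ ^ 2) ^ 2 =
      4 * (((starRingEnd ℂ) (y - x) * (z - x)).im) ^ 2 := by
  simp only [Complex.sq_norm, Complex.normSq_apply, Complex.mul_im, Complex.conj_re,
    Complex.conj_im, Complex.sub_re, Complex.sub_im]
  ring

lemma curvature_nonneg (hδ : 0 < δ) (p : ℂ × ℂ × ℂ) : 0 ≤ curvature δ p := by
  obtain ⟨x, y, z⟩ := p
  rw [curvature_eq hδ]
  have hS := heron x y z
  have hS' : 0 ≤ 4 * (((starRingEnd ℂ) (y - x) * (z - x)).im) ^ 2 := by positivity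
  have hm : ∀ t : ℝ, 0 ≤ t → (max δ t) ^ 2 = max (δ ^ 2) (t ^ 2) := fun t ht => by
    rcases le_total δ t with h | h
    · rw [max_eq_right h, max_eq_right (by gcongr)]
    · rw [max_eq_left h, max_eq_left (by gcongr)]
  refine div_nonneg ?_ (by positivity)
  rw [hm _ (norm_nonneg _), hm _ (norm_nonneg _), hm _ (norm_nonneg _)]
  have hd : 0 ≤ δ ^ 2 := by positivity
  have ha : 0 ≤ ‖x - y‖ ^ 2 := by positivity
  have hb : 0 ≤ ‖x - z‖ ^ 2 := by positivity
  have hc : 0 ≤ ‖y - z‖ ^ 2 := by positivity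
  rcases le_total (‖x - y‖ ^ 2) (‖x - z‖ ^ 2) with h1 | h1
  · rcases le_total (‖x - z‖ ^ 2) (‖y - z‖ ^ 2) with h2 | h2
    · have := curvature_numerator_nonneg ha hb (h1.trans h2) h2 (by linarith) hd
      linarith
    · have := curvature_numerator_nonneg ha hc h1 h2 (by linarith) hd
      linarith
  · rcases le_total (‖x - y‖ ^ 2) (‖y - z‖ ^ 2) with h2 | h2
    · have := curvature_numerator_nonneg ha hb h2 (h1.trans h2) (by linarith) hd
      linarith
    · have := curvature_numerator_nonneg hb hc h1 h2 (by linarith) hd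
      linarith

/-- Lower bound for the curvature of a triangle with sides between `δ` and `D`. -/
lemma le_curvature {D : ℝ} (hδ : 0 < δ) {x y z : ℂ} (h1 : δ ≤ ‖x - y‖) (h2 : δ ≤ ‖x - z‖)
    (h3 : δ ≤ ‖y - z‖) (g1 : ‖x - y‖ ≤ D) (g2 : ‖x - z‖ ≤ D) (g3 : ‖y - z‖ ≤ D) :
    2 * (((starRingEnd ℂ) (y - x) * (z - x)).im) ^ 2 / D ^ 6 ≤ curvature δ (x, y, z) := by
  rw [curvature_eq hδ, max_eq_right h1, max_eq_right h2, max_eq_right h3]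
  have hS := heron x y z
  have p1 := hδ.trans_le h1
  have p2 := hδ.trans_le h2
  have p3 := hδ.trans_le h3
  set I := ((starRingEnd ℂ) (y - x) * (z - x)).im
  have e : (‖x - y‖ ^ 2 + ‖x - z‖ ^ 2 - ‖y - z‖ ^ 2) * ‖y - z‖ ^ 2 +
        (‖x - y‖ ^ 2 + ‖y - z‖ ^ 2 - ‖x - z‖ ^ 2) * ‖x - z‖ ^ 2 +
        (‖x - z‖ ^ 2 + ‖y - z‖ ^ 2 - ‖x - y‖ ^ 2) * ‖x - y‖ ^ 2 = 4 * I ^ 2 := by linarith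
  rw [e]
  have e2 : 4 * I ^ 2 / (2 * (‖x - y‖ ^ 2 * ‖x - z‖ ^ 2 * ‖y - z‖ ^ 2)) =
      2 * I ^ 2 / (‖x - y‖ ^ 2 * ‖x - z‖ ^ 2 * ‖y - z‖ ^ 2) := by field_simp; ring
  rw [e2]
  refine div_le_div_of_nonneg_left (by positivity) (by positivity) ?_
  calc ‖x - y‖ ^ 2 * ‖x - z‖ ^ 2 * ‖y - z‖ ^ 2 ≤ D ^ 2 * D ^ 2 * D ^ 2 := by gcongr
    _ = D ^ 6 := by ring

lemma continuous_kernelProduct (hδ : 0 < δ) : Continuous (kernelProduct δ) := by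
  have := continuous_cauchyKernel hδ
  unfold kernelProduct
  fun_prop

lemma continuous_curvature (hδ : 0 < δ) : Continuous (curvature δ) := by
  have := continuous_kernelProduct hδ
  unfold curvature
  fun_prop

lemma abs_kernelProduct_le (hδ : 0 < δ) (p : ℂ × ℂ × ℂ) : |kernelProduct δ p| ≤ 1 / δ * (1 / δ) := by
  refine (Complex.abs_re_le_norm _).trans ?_
  rw [norm_mul, RCLike.norm_conj]
  exact mul_le_mul (norm_cauchyKernel_le hδ _) (norm_cauchyKernel_le hδ _) (norm_nonneg _)
    (by positivity)

lemma integrable_kernelProduct (hδ : 0 < δ) (ν : Measure (ℂ × ℂ × ℂ)) [IsFiniteMeasure ν] :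
    Integrable (kernelProduct δ) ν :=
  Integrable.of_bound (continuous_kernelProduct hδ).aestronglyMeasurable (1 / δ * (1 / δ))
    (Filter.Eventually.of_forall fun p => abs_kernelProduct_le hδ p)

lemma integrable_cauchyKernel (hδ : 0 < δ) (ν : Measure ℂ) [IsFiniteMeasure ν] (x : ℂ) :
    Integrable (fun y => cauchyKernel δ (x - y)) ν :=
  Integrable.of_bound ((continuous_cauchyKernel hδ).comp (by fun_prop)).aestronglyMeasurable (1 / δ)
    (Filter.Eventually.of_forall fun _ => norm_cauchyKernel_le hδ _)

lemma integral_kernelProduct (hδ : 0 < δ) (ν : Measure ℂ) [IsFiniteMeasure ν] :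
    ∫ p, kernelProduct δ p ∂(ν.prod (ν.prod ν)) =
      ∫ x, ‖∫ y, cauchyKernel δ (x - y) ∂ν‖ ^ 2 ∂ν := by
  rw [integral_prod _ (integrable_kernelProduct hδ _)]
  refine integral_congr_ae (Filter.Eventually.of_forall fun x => ?_)
  have hi := integrable_cauchyKernel hδ ν x
  have e : ∫ q : ℂ × ℂ, cauchyKernel δ (x - q.1) * (starRingEnd ℂ) (cauchyKernel δ (x - q.2))
      ∂(ν.prod ν) = (∫ y, cauchyKernel δ (x - y) ∂ν) *
        (starRingEnd ℂ) (∫ y, cauchyKernel δ (x - y) ∂ν) := by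
    rw [← integral_conj]
    exact integral_prod_mul (L := ℂ) (fun y => cauchyKernel δ (x - y))
      (fun y => (starRingEnd ℂ) (cauchyKernel δ (x - y)))
  have hint : Integrable (fun q : ℂ × ℂ =>
      cauchyKernel δ (x - q.1) * (starRingEnd ℂ) (cauchyKernel δ (x - q.2))) (ν.prod ν) := by
    refine hi.mul_prod (g := fun y => (starRingEnd ℂ) (cauchyKernel δ (x - y))) ?_
    exact (Complex.conjCLE : ℂ →L[ℝ] ℂ).integrable_comp hi
  have h := integral_re (𝕜 := ℂ) hint
  simp only [kernelProduct]
  simp only [RCLike.re_to_complex] at h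
  rw [h, e, Complex.mul_conj, Complex.ofReal_re, Complex.normSq_eq_norm_sq]

/-- Melnikov's identity for the regularized kernel. -/
lemma integral_curvature (hδ : 0 < δ) (ν : Measure ℂ) [IsFiniteMeasure ν] :
    ∫ p, curvature δ p ∂(ν.prod (ν.prod ν)) =
      3 * ∫ x, ‖∫ y, cauchyKernel δ (x - y) ∂ν‖ ^ 2 ∂ν := by
  have hc : MeasurePreserving (fun p : ℂ × ℂ × ℂ => (p.2.1, p.2.2, p.1)) (ν.prod (ν.prod ν))
      (ν.prod (ν.prod ν)) :=
    (measurePreserving_prodAssoc ν ν ν).comp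
      (Measure.measurePreserving_swap (μ := ν) (ν := ν.prod ν))
  have hk := (continuous_kernelProduct hδ)
  have hI := integrable_kernelProduct hδ (ν.prod (ν.prod ν))
  have e1 : ∫ p, kernelProduct δ (p.2.1, p.2.2, p.1) ∂(ν.prod (ν.prod ν)) =
      ∫ p, kernelProduct δ p ∂(ν.prod (ν.prod ν)) := by
    have := integral_map (μ := ν.prod (ν.prod ν)) hc.measurable.aemeasurable (f := kernelProduct δ)
      hk.aestronglyMeasurable
    rw [hc.map_eq] at this
    exact this.symm
  have e2 : ∫ p, kernelProduct δ (p.2.2, p.1, p.2.1) ∂(ν.prod (ν.prod ν)) =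
      ∫ p, kernelProduct δ p ∂(ν.prod (ν.prod ν)) := by
    have := integral_map (μ := ν.prod (ν.prod ν)) (hc.comp hc).measurable.aemeasurable (f := kernelProduct δ)
      hk.aestronglyMeasurable
    rw [(hc.comp hc).map_eq] at this
    exact this.symm
  have i1 : Integrable (fun p : ℂ × ℂ × ℂ => kernelProduct δ (p.2.1, p.2.2, p.1))
      (ν.prod (ν.prod ν)) := hc.integrable_comp_of_integrable hI
  have i2 : Integrable (fun p : ℂ × ℂ × ℂ => kernelProduct δ (p.2.2, p.1, p.2.1))
      (ν.prod (ν.prod ν)) := (hc.comp hc).integrable_comp_of_integrable hI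
  simp only [curvature]
  have e3 : ∫ p : ℂ × ℂ × ℂ, kernelProduct δ p + kernelProduct δ (p.2.1, p.2.2, p.1) +
      kernelProduct δ (p.2.2, p.1, p.2.1) ∂(ν.prod (ν.prod ν)) = _ := integral_add (hI.add i1) i2
  rw [e3, integral_add hI i1, e1, e2, integral_kernelProduct hδ]
  ring

end Kernel

lemma cauchyTransform_indicator (μ : Measure ℂ) (δ : ℝ) {B : Set ℂ} (hB : MeasurableSet B) :
    cauchyTransform μ δ (B.indicator 1) = fun x => ∫ y, cauchyKernel δ (x - y) ∂(μ.restrict B) := by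
  ext x
  rw [cauchyTransform, ← integral_indicator hB]
  congr 1
  ext y
  by_cases h : y ∈ B <;> simp [h]

/-- The `L²` estimate for the Cauchy transform of the characteristic function of a set. -/
lemma IsGood.memLp_and_integral_sq_le {C₀ : ℝ} (hC₀ : 0 < C₀) {μ : Measure ℂ} (hg : IsGood C₀ μ) {δ : ℝ}
    (hδ : 0 < δ) {B : Set ℂ} (hB : MeasurableSet B) (hfin : μ B ≠ ⊤) :
    MemLp (fun x => ∫ y, cauchyKernel δ (x - y) ∂(μ.restrict B)) 2 μ ∧
      ∫ x, ‖∫ y, cauchyKernel δ (x - y) ∂(μ.restrict B)‖ ^ 2 ∂μ ≤ C₀ ^ 2 * μ.real B := by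
  have hm : MemLp (B.indicator (1 : ℂ → ℂ)) 2 μ := memLp_indicator_const 2 hB 1 (Or.inr hfin)
  obtain ⟨h1, h2⟩ := hg.2 δ hδ _ hm
  rw [cauchyTransform_indicator μ δ hB] at h1 h2
  set F : ℂ → ℂ := fun x => ∫ y, cauchyKernel δ (x - y) ∂(μ.restrict B) with hF
  have hint : Integrable (fun x => ‖F x‖ ^ 2) μ := (memLp_two_iff_integrable_sq_norm h1.1).1 h1
  have e1 : ∫ x, ‖F x‖ ^ 2 ∂μ = (eLpNorm F 2 μ).toReal ^ 2 := by
    have := h1.eLpNorm_eq_integral_rpow_norm two_ne_zero ENNReal.ofNat_ne_top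
    rw [this, ENNReal.toReal_ofReal (by positivity)]
    simp only [ENNReal.toReal_ofNat, Real.rpow_ofNat]
    rw [← Real.rpow_natCast, ← Real.rpow_mul (integral_nonneg fun _ => by positivity)]
    norm_num
  have e2 : (eLpNorm (B.indicator (1 : ℂ → ℂ)) 2 μ).toReal ^ 2 = μ.real B := by
    have : eLpNorm (B.indicator (1 : ℂ → ℂ)) 2 μ = _ :=
      eLpNorm_indicator_const (c := (1 : ℂ)) hB two_ne_zero ENNReal.ofNat_ne_top
    rw [this]
    simp only [enorm_one, one_mul, ← ENNReal.toReal_rpow, ENNReal.toReal_ofNat]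
    rw [← Real.rpow_natCast, ← Real.rpow_mul ENNReal.toReal_nonneg]
    norm_num [Measure.real]
  refine ⟨h1, ?_⟩
  calc ∫ x, ‖F x‖ ^ 2 ∂μ = (eLpNorm F 2 μ).toReal ^ 2 := e1
    _ ≤ (C₀ * (eLpNorm (B.indicator (1 : ℂ → ℂ)) 2 μ).toReal) ^ 2 := by
        gcongr
        have := ENNReal.toReal_mono (ENNReal.mul_ne_top ENNReal.ofReal_ne_top hm.2.ne) h2
        rwa [ENNReal.toReal_mul, ENNReal.toReal_ofReal hC₀.le] at this
    _ = _ := by rw [mul_pow, e2]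

lemma IsGood.integral_sq_le {C₀ : ℝ} (hC₀ : 0 < C₀) {μ : Measure ℂ} (hg : IsGood C₀ μ) {δ : ℝ}
    (hδ : 0 < δ) {B : Set ℂ} (hB : MeasurableSet B) (hfin : μ B ≠ ⊤) :
    ∫ x, ‖∫ y, cauchyKernel δ (x - y) ∂(μ.restrict B)‖ ^ 2 ∂(μ.restrict B) ≤
      C₀ ^ 2 * μ.real B := by
  obtain ⟨h1, h2⟩ := hg.memLp_and_integral_sq_le hC₀ hδ hB hfin
  exact (setIntegral_le_integral ((memLp_two_iff_integrable_sq_norm h1.1).1 h1)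
    (Filter.Eventually.of_forall fun _ => by positivity)).trans h2


/-- `Q` sees a triple of points of the support that is quantitatively non-collinear. -/
def HasNonflatTriple (D s : ℝ) (μ : Measure ℂ) (Q : DyadicSquare) : Prop :=
  ∃ x ∈ μ.support, ∃ y ∈ μ.support, ∃ z ∈ μ.support,
    ‖x - Q.center‖ ≤ D * Q.side ∧ ‖y - Q.center‖ ≤ D * Q.side ∧ ‖z - Q.center‖ ≤ D * Q.side ∧
    s * Q.side ≤ ‖x - y‖ ∧ s * Q.side ≤ ‖x - z‖ ∧ s * Q.side ≤ ‖y - z‖ ∧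
    s * Q.side ^ 2 ≤ |((starRingEnd ℂ) (y - x) * (z - x)).im|

lemma exists_pos_le_side (F : Finset DyadicSquare) {s : ℝ} (hs : 0 < s) :
    ∃ δ : ℝ, 0 < δ ∧ ∀ Q ∈ F, δ ≤ s * Q.side := by
  rcases F.eq_empty_or_nonempty with rfl | hF
  · exact ⟨1, one_pos, by simp⟩
  · obtain ⟨Q₀, -, h⟩ := F.exists_min_image DyadicSquare.side hF
    exact ⟨s * Q₀.side, mul_pos hs Q₀.side_pos, fun Q hQ =>
      mul_le_mul_of_nonneg_left (h Q hQ) hs.le⟩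

lemma norm_sub_ge_of_near {x y x' y' : ℂ} {r : ℝ} (hx : ‖x' - x‖ ≤ r) (hy : ‖y' - y‖ ≤ r) :
    ‖x - y‖ - 2 * r ≤ ‖x' - y'‖ ∧ ‖x' - y'‖ ≤ ‖x - y‖ + 2 * r := by
  constructor
  · have : x - y = -(x' - x) + (x' - y') + (y' - y) := by ring
    have h := norm_add₃_le (a := -(x' - x)) (b := x' - y') (c := y' - y)
    rw [← this, norm_neg] at h
    linarith
  · have : x' - y' = (x' - x) + (x - y) + -(y' - y) := by ring
    have h := norm_add₃_le (a := x' - x) (b := x - y) (c := -(y' - y))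
    rw [← this, norm_neg] at h
    linarith

lemma abs_im_area_ge {x y z x' y' z' : ℂ} {R r : ℝ} (hr : r ≤ R) (hx : ‖x' - x‖ ≤ r)
    (hy : ‖y' - y‖ ≤ r) (hz : ‖z' - z‖ ≤ r) (h1 : ‖y - x‖ ≤ 2 * R) (h2 : ‖z - x‖ ≤ 2 * R) :
    |((starRingEnd ℂ) (y - x) * (z - x)).im| - 12 * R * r ≤
      |((starRingEnd ℂ) (y' - x') * (z' - x')).im| := by
  have hr0 : 0 ≤ r := (norm_nonneg _).trans hx
  set e := (y' - x') - (y - x)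
  set f := (z' - x') - (z - x)
  have he : ‖e‖ ≤ 2 * r := by
    have : e = (y' - y) - (x' - x) := by ring
    rw [this]; linarith [norm_sub_le (y' - y) (x' - x)]
  have hf : ‖f‖ ≤ 2 * r := by
    have : f = (z' - z) - (x' - x) := by ring
    rw [this]; linarith [norm_sub_le (z' - z) (x' - x)]
  have hd : (starRingEnd ℂ) (y' - x') * (z' - x') - (starRingEnd ℂ) (y - x) * (z - x) =
      (starRingEnd ℂ) e * (z - x) + (starRingEnd ℂ) e * f + (starRingEnd ℂ) (y - x) * f := by
    simp only [e, f, map_sub]; ring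
  have hn : ‖(starRingEnd ℂ) (y' - x') * (z' - x') - (starRingEnd ℂ) (y - x) * (z - x)‖ ≤
      12 * R * r := by
    rw [hd]
    refine (norm_add₃_le).trans ?_
    simp only [norm_mul, RCLike.norm_conj]
    have a1 : ‖e‖ * ‖z - x‖ ≤ 2 * r * (2 * R) := by gcongr
    have a2 : ‖e‖ * ‖f‖ ≤ 2 * r * (2 * r) := by gcongr
    have a3 : ‖y - x‖ * ‖f‖ ≤ 2 * R * (2 * r) := by gcongr; linarith
    nlinarith
  have h3 := (Complex.abs_im_le_norm _).trans hn
  rw [Complex.sub_im] at h3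
  have h4 := abs_sub_abs_le_abs_sub ((starRingEnd ℂ) (y - x) * (z - x)).im
    ((starRingEnd ℂ) (y' - x') * (z' - x')).im
  rw [abs_sub_comm] at h4
  linarith

/-- The squares that see a non-flat triple form a Carleson family. -/
lemma exists_sum_side_nonflat_le {C₀ c₀ D s : ℝ} (hC₀ : 0 < C₀) (hc₀ : 0 < c₀) (hD : 1 ≤ D)
    (hs : 0 < s) (hs1 : s ≤ 1) :
    ∃ C : ℝ, 0 ≤ C ∧ ∀ μ : Measure ℂ, IsGood C₀ μ → IsLowerADRegular c₀ μ →
      ∀ (P : DyadicSquare) (F : Finset DyadicSquare),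
        (∀ Q ∈ F, HasNonflatTriple D s μ Q ∧ Q.side ≤ P.side ∧ ‖Q.center - P.center‖ ≤ P.side) →
        ∑ Q ∈ F, Q.side ≤ C * P.side := by
  obtain ⟨N, hN⟩ := DyadicSquare.exists_card_le_of_comparable (3 * D + 2 / s)
    (by have : 0 < 2 / s := by positivity
        linarith)
  set κ : ℝ := s / (32 * D) with hκ
  have hD0 : 0 < D := by linarith
  have hκ0 : 0 < κ := by positivity
  have hκs : κ ≤ s / 32 := by
    rw [hκ]; exact div_le_div_of_nonneg_left hs.le (by norm_num) (by linarith)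
  have hDκ : D * κ = s / 32 := by rw [hκ]; field_simp
  set h₀ : ℝ := s ^ 2 / (2 * (3 * D) ^ 6) * (c₀ * κ) ^ 3 with hh₀
  have hh₀' : 0 < h₀ := by positivity
  refine ⟨N * (3 * (C₀ ^ 2 * (C₀ * (3 * D)))) / h₀, by positivity, fun μ hg hl P F hF => ?_⟩
  have hPs := P.side_pos
  have hn := hg.1
  set B := Metric.ball P.center (3 * D * P.side) with hB
  have hBfin : μ B < ⊤ := hn.measure_ball_lt_top _ _
  set ν := μ.restrict B with hν
  have : IsFiniteMeasure ν := ⟨by rwa [hν, Measure.restrict_apply_univ]⟩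
  obtain ⟨δ, hδ, hδF⟩ := exists_pos_le_side F (s := s / 2) (by positivity)
  set π := ν.prod (ν.prod ν) with hπ
  set ϖ := π.withDensity (fun p => ENNReal.ofReal (curvature δ p)) with hϖ
  choose! x hx y hy z hz hxD hyD hzD hxy hxz hyz hI using fun Q hQ => (hF Q hQ).1
  have htot : ϖ Set.univ ≤ ENNReal.ofReal (3 * (C₀ ^ 2 * (C₀ * (3 * D * P.side)))) := by
    have hint : Integrable (curvature δ) π := by
      refine Integrable.of_bound (continuous_curvature hδ).aestronglyMeasurable
        (1 / δ * (1 / δ) + 1 / δ * (1 / δ) + 1 / δ * (1 / δ))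
        (Filter.Eventually.of_forall fun p => ?_)
      unfold curvature
      refine (norm_add₃_le).trans ?_
      exact add_le_add (add_le_add (abs_kernelProduct_le hδ _) (abs_kernelProduct_le hδ _))
        (abs_kernelProduct_le hδ _)
    rw [hϖ, withDensity_apply _ MeasurableSet.univ, Measure.restrict_univ,
      ← ofReal_integral_eq_lintegral_ofReal hint
        (Filter.Eventually.of_forall fun p => curvature_nonneg hδ p), hπ, integral_curvature hδ ν]
    refine ENNReal.ofReal_le_ofReal ?_
    have := hg.integral_sq_le hC₀ hδ (B := B) measurableSet_ball hBfin.ne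
    have h2 := hn.real_ball_le hC₀ P.center (r := 3 * D * P.side) (by positivity)
    have h3 := mul_le_mul_of_nonneg_left h2 (by positivity : 0 ≤ C₀ ^ 2)
    linarith
  have hpiece : ∀ Q ∈ F, ENNReal.ofReal (h₀ * Q.side) ≤
      ϖ (Metric.ball (x Q) (κ * Q.side) ×ˢ (Metric.ball (y Q) (κ * Q.side) ×ˢ
        Metric.ball (z Q) (κ * Q.side))) := by
    intro Q hQ
    have hQs := Q.side_pos
    have hκD : κ ≤ D := by linarith
    have hκQ : κ * Q.side ≤ D * Q.side := by gcongr
    have hsub : ∀ w, ‖w - Q.center‖ ≤ D * Q.side → Metric.ball w (κ * Q.side) ⊆ B := by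
      intro w hw v hv
      rw [Metric.mem_ball, dist_eq_norm] at *
      have e : v - P.center = (v - w) + (w - Q.center) + (Q.center - P.center) := by ring
      rw [e]
      have h1 := norm_add₃_le (a := v - w) (b := w - Q.center) (c := Q.center - P.center)
      have h2 := (hF Q hQ).2.2
      have h3 : D * Q.side ≤ D * P.side := by gcongr; exact (hF Q hQ).2.1
      nlinarith
    have hmeas : ∀ w ∈ μ.support, ‖w - Q.center‖ ≤ D * Q.side →
        ENNReal.ofReal (c₀ * (κ * Q.side)) ≤ ν (Metric.ball w (κ * Q.side)) := by
      intro w hw hw'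
      rw [hν, Measure.restrict_apply measurableSet_ball, Set.inter_eq_left.2 (hsub w hw')]
      exact hl w hw _ (by positivity)
    have hms : MeasurableSet (Metric.ball (x Q) (κ * Q.side) ×ˢ (Metric.ball (y Q) (κ * Q.side) ×ˢ
        Metric.ball (z Q) (κ * Q.side))) :=
      measurableSet_ball.prod (measurableSet_ball.prod measurableSet_ball)
    have hlow : ∀ p ∈ Metric.ball (x Q) (κ * Q.side) ×ˢ (Metric.ball (y Q) (κ * Q.side) ×ˢ
        Metric.ball (z Q) (κ * Q.side)),
        ENNReal.ofReal (s ^ 2 / (2 * (3 * D) ^ 6) / Q.side ^ 2) ≤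
          ENNReal.ofReal (curvature δ p) := by
      rintro ⟨x', y', z'⟩ ⟨hx', hy', hz'⟩
      simp only [Metric.mem_ball, dist_eq_norm] at hx' hy' hz'
      refine ENNReal.ofReal_le_ofReal ?_
      have hδQ := hδF Q hQ
      have e1 := norm_sub_ge_of_near hx'.le hy'.le
      have e2 := norm_sub_ge_of_near hx'.le hz'.le
      have e3 := norm_sub_ge_of_near hy'.le hz'.le
      have hκQ' : κ * Q.side ≤ s / 32 * Q.side := by gcongr
      have u : ∀ v w : ℂ, ‖v - Q.center‖ ≤ D * Q.side → ‖w - Q.center‖ ≤ D * Q.side →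
          ‖v - w‖ ≤ 2 * (D * Q.side) := by
        intro v w hv hw
        have e : v - w = (v - Q.center) - (w - Q.center) := by ring
        rw [e]; linarith [norm_sub_le (v - Q.center) (w - Q.center)]
      have u1 := u _ _ (hxD Q hQ) (hyD Q hQ)
      have u2 := u _ _ (hxD Q hQ) (hzD Q hQ)
      have u3 := u _ _ (hyD Q hQ) (hzD Q hQ)
      have hss : s * Q.side ≤ D * Q.side := by gcongr; linarith
      have l1 := hxy Q hQ
      have l2 := hxz Q hQ
      have l3 := hyz Q hQ
      have hcur := le_curvature (D := 3 * D * Q.side) hδ (x := x') (y := y') (z := z')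
        (by linarith) (by linarith) (by linarith) (by linarith) (by linarith) (by linarith)
      refine le_trans ?_ hcur
      have area := abs_im_area_ge (R := D * Q.side) hκQ hx'.le hy'.le hz'.le
        (by rw [norm_sub_rev]; exact u1) (by rw [norm_sub_rev]; exact u2)
      have hDQ : 12 * (D * Q.side) * (κ * Q.side) = 12 * (s / 32) * Q.side ^ 2 := by
        rw [← hDκ]; ring
      rw [hDQ] at area
      have area2 : s / 2 * Q.side ^ 2 ≤ |((starRingEnd ℂ) (y' - x') * (z' - x')).im| := by
        have := hI Q hQ
        have h5 : 0 ≤ s * Q.side ^ 2 := by positivity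
        linarith
      have area3 : (s / 2 * Q.side ^ 2) ^ 2 ≤ (((starRingEnd ℂ) (y' - x') * (z' - x')).im) ^ 2 := by
        rw [← sq_abs (((starRingEnd ℂ) (y' - x') * (z' - x')).im)]
        gcongr
      calc s ^ 2 / (2 * (3 * D) ^ 6) / Q.side ^ 2
          = 2 * (s / 2 * Q.side ^ 2) ^ 2 / (3 * D * Q.side) ^ 6 := by field_simp
        _ ≤ _ := by gcongr
    rw [hϖ, withDensity_apply _ hms]
    calc ENNReal.ofReal (h₀ * Q.side)
        = ENNReal.ofReal (s ^ 2 / (2 * (3 * D) ^ 6) / Q.side ^ 2) *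
          (ENNReal.ofReal (c₀ * (κ * Q.side)) * (ENNReal.ofReal (c₀ * (κ * Q.side)) *
            ENNReal.ofReal (c₀ * (κ * Q.side)))) := by
          rw [← ENNReal.ofReal_mul (by positivity), ← ENNReal.ofReal_mul (by positivity),
            ← ENNReal.ofReal_mul (by positivity)]
          congr 1
          rw [hh₀]; field_simp
      _ ≤ ENNReal.ofReal (s ^ 2 / (2 * (3 * D) ^ 6) / Q.side ^ 2) *
          π (Metric.ball (x Q) (κ * Q.side) ×ˢ (Metric.ball (y Q) (κ * Q.side) ×ˢ
            Metric.ball (z Q) (κ * Q.side))) := by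
          rw [hπ, Measure.prod_prod, Measure.prod_prod]
          gcongr
          · exact hmeas _ (hx Q hQ) (hxD Q hQ)
          · exact hmeas _ (hy Q hQ) (hyD Q hQ)
          · exact hmeas _ (hz Q hQ) (hzD Q hQ)
      _ = ∫⁻ p in Metric.ball (x Q) (κ * Q.side) ×ˢ (Metric.ball (y Q) (κ * Q.side) ×ˢ
            Metric.ball (z Q) (κ * Q.side)),
            ENNReal.ofReal (s ^ 2 / (2 * (3 * D) ^ 6) / Q.side ^ 2) ∂π := by
          rw [setLIntegral_const]
      _ ≤ _ := setLIntegral_mono' hms hlow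
  have hov := sum_measure_le_of_overlap ϖ F (fun Q => Metric.ball (x Q) (κ * Q.side) ×ˢ
    (Metric.ball (y Q) (κ * Q.side) ×ˢ Metric.ball (z Q) (κ * Q.side))) Set.univ N
    (fun Q _ => measurableSet_ball.prod (measurableSet_ball.prod measurableSet_ball))
    MeasurableSet.univ (fun _ _ => Set.subset_univ _) ?_
  · have h1 : ENNReal.ofReal (∑ Q ∈ F, h₀ * Q.side) ≤
        ENNReal.ofReal (N * (3 * (C₀ ^ 2 * (C₀ * (3 * D * P.side))))) := by
      rw [ENNReal.ofReal_sum_of_nonneg (fun Q _ => (mul_pos hh₀' Q.side_pos).le),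
        ENNReal.ofReal_mul (by positivity), ENNReal.ofReal_natCast]
      exact (Finset.sum_le_sum hpiece).trans (hov.trans (by gcongr))
    have h2 := (ENNReal.ofReal_le_ofReal_iff (by positivity)).1 h1
    rw [← Finset.mul_sum] at h2
    rw [div_mul_eq_mul_div, le_div_iff₀ hh₀']
    linarith
  · rintro ⟨x', y', z'⟩ G hG hmem
    rcases G.eq_empty_or_nonempty with rfl | ⟨Q₀, hQ₀⟩
    · simp
    have key : ∀ Q ∈ G, s / 2 * Q.side ≤ ‖x' - y'‖ ∧ ‖x' - y'‖ ≤ 3 * D * Q.side ∧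
        ‖Q.center - x'‖ ≤ 3 * D * Q.side := by
      intro Q hQ
      have hQs := Q.side_pos
      obtain ⟨hx', hy', -⟩ := hmem Q hQ
      simp only [Metric.mem_ball, dist_eq_norm] at hx' hy'
      have e1 := norm_sub_ge_of_near hx'.le hy'.le
      have hκQ' : κ * Q.side ≤ s / 32 * Q.side := by gcongr
      have l1 := hxy Q (hG hQ)
      have hss : s * Q.side ≤ D * Q.side := by gcongr; linarith
      have a1 := hxD Q (hG hQ)
      have a2 := hyD Q (hG hQ)
      have hsQ : 0 < s * Q.side := by positivity
      refine ⟨by linarith, ?_, ?_⟩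
      · have e : x Q - y Q = (x Q - Q.center) - (y Q - Q.center) := by ring
        have := norm_sub_le (x Q - Q.center) (y Q - Q.center)
        rw [← e] at this
        linarith
      · have e : Q.center - x' = -((x' - x Q) + (x Q - Q.center)) := by ring
        rw [e, norm_neg]
        linarith [norm_add_le (x' - x Q) (x Q - Q.center)]
    have hd : 0 < ‖x' - y'‖ := by
      have := (key Q₀ hQ₀).1
      have := Q₀.side_pos
      have : 0 < s / 2 * Q₀.side := by positivity
      linarith
    refine hN G x' ‖x' - y'‖ hd fun Q hQ => ?_
    obtain ⟨k1, k2, k3⟩ := key Q hQ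
    have hQs := Q.side_pos
    have hs2 : 0 < 2 / s := by positivity
    refine ⟨by nlinarith, ?_, by nlinarith⟩
    have : Q.side ≤ 2 / s * ‖x' - y'‖ := by
      rw [div_mul_eq_mul_div, le_div_iff₀ hs]; linarith
    nlinarith


/-- An almost orthogonality (Bessel type) inequality. -/
lemma sum_inner_sq_le {E ι : Type*} [NormedAddCommGroup E] [InnerProductSpace ℝ E] (F : Finset ι)
    (v : ι → E) {M : ℝ} (hM : 0 < M) (h : ∀ i ∈ F, ∑ j ∈ F, |inner ℝ (v i) (v j)| ≤ M) (f : E) :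
    ∑ i ∈ F, inner ℝ f (v i) ^ 2 ≤ M * ‖f‖ ^ 2 := by
  set c : ι → ℝ := fun i => inner ℝ f (v i) with hc
  set g : E := ∑ i ∈ F, c i • v i with hg
  set S : ℝ := ∑ i ∈ F, c i ^ 2 with hS
  have h1 : inner ℝ f g = S := by
    rw [hg, inner_sum]
    refine Finset.sum_congr rfl fun i _ => ?_
    rw [inner_smul_right, pow_two]
  have h2 : ‖g‖ ^ 2 ≤ M * S := by
    rw [← real_inner_self_eq_norm_sq, hg, sum_inner]
    have e : ∀ i ∈ F, inner ℝ (c i • v i) (∑ j ∈ F, c j • v j) ≤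
        ∑ j ∈ F, (c i ^ 2 / 2 * |inner ℝ (v i) (v j)| + c j ^ 2 / 2 * |inner ℝ (v i) (v j)|) := by
      intro i _
      rw [inner_sum]
      refine Finset.sum_le_sum fun j _ => ?_
      rw [inner_smul_left, inner_smul_right, RCLike.conj_to_real, ← mul_assoc]
      calc c i * c j * inner ℝ (v i) (v j) ≤ |c i * c j * inner ℝ (v i) (v j)| := le_abs_self _
        _ = |c i * c j| * |inner ℝ (v i) (v j)| := abs_mul _ _
        _ ≤ (c i ^ 2 / 2 + c j ^ 2 / 2) * |inner ℝ (v i) (v j)| := by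
            refine mul_le_mul_of_nonneg_right ?_ (abs_nonneg _)
            rw [abs_le]; constructor <;> nlinarith [sq_nonneg (c i + c j), sq_nonneg (c i - c j)]
        _ = _ := by ring
    refine (Finset.sum_le_sum e).trans ?_
    simp_rw [Finset.sum_add_distrib]
    have e1 : ∑ i ∈ F, ∑ j ∈ F, c i ^ 2 / 2 * |inner ℝ (v i) (v j)| ≤ M * S / 2 := by
      simp_rw [← Finset.mul_sum]
      calc ∑ i ∈ F, c i ^ 2 / 2 * ∑ j ∈ F, |inner ℝ (v i) (v j)| ≤ ∑ i ∈ F, c i ^ 2 / 2 * M :=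
            Finset.sum_le_sum fun i hi => mul_le_mul_of_nonneg_left (h i hi) (by positivity)
        _ = M * S / 2 := by rw [← Finset.sum_mul, ← Finset.sum_div]; ring
    have e2 : ∑ i ∈ F, ∑ j ∈ F, c j ^ 2 / 2 * |inner ℝ (v i) (v j)| =
        ∑ i ∈ F, ∑ j ∈ F, c i ^ 2 / 2 * |inner ℝ (v i) (v j)| := by
      rw [Finset.sum_comm]
      refine Finset.sum_congr rfl fun i _ => Finset.sum_congr rfl fun j _ => ?_
      rw [real_inner_comm]
    rw [e2]; linarith
  have h3 : 0 ≤ ‖M • f - g‖ ^ 2 := by positivity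
  rw [norm_sub_sq_real, inner_smul_left, h1, norm_smul, RCLike.conj_to_real, Real.norm_eq_abs,
    abs_of_pos hM] at h3
  have h4 : M * S ≤ M * (M * ‖f‖ ^ 2) := by nlinarith
  exact le_of_mul_le_mul_left h4 hM

/-- A Lipschitz function with mean zero adapted to the square `Q`, which is close to the support. -/
structure IsMolecule (A R : ℝ) (μ : Measure ℂ) (Q : DyadicSquare) (ψ : ℂ → ℝ) : Prop where
  bound : ∀ x, |ψ x| ≤ A / Q.side
  lip : ∀ x y, |ψ x - ψ y| ≤ A / Q.side ^ 2 * ‖x - y‖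
  supp : ∀ x, ψ x ≠ 0 → ‖x - Q.center‖ ≤ R * Q.side
  mean : ∫ x, ψ x ∂μ = 0
  near : ∃ e ∈ μ.support, ‖e - Q.center‖ ≤ R * Q.side

namespace IsMolecule

variable {A R C₀ c₀ : ℝ} {μ : Measure ℂ} {Q Q' : DyadicSquare} {ψ ψ' : ℂ → ℝ}

lemma const_nonneg (h : IsMolecule A R μ Q ψ) : 0 ≤ A := by
  have := (abs_nonneg _).trans (h.bound 0)
  by_contra! hA
  exact absurd this (not_le.2 (div_neg_of_neg_of_pos hA Q.side_pos))

lemma continuous (h : IsMolecule A R μ Q ψ) : Continuous ψ := by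
  have : LipschitzWith (A / Q.side ^ 2).toNNReal ψ :=
    LipschitzWith.of_dist_le' fun x y => by
      rw [Real.dist_eq, dist_eq_norm]; exact h.lip x y
  exact this.continuous

lemma hasCompactSupport (h : IsMolecule A R μ Q ψ) : HasCompactSupport ψ := by
  refine HasCompactSupport.intro (isCompact_closedBall Q.center (R * Q.side)) fun x hx => ?_
  by_contra hne
  exact hx (by rw [Metric.mem_closedBall, dist_eq_norm]; exact h.supp x hne)

lemma memLp [IsLocallyFiniteMeasure μ] (h : IsMolecule A R μ Q ψ) : MemLp ψ 2 μ :=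
  h.continuous.memLp_of_hasCompactSupport h.hasCompactSupport

lemma integrable [IsLocallyFiniteMeasure μ] (h : IsMolecule A R μ Q ψ) : Integrable ψ μ :=
  h.continuous.integrable_of_hasCompactSupport h.hasCompactSupport

lemma integral_mul_eq_zero (h : IsMolecule A R μ Q ψ) (h' : IsMolecule A R μ Q' ψ')
    (hfar : R * Q.side + R * Q'.side < ‖Q'.center - Q.center‖) : ∫ x, ψ x * ψ' x ∂μ = 0 := by
  have : ∀ x, ψ x * ψ' x = 0 := by
    intro x
    by_contra hne
    have h1 := h.supp x (left_ne_zero_of_mul hne)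
    have h2 := h'.supp x (right_ne_zero_of_mul hne)
    have e : Q'.center - Q.center = (x - Q.center) - (x - Q'.center) := by ring
    have := norm_sub_le (x - Q.center) (x - Q'.center)
    rw [← e] at this
    linarith
  simp [this]

lemma abs_integral_le (hC₀ : 0 < C₀) (hR : 0 < R) (hn : IsNice C₀ μ) (h : IsMolecule A R μ Q ψ)
    {g : ℂ → ℝ} {b : ℝ} (hb0 : 0 ≤ b) (hb : ∀ x, ‖x - Q.center‖ ≤ R * Q.side → |g x| ≤ b) :
    |∫ x, g x * ψ x ∂μ| ≤ 2 * R * C₀ * A * b := by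
  have hs := Q.side_pos
  have hA := h.const_nonneg
  set B := Metric.ball Q.center (2 * R * Q.side)
  have hsub : ∀ x, x ∉ B → g x * ψ x = 0 := by
    intro x hx
    by_contra hne
    have h1 := h.supp x (right_ne_zero_of_mul hne)
    refine hx ?_
    rw [Metric.mem_ball, dist_eq_norm]
    have : 0 < R * Q.side := by positivity
    linarith
  rw [← setIntegral_eq_integral_of_forall_compl_eq_zero hsub, ← Real.norm_eq_abs]
  calc ‖∫ x in B, g x * ψ x ∂μ‖ ≤ b * (A / Q.side) * μ.real B := by
        refine norm_setIntegral_le_of_norm_le_const (hn.measure_ball_lt_top _ _) fun x _ => ?_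
        rw [Real.norm_eq_abs, abs_mul]
        by_cases h0 : ψ x = 0
        · rw [h0, abs_zero, mul_zero]; positivity
        · exact mul_le_mul (hb x (h.supp x h0)) (h.bound x) (abs_nonneg _) hb0
    _ ≤ b * (A / Q.side) * (C₀ * (2 * R * Q.side)) := by
        gcongr
        exact hn.real_ball_le hC₀ _ (by positivity)
    _ = _ := by field_simp

lemma abs_integral_mul_le (hC₀ : 0 < C₀) (hR : 0 < R) (hn : IsNice C₀ μ)
    (h : IsMolecule A R μ Q ψ) (h' : IsMolecule A R μ Q' ψ') :
    |∫ x, ψ x * ψ' x ∂μ| ≤ 2 * R ^ 2 * C₀ * A ^ 2 * (Q'.side / Q.side ^ 2) := by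
  have := hn.isLocallyFiniteMeasure
  have hs := Q.side_pos
  have hs' := Q'.side_pos
  have hA := h.const_nonneg
  have e : ∫ x, ψ x * ψ' x ∂μ = ∫ x, (ψ x - ψ Q'.center) * ψ' x ∂μ := by
    have i1 : Integrable (fun x => ψ x * ψ' x) μ :=
      (h.continuous.mul h'.continuous).integrable_of_hasCompactSupport
        (h'.hasCompactSupport.mul_left)
    have i2 : Integrable (fun x => ψ Q'.center * ψ' x) μ := h'.integrable.const_mul _
    have : ∀ x, (ψ x - ψ Q'.center) * ψ' x = ψ x * ψ' x - ψ Q'.center * ψ' x := fun x => by ring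
    simp_rw [this]
    rw [integral_sub i1 i2, integral_const_mul, h'.mean]; simp
  rw [e]
  have := h'.abs_integral_le hC₀ hR hn (g := fun x => ψ x - ψ Q'.center)
    (b := A / Q.side ^ 2 * (R * Q'.side)) (by positivity) (fun x hx =>
      (h.lip x _).trans (by gcongr))
  refine this.trans (le_of_eq ?_)
  field_simp

end IsMolecule

lemma exists_sum_pow_natAbs_le {r : ℝ} (h0 : 0 ≤ r) (h1 : r < 1) :
    ∃ S : ℝ, 0 < S ∧ ∀ (T : Finset ℤ) (j : ℤ), ∑ i ∈ T, r ^ (j - i).natAbs ≤ S := by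
  have hs : Summable (fun n : ℤ => r ^ n.natAbs) := by
    refine Summable.of_nat_of_neg ?_ ?_ <;> simpa using summable_geometric_of_lt_one h0 h1
  refine ⟨∑' n : ℤ, r ^ n.natAbs + 1, by positivity, fun T j => ?_⟩
  classical
  have : ∑ i ∈ T, r ^ (j - i).natAbs = ∑ n ∈ T.image (fun i => j - i), r ^ n.natAbs := by
    rw [Finset.sum_image]
    intro a _ b _ hab
    simpa using hab
  rw [this]
  have := hs.sum_le_tsum (T.image (fun i => j - i)) (fun _ _ => by positivity)
  linarith

lemma weighted_ratio_eq {j j' : ℤ} (hjj : j' ≤ j) :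
    √((2 : ℝ) ^ j * (2 : ℝ) ^ j') * ((2 : ℝ) ^ j' / ((2 : ℝ) ^ j) ^ 2) =
      √(1 / 2) ^ (j - j').natAbs * (1 / 2) ^ (j - j').natAbs := by
  obtain ⟨i, hi⟩ := Int.le.dest hjj
  have e : (j - j').natAbs = i := by omega
  rw [e, ← hi]
  have hp : (0 : ℝ) < 2 ^ j' := zpow_pos two_pos _
  have h2 : (2 : ℝ) ^ (j' + (i : ℤ)) = 2 ^ j' * 2 ^ i := by
    rw [zpow_add₀ two_ne_zero, zpow_natCast]
  rw [h2]
  have h3 : (2 : ℝ) ^ j' * 2 ^ i * 2 ^ j' = (2 ^ j' * 2 ^ i) ^ 2 * (1 / 2) ^ i := by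
    rw [div_pow, one_pow]; field_simp
  have h4 : √(1 / 2 : ℝ) ^ i = √((1 / 2) ^ i) := by
    rw [Real.sqrt_eq_rpow, Real.sqrt_eq_rpow, ← Real.rpow_natCast, ← Real.rpow_mul (by norm_num),
      mul_comm, Real.rpow_mul (by norm_num), Real.rpow_natCast]
  rw [h3, Real.sqrt_mul (by positivity), Real.sqrt_sq (by positivity), h4, div_pow]
  field_simp
  exact (one_pow i).symm

/-- Families of molecules satisfy a Bessel inequality (they form a Riesz system). -/
lemma exists_riesz_system {C₀ c₀ A R : ℝ} (hC₀ : 0 < C₀) (hc₀ : 0 < c₀) (hA : 0 < A)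
    (hR : 0 < R) :
    ∃ M : ℝ, 0 < M ∧ ∀ μ : Measure ℂ, IsNice C₀ μ → IsLowerADRegular c₀ μ →
      ∀ (F : Finset DyadicSquare) (ψ : DyadicSquare → ℂ → ℝ),
        (∀ Q ∈ F, IsMolecule A R μ Q (ψ Q)) → ∀ f : ℂ → ℝ, MemLp f 2 μ →
          ∑ Q ∈ F, Q.side * (∫ x, f x * ψ Q x ∂μ) ^ 2 ≤ M * ∫ x, f x ^ 2 ∂μ := by
  classical
  have hr1 : √(1 / 2 : ℝ) < 1 := by rw [Real.sqrt_lt' one_pos]; norm_num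
  obtain ⟨S, hS, hSum⟩ := exists_sum_pow_natAbs_le (Real.sqrt_nonneg (1 / 2)) hr1
  set G : ℝ := 2 * R ^ 2 * C₀ * A ^ 2 with hG
  set N : ℝ := (4 * R + 1) ^ 2 + ((2 * R + 3) ^ 2 + 1) * (C₀ * (3 * R + 1)) / c₀ with hN
  have hG0 : 0 < G := by positivity
  have hN0 : 0 < N := by positivity
  refine ⟨G * N * S, by positivity, fun μ hn hl F ψ hψ f hf => ?_⟩
  have := hn.isLocallyFiniteMeasure
  set v : DyadicSquare → Lp ℝ 2 μ := fun Q =>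
    if h : IsMolecule A R μ Q (ψ Q) then √Q.side • h.memLp.toLp else 0 with hv
  have hv' : ∀ (Q) (hQ : Q ∈ F), v Q = √Q.side • (hψ Q hQ).memLp.toLp := fun Q hQ => by
    simp [hv, hψ Q hQ]
  have inner_eq : ∀ (g h : ℂ → ℝ) (hg : MemLp g 2 μ) (hh : MemLp h 2 μ),
      inner ℝ hg.toLp hh.toLp = ∫ x, g x * h x ∂μ := by
    intro g h hg hh
    rw [L2.inner_def]
    refine integral_congr_ae ?_
    filter_upwards [hg.coeFn_toLp, hh.coeFn_toLp] with x h1 h2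
    rw [h1, h2]
    simp [mul_comm]
  have hgram : ∀ Q ∈ F, ∀ Q' ∈ F, inner ℝ (v Q) (v Q') =
      √(Q.side * Q'.side) * ∫ x, ψ Q x * ψ Q' x ∂μ := by
    intro Q hQ Q' hQ'
    rw [hv' Q hQ, hv' Q' hQ', inner_smul_left, inner_smul_right, inner_eq,
      Real.sqrt_mul Q.side_pos.le]
    simp [mul_assoc]
  have hgram_le : ∀ Q ∈ F, ∀ Q' ∈ F, Q'.j ≤ Q.j → |inner ℝ (v Q) (v Q')| ≤
      G * (√(1 / 2) ^ (Q.j - Q'.j).natAbs * (1 / 2) ^ (Q.j - Q'.j).natAbs) := by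
    intro Q hQ Q' hQ' hj
    have h1 := (hψ Q hQ).abs_integral_mul_le hC₀ hR hn (hψ Q' hQ')
    rw [hgram Q hQ Q' hQ', abs_mul, abs_of_nonneg (Real.sqrt_nonneg _)]
    calc √(Q.side * Q'.side) * |∫ x, ψ Q x * ψ Q' x ∂μ|
        ≤ √(Q.side * Q'.side) * (G * (Q'.side / Q.side ^ 2)) := by gcongr
      _ = G * (√(Q.side * Q'.side) * (Q'.side / Q.side ^ 2)) := by ring
      _ = _ := by rw [← weighted_ratio_eq hj]; rfl
  have hgram_zero : ∀ Q ∈ F, ∀ Q' ∈ F, R * Q.side + R * Q'.side < ‖Q'.center - Q.center‖ →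
      inner ℝ (v Q) (v Q') = 0 := by
    intro Q hQ Q' hQ' hfar
    rw [hgram Q hQ Q' hQ', (hψ Q hQ).integral_mul_eq_zero (hψ Q' hQ') hfar, mul_zero]
  have hrow : ∀ Q ∈ F, ∑ Q' ∈ F, |inner ℝ (v Q) (v Q')| ≤ G * N * S := by
    intro Q hQ
    have hs := Q.side_pos
    have hscale : ∀ j' : ℤ, ∑ Q' ∈ F with Q'.j = j', |inner ℝ (v Q) (v Q')| ≤
        G * N * √(1 / 2) ^ (Q.j - j').natAbs := by
      intro j'
      set near := (F.filter (fun Q' => Q'.j = j')).filter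
        (fun Q' => ‖Q'.center - Q.center‖ ≤ R * Q.side + R * Q'.side) with hnear
      have hmem : ∀ Q' ∈ near, Q' ∈ F ∧ Q'.j = j' ∧
          ‖Q'.center - Q.center‖ ≤ R * Q.side + R * Q'.side := by
        intro Q' hQ'
        obtain ⟨h1, h2⟩ := Finset.mem_filter.1 hQ'
        obtain ⟨h3, h4⟩ := Finset.mem_filter.1 h1
        exact ⟨h3, h4, h2⟩
      have e : ∑ Q' ∈ F with Q'.j = j', |inner ℝ (v Q) (v Q')| =
          ∑ Q' ∈ near, |inner ℝ (v Q) (v Q')| := by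
        rw [hnear, Finset.sum_filter_of_ne (s := F.filter (fun Q' => Q'.j = j'))]
        intro Q' hQ' hne
        by_contra hlt
        exact hne (by rw [hgram_zero Q hQ Q' (Finset.mem_filter.1 hQ').1 (not_le.1 hlt), abs_zero])
      rw [e]
      set i := (Q.j - j').natAbs with hi
      have hp1 : (1 / 2 : ℝ) ^ i ≤ 1 := pow_le_one₀ (by norm_num) (by norm_num)
      have hr0 : 0 ≤ √(1 / 2 : ℝ) ^ i := by positivity
      have hterm : ∀ Q' ∈ near, |inner ℝ (v Q) (v Q')| ≤ G * (√(1 / 2) ^ i * (1 / 2) ^ i) := by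
        intro Q' hQ'
        obtain ⟨h1, rfl, -⟩ := hmem Q' hQ'
        rcases le_total Q'.j Q.j with hj | hj
        · exact hgram_le Q hQ Q' h1 hj
        · have := hgram_le Q' h1 Q hQ hj
          rw [real_inner_comm] at this
          have e : (Q'.j - Q.j).natAbs = i := by omega
          rwa [e] at this
      have hcard : (near.card : ℝ) * (1 / 2) ^ i ≤ N := by
        rcases le_total Q.j j' with hj | hj
        · have hle : Q.side ≤ (2 : ℝ) ^ j' := zpow_le_zpow_right₀ one_le_two hj
          have := DyadicSquare.card_le_of_near (F := near) (j := j') (x := Q.center) (K := 2 * R)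
            (by positivity) (fun Q' hQ' => by
              obtain ⟨h1, rfl, h3⟩ := hmem Q' hQ'
              refine ⟨rfl, h3.trans ?_⟩
              have : R * Q.side ≤ R * (2 : ℝ) ^ Q'.j := by gcongr
              have e : Q'.side = (2 : ℝ) ^ Q'.j := rfl
              rw [e]; linarith)
          calc (near.card : ℝ) * (1 / 2) ^ i ≤ near.card * 1 := by gcongr
            _ ≤ (4 * R + 1) ^ 2 := by rw [mul_one]; refine this.trans (le_of_eq ?_); ring
            _ ≤ N := by rw [hN]; exact le_add_of_nonneg_right (by positivity)
        · have hle : (2 : ℝ) ^ j' ≤ Q.side := zpow_le_zpow_right₀ one_le_two hj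
          have hp : (0 : ℝ) < 2 ^ j' := zpow_pos two_pos _
          have := card_mul_le_of_near_support hC₀ hn hl (F := near) (j := j') (x := Q.center)
            (K := R) (ρ := R * Q.side + R * (2 : ℝ) ^ j') hR.le (by positivity) (fun Q' hQ' => by
              obtain ⟨h1, rfl, h3⟩ := hmem Q' hQ'
              exact ⟨rfl, (hψ Q' h1).near, h3⟩)
          have e1 : (2 : ℝ) ^ j' = Q.side * (1 / 2) ^ i := by
            have e2 : Q.j = j' + (i : ℤ) := by omega
            rw [DyadicSquare.side, e2, zpow_add₀ two_ne_zero, zpow_natCast, mul_assoc, ← mul_pow]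
            norm_num
          have h5 : (near.card : ℝ) * (1 / 2) ^ i * (c₀ * Q.side) ≤
              ((2 * R + 3) ^ 2 + 1) * (C₀ * (3 * R + 1)) * Q.side := by
            calc (near.card : ℝ) * (1 / 2) ^ i * (c₀ * Q.side)
                = near.card * (c₀ * (2 : ℝ) ^ j') := by rw [e1]; ring
              _ ≤ _ := this
              _ ≤ ((2 * R + 3) ^ 2 + 1) * (C₀ * (R * Q.side + R * Q.side + (R + 1) * Q.side)) := by
                  gcongr
              _ = _ := by ring
          have h6 : (near.card : ℝ) * (1 / 2) ^ i ≤
              ((2 * R + 3) ^ 2 + 1) * (C₀ * (3 * R + 1)) / c₀ := by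
            rw [le_div_iff₀ hc₀]
            refine le_of_mul_le_mul_right ?_ hs
            linarith
          rw [hN]
          have : 0 ≤ (4 * R + 1) ^ 2 := by positivity
          linarith
      calc ∑ Q' ∈ near, |inner ℝ (v Q) (v Q')| ≤ ∑ Q' ∈ near, G * (√(1 / 2) ^ i * (1 / 2) ^ i) :=
            Finset.sum_le_sum hterm
        _ = G * (near.card * (1 / 2) ^ i) * √(1 / 2) ^ i := by
            rw [Finset.sum_const, nsmul_eq_mul]; ring
        _ ≤ G * N * √(1 / 2) ^ i := by gcongr
    calc ∑ Q' ∈ F, |inner ℝ (v Q) (v Q')|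
        = ∑ j' ∈ F.image DyadicSquare.j, ∑ Q' ∈ F with Q'.j = j', |inner ℝ (v Q) (v Q')| :=
          (Finset.sum_fiberwise_of_maps_to (fun Q' hQ' => Finset.mem_image_of_mem _ hQ') _).symm
      _ ≤ ∑ j' ∈ F.image DyadicSquare.j, G * N * √(1 / 2) ^ (Q.j - j').natAbs :=
          Finset.sum_le_sum fun j' _ => hscale j'
      _ ≤ G * N * S := by
          rw [← Finset.mul_sum]
          have := hSum (F.image DyadicSquare.j) Q.j
          gcongr
  have hmain := sum_inner_sq_le F v (by positivity) hrow hf.toLp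
  have e1 : ‖hf.toLp‖ ^ 2 = ∫ x, f x ^ 2 ∂μ := by
    rw [← real_inner_self_eq_norm_sq, inner_eq]
    simp_rw [pow_two]
  rw [e1] at hmain
  refine le_trans (le_of_eq (Finset.sum_congr rfl fun Q hQ => ?_)) hmain
  rw [hv' Q hQ, inner_smul_right, inner_eq, mul_pow, Real.sq_sqrt Q.side_pos.le]


/-- Coordinate of `x` in the direction of the unit vector `u`. -/
noncomputable def tc (u x : ℂ) : ℝ := ((starRingEnd ℂ) u * x).re

/-- Coordinate of `x` in the direction orthogonal to the unit vector `u`. -/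
noncomputable def yc (u x : ℂ) : ℝ := ((starRingEnd ℂ) u * x).im

/-- The component of the Cauchy kernel in the direction `u`. -/
noncomputable def dirKernel (δ : ℝ) (u x w : ℂ) : ℝ := (u * cauchyKernel δ (x - w)).re

section Coordinates

variable {u x w : ℂ} {δ : ℝ}

lemma tc_sub (u x w : ℂ) : tc u (x - w) = tc u x - tc u w := by simp [tc, mul_sub]

lemma yc_sub (u x w : ℂ) : yc u (x - w) = yc u x - yc u w := by simp [yc, mul_sub]

lemma tc_neg (u x : ℂ) : tc (-u) x = -tc u x := by simp [tc]

lemma yc_neg (u x : ℂ) : yc (-u) x = -yc u x := by simp [yc]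

lemma continuous_tc (u : ℂ) : Continuous (tc u) := by unfold tc; fun_prop

lemma tc_sq_add_yc_sq (hu : ‖u‖ = 1) (x : ℂ) : tc u x ^ 2 + yc u x ^ 2 = ‖x‖ ^ 2 := by
  have h : ‖(starRingEnd ℂ) u * x‖ ^ 2 = ‖x‖ ^ 2 := by
    rw [norm_mul, RCLike.norm_conj, hu, one_mul]
  rw [← h, Complex.sq_norm, Complex.normSq_apply, tc, yc]
  ring

lemma abs_tc_le (hu : ‖u‖ = 1) (x : ℂ) : |tc u x| ≤ ‖x‖ := by
  refine abs_le_of_sq_le_sq ?_ (norm_nonneg _)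
  nlinarith [tc_sq_add_yc_sq hu x, sq_nonneg (yc u x)]

lemma abs_yc_le (hu : ‖u‖ = 1) (x : ℂ) : |yc u x| ≤ ‖x‖ := by
  refine abs_le_of_sq_le_sq ?_ (norm_nonneg _)
  nlinarith [tc_sq_add_yc_sq hu x, sq_nonneg (tc u x)]

lemma norm_le_tc_add_yc (hu : ‖u‖ = 1) (x : ℂ) : ‖x‖ ≤ |tc u x| + |yc u x| := by
  refine le_of_sq_le_sq ?_ (by positivity)
  nlinarith [tc_sq_add_yc_sq hu x, sq_abs (tc u x), sq_abs (yc u x), abs_nonneg (tc u x),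
    abs_nonneg (yc u x)]

lemma dirKernel_eq (δ : ℝ) (u x w : ℂ) :
    dirKernel δ u x w = (tc u x - tc u w) / (max δ ‖x - w‖) ^ 2 := by
  rw [dirKernel, cauchyKernel, ← mul_div_assoc, Complex.div_ofReal_re, ← tc_sub, tc]
  congr 1
  simp only [Complex.mul_re, Complex.conj_re, Complex.conj_im]
  ring

lemma dirKernel_neg (δ : ℝ) (u x w : ℂ) : dirKernel δ (-u) x w = -dirKernel δ u x w := by
  simp [dirKernel]

lemma dirKernel_swap (δ : ℝ) (u x w : ℂ) : dirKernel δ u w x = -dirKernel δ u x w := by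
  rw [dirKernel, dirKernel, ← neg_sub x w, cauchyKernel_neg]; simp

lemma continuous_dirKernel (hδ : 0 < δ) (u : ℂ) :
    Continuous (fun p : ℂ × ℂ => dirKernel δ u p.1 p.2) := by
  have := continuous_cauchyKernel hδ
  unfold dirKernel
  fun_prop

lemma abs_dirKernel_le (hδ : 0 < δ) (hu : ‖u‖ = 1) (x w : ℂ) : |dirKernel δ u x w| ≤ 1 / δ := by
  refine (Complex.abs_re_le_norm _).trans ?_
  rw [norm_mul, hu, one_mul]
  exact norm_cauchyKernel_le hδ _

lemma dirKernel_nonneg (h : tc u w ≤ tc u x) : 0 ≤ dirKernel δ u x w := by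
  rw [dirKernel_eq]; exact div_nonneg (by linarith) (by positivity)

lemma dirKernel_le (hu : ‖u‖ = 1) (h : tc u w < tc u x) :
    dirKernel δ u x w ≤ 1 / (tc u x - tc u w) := by
  have h0 : 0 < tc u x - tc u w := by linarith
  rw [dirKernel_eq]
  have h1 : tc u x - tc u w ≤ max δ ‖x - w‖ := by
    rw [← tc_sub]; exact (le_abs_self _).trans ((abs_tc_le hu _).trans (le_max_right _ _))
  rw [div_le_div_iff₀ (by have := h0.trans_le h1; positivity) h0]
  nlinarith

lemma le_dirKernel {ρ g h : ℝ} (hu : ‖u‖ = 1) (hρ : 0 < ρ) (hg : 0 < g) (hδρ : δ ≤ ρ)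
    (hh : h ^ 2 ≤ ρ * g / 2) (hd : ρ ≤ tc u x - tc u w) (hy : |yc u x - yc u w| ≤ h) :
    1 / (tc u x - tc u w + g) ≤ dirKernel δ u x w ∧
      (tc u x - tc u w ≤ g → h ≤ ρ → 1 / (tc u x - tc u w + g) + 1 / (8 * g) ≤
        dirKernel δ u x w) := by
  set d := tc u x - tc u w with hd'
  have hd0 : 0 < d := hρ.trans_le hd
  have hN : ‖x - w‖ ^ 2 = d ^ 2 + (yc u x - yc u w) ^ 2 := by
    rw [← tc_sq_add_yc_sq hu, tc_sub, yc_sub]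
  have hdn : d ≤ ‖x - w‖ := by
    rw [hd', ← tc_sub]; exact (le_abs_self _).trans (abs_tc_le hu _)
  rw [dirKernel_eq, max_eq_right (by linarith), hN, ← hd']
  have hy2 : (yc u x - yc u w) ^ 2 ≤ h ^ 2 := by
    rw [← sq_abs]; gcongr
  set Y := (yc u x - yc u w) ^ 2
  have hY : 0 ≤ Y := sq_nonneg _
  have hYd : Y ≤ d * g / 2 := by nlinarith
  have hpos : 0 < d ^ 2 + Y := by positivity
  constructor
  · rw [div_le_div_iff₀ (by linarith) hpos]; nlinarith
  · intro hdg hhρ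
    have hYd2 : Y ≤ d ^ 2 := by
      have := (abs_nonneg _).trans hy
      nlinarith
    have e : 1 / (8 * g) ≤ d / (d ^ 2 + Y) - 1 / (d + g) := by
      rw [div_sub_div _ _ hpos.ne' (by linarith), div_le_div_iff₀ (by linarith) (by positivity)]
      have h1 : (d ^ 2 + Y) * (d + g) ≤ 2 * d ^ 2 * (2 * g) := by
        apply mul_le_mul <;> nlinarith
      nlinarith [mul_pos hd0 hg]
    linarith

lemma integrable_dirKernel (hδ : 0 < δ) (hu : ‖u‖ = 1) (ν : Measure ℂ) [IsFiniteMeasure ν]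
    (x : ℂ) : Integrable (fun w => dirKernel δ u x w) ν :=
  Integrable.of_bound ((continuous_dirKernel hδ u).comp (by fun_prop :
    Continuous (fun w : ℂ => (x, w)))).aestronglyMeasurable (1 / δ)
    (Filter.Eventually.of_forall fun _ => abs_dirKernel_le hδ hu _ _)

/-- The integral of the directional kernel. -/
noncomputable def dirPotential (δ : ℝ) (u : ℂ) (ν : Measure ℂ) (x : ℂ) : ℝ :=
  ∫ w, dirKernel δ u x w ∂ν

lemma stronglyMeasurable_dirPotential (hδ : 0 < δ) (u : ℂ) (ν : Measure ℂ) [IsFiniteMeasure ν] :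
    StronglyMeasurable (dirPotential δ u ν) :=
  (continuous_dirKernel hδ u).stronglyMeasurable.integral_prod_right

lemma abs_dirPotential_le (hδ : 0 < δ) (hu : ‖u‖ = 1) (ν : Measure ℂ) [IsFiniteMeasure ν] (x : ℂ) :
    |dirPotential δ u ν x| ≤ 1 / δ * ν.real Set.univ :=
  norm_integral_le_of_norm_le_const (f := fun w => dirKernel δ u x w)
    (Filter.Eventually.of_forall fun _ => abs_dirKernel_le hδ hu _ _)

lemma integrable_mul_dirPotential (hδ : 0 < δ) (hu : ‖u‖ = 1) (ν : Measure ℂ) [IsFiniteMeasure ν]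
    {μ : Measure ℂ} {α : ℂ → ℝ} (hα : Integrable α μ) :
    Integrable (fun x => α x * dirPotential δ u ν x) μ :=
  hα.mul_bdd (c := 1 / δ * ν.real Set.univ)
    (stronglyMeasurable_dirPotential hδ u ν).aestronglyMeasurable
    (Filter.Eventually.of_forall fun x => abs_dirPotential_le hδ hu ν x)

end Coordinates

lemma le_integral_mul_of_le {μ : Measure ℂ} {α U : ℂ → ℝ} {m : ℝ} (hα : Integrable α μ)
    (hαU : Integrable (fun x => α x * U x) μ) (h0 : ∀ x, 0 ≤ α x) (h1 : ∫ x, α x ∂μ = 1)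
    (h : ∀ᵐ x ∂μ, α x ≠ 0 → m ≤ U x) : m ≤ ∫ x, α x * U x ∂μ := by
  calc m = ∫ x, α x * m ∂μ := by rw [integral_mul_const, h1, one_mul]
    _ ≤ _ := by
      refine integral_mono_ae (hα.mul_const m) hαU ?_
      filter_upwards [h] with x hx
      by_cases hz : α x = 0
      · simp [hz]
      · exact mul_le_mul_of_nonneg_left (hx hz) (h0 x)

lemma integral_mul_le_of_le {μ : Measure ℂ} {α U : ℂ → ℝ} {m : ℝ} (hα : Integrable α μ)
    (hαU : Integrable (fun x => α x * U x) μ) (h0 : ∀ x, 0 ≤ α x) (h1 : ∫ x, α x ∂μ = 1)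
    (h : ∀ᵐ x ∂μ, α x ≠ 0 → U x ≤ m) : ∫ x, α x * U x ∂μ ≤ m := by
  have := le_integral_mul_of_le (U := fun x => -U x) (m := -m) hα
    (by simpa [mul_neg] using hαU.neg) h0 h1 (by
      filter_upwards [h] with x hx hz
      linarith [hx hz])
  simp only [mul_neg, integral_neg] at this
  linarith

/-- Symmetrization: a monotone weight has nonnegative energy. -/
lemma integral_mul_dirPotential_nonneg {δ : ℝ} (hδ : 0 < δ) {u : ℂ} (hu : ‖u‖ = 1) {μ : Measure ℂ}
    {S : Set ℂ} (hS : MeasurableSet S) (hfin : μ S ≠ ⊤) {α : ℂ → ℝ} (hα : Integrable α μ)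
    (hmono : ∀ x ∈ S, ∀ w ∈ S, tc u x ≤ tc u w → α x ≤ α w) :
    0 ≤ ∫ x in S, α x * dirPotential δ u (μ.restrict S) x ∂μ := by
  have : IsFiniteMeasure (μ.restrict S) := ⟨by rwa [Measure.restrict_apply_univ, lt_top_iff_ne_top]⟩
  set ν := μ.restrict S
  have hαν : Integrable α ν := hα.restrict
  have hk := continuous_dirKernel hδ u
  have hint : Integrable (fun p : ℂ × ℂ => α p.1 * dirKernel δ u p.1 p.2) (ν.prod ν) :=
    (hαν.comp_fst ν).mul_bdd (c := 1 / δ) hk.aestronglyMeasurable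
      (Filter.Eventually.of_forall fun p => abs_dirKernel_le hδ hu _ _)
  have hint2 : Integrable (fun p : ℂ × ℂ => α p.2 * dirKernel δ u p.1 p.2) (ν.prod ν) :=
    (hαν.comp_snd ν).mul_bdd (c := 1 / δ) hk.aestronglyMeasurable
      (Filter.Eventually.of_forall fun p => abs_dirKernel_le hδ hu _ _)
  have e1 : ∫ x, α x * dirPotential δ u ν x ∂ν =
      ∫ p, α p.1 * dirKernel δ u p.1 p.2 ∂(ν.prod ν) := by
    rw [integral_prod _ hint]
    simp_rw [integral_const_mul]
    rfl
  have e2 : ∫ p, α p.2 * dirKernel δ u p.1 p.2 ∂(ν.prod ν) =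
      -∫ p, α p.1 * dirKernel δ u p.1 p.2 ∂(ν.prod ν) := by
    rw [← integral_prod_swap, ← integral_neg]
    refine integral_congr_ae (Filter.Eventually.of_forall fun p => ?_)
    simp only [Prod.fst_swap, Prod.snd_swap]
    rw [dirKernel_swap]; ring
  have e3 : 0 ≤ ∫ p, (α p.1 * dirKernel δ u p.1 p.2 - α p.2 * dirKernel δ u p.1 p.2)
      ∂(ν.prod ν) := by
    refine integral_nonneg_of_ae ?_
    have hmem : ∀ᵐ x ∂ν, x ∈ S := ae_restrict_mem hS
    have h1 : ∀ᵐ p ∂(ν.prod ν), p.1 ∈ S := Measure.quasiMeasurePreserving_fst.ae hmem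
    have h2 : ∀ᵐ p ∂(ν.prod ν), p.2 ∈ S := Measure.quasiMeasurePreserving_snd.ae hmem
    filter_upwards [h1, h2] with p hp1 hp2
    rw [Pi.zero_apply, ← sub_mul]
    rcases le_total (tc u p.1) (tc u p.2) with h | h
    · have := hmono _ hp1 _ hp2 h
      have h3 := dirKernel_nonneg (δ := δ) h
      rw [dirKernel_swap] at h3
      nlinarith
    · have := hmono _ hp2 _ hp1 h
      exact mul_nonneg (by linarith) (dirKernel_nonneg h)
  rw [integral_sub hint hint2, e2] at e3
  rw [e1]
  linarith

/-- The contribution of the points on one side of a gap to the oscillation of the Cauchy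
transform across the gap. -/
lemma le_integral_potential_one_side {δ ρ h ta tb ε₀ ε₁ : ℝ} (hδ : 0 < δ) (hδρ : δ ≤ ρ)
    (htab : ta < tb) (hh : h ^ 2 ≤ ρ * (tb - ta) / 2) (hhρ : h ≤ ρ) {u : ℂ}
    (hu : ‖u‖ = 1) {μ : Measure ℂ} {S : Set ℂ} (hS : MeasurableSet S) (hfin : μ S ≠ ⊤)
    (hSt : ∀ x ∈ S, tc u x ≤ ta) (hSy : ∀ x ∈ S, ∀ w ∈ S, |yc u x - yc u w| ≤ h)
    {α β : ℂ → ℝ} (hα : Integrable α μ) (hβ : Integrable β μ) (hα0 : ∀ x, 0 ≤ α x)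
    (hβ0 : ∀ x, 0 ≤ β x) (hα1 : ∫ x, α x ∂μ = 1) (hβ1 : ∫ x, β x ∂μ = 1)
    (hαs : ∀ᵐ x ∂μ, α x ≠ 0 → x ∈ S ∧ ta - ρ ≤ tc u x)
    (hαm : ∀ x ∈ S, ∀ w ∈ S, tc u x ≤ tc u w → α x ≤ α w)
    (hβs : ∀ᵐ x ∂μ, β x ≠ 0 → tb ≤ tc u x)
    (hε₀ : μ.real (S ∩ {x | ta - 2 * ρ < tc u x}) ≤ ε₀ * (tb - ta))
    (hε₁ : ε₁ * (tb - ta) ≤ μ.real (S ∩ {x | tc u x ≤ ta - 2 * ρ} ∩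
      {x | ta - (tb - ta) / 2 < tc u x})) :
    ε₁ / 8 - ε₀ ≤ ∫ x, (α x - β x) * dirPotential δ u (μ.restrict S) x ∂μ := by
  have hρ : 0 < ρ := hδ.trans_le hδρ
  set g := tb - ta with hg
  have hg0 : 0 < g := by linarith
  have hct := continuous_tc u
  set S₀ := S ∩ {x | ta - 2 * ρ < tc u x} with hS₀
  set S₁ := S ∩ {x | tc u x ≤ ta - 2 * ρ} with hS₁
  have mS₀ : MeasurableSet S₀ := hS.inter (measurableSet_lt measurable_const hct.measurable)
  have mS₁ : MeasurableSet S₁ := hS.inter (measurableSet_le hct.measurable measurable_const)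
  have f₀ : μ S₀ ≠ ⊤ := measure_ne_top_of_subset Set.inter_subset_left hfin
  have f₁ : μ S₁ ≠ ⊤ := measure_ne_top_of_subset Set.inter_subset_left hfin
  have i₀ : IsFiniteMeasure (μ.restrict S₀) :=
    ⟨by rwa [Measure.restrict_apply_univ, lt_top_iff_ne_top]⟩
  have i₁ : IsFiniteMeasure (μ.restrict S₁) :=
    ⟨by rwa [Measure.restrict_apply_univ, lt_top_iff_ne_top]⟩
  have hdisj : Disjoint S₀ S₁ := by
    rw [Set.disjoint_left]
    rintro x ⟨-, h1⟩ ⟨-, h2⟩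
    rw [Set.mem_ofPred_eq] at h1 h2
    linarith
  have hunion : S = S₀ ∪ S₁ := by
    rw [hS₀, hS₁, ← Set.inter_union_distrib_left]
    refine (Set.inter_eq_left.2 fun x _ => ?_).symm
    exact lt_or_ge (ta - 2 * ρ) (tc u x)
  have hsplit : ∀ x, dirPotential δ u (μ.restrict S) x =
      dirPotential δ u (μ.restrict S₀) x + dirPotential δ u (μ.restrict S₁) x := by
    intro x
    rw [hunion, Measure.restrict_union hdisj mS₁]
    exact integral_add_measure (integrable_dirKernel hδ hu _ x) (integrable_dirKernel hδ hu _ x)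
  have hα₀ := integrable_mul_dirPotential hδ hu (μ.restrict S₀) hα
  have hα₁ := integrable_mul_dirPotential hδ hu (μ.restrict S₁) hα
  have hβ₀ := integrable_mul_dirPotential hδ hu (μ.restrict S₀) hβ
  have hβ₁ := integrable_mul_dirPotential hδ hu (μ.restrict S₁) hβ
  have hexp : ∫ x, (α x - β x) * dirPotential δ u (μ.restrict S) x ∂μ =
      ∫ x, α x * dirPotential δ u (μ.restrict S₀) x ∂μ +
      ∫ x, α x * dirPotential δ u (μ.restrict S₁) x ∂μ -
      (∫ x, β x * dirPotential δ u (μ.restrict S₀) x ∂μ +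
      ∫ x, β x * dirPotential δ u (μ.restrict S₁) x ∂μ) := by
    rw [← integral_add hα₀ hα₁, ← integral_add hβ₀ hβ₁,
      ← integral_sub (by exact hα₀.add hα₁) (by exact hβ₀.add hβ₁)]
    refine integral_congr_ae (Filter.Eventually.of_forall fun x => ?_)
    simp only [hsplit]; ring
  have hself : 0 ≤ ∫ x, α x * dirPotential δ u (μ.restrict S₀) x ∂μ := by
    have e : ∫ x in S₀, α x * dirPotential δ u (μ.restrict S₀) x ∂μ =
        ∫ x, α x * dirPotential δ u (μ.restrict S₀) x ∂μ := by
      refine setIntegral_eq_integral_of_ae_compl_eq_zero ?_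
      filter_upwards [hαs] with x hx hx0
      by_contra hne
      have h1 := hx (left_ne_zero_of_mul hne)
      exact hx0 ⟨h1.1, show ta - 2 * ρ < tc u x by linarith [h1.2]⟩
    rw [← e]
    exact integral_mul_dirPotential_nonneg hδ hu mS₀ f₀ hα
      (fun x hx w hw => hαm x hx.1 w hw.1)
  have hcross : ∫ x, β x * dirPotential δ u (μ.restrict S₀) x ∂μ ≤ ε₀ := by
    refine integral_mul_le_of_le hβ hβ₀ hβ0 hβ1 ?_
    filter_upwards [hβs] with x hx hx0
    have hxt := hx hx0
    calc dirPotential δ u (μ.restrict S₀) x ≤ ∫ w, 1 / g ∂(μ.restrict S₀) := by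
          refine integral_mono_ae (integrable_dirKernel hδ hu _ x) (integrable_const _) ?_
          filter_upwards [ae_restrict_mem mS₀] with w hw
          have hwt := hSt w hw.1
          refine (dirKernel_le hu (by linarith)).trans ?_
          exact one_div_le_one_div_of_le hg0 (by linarith)
      _ = μ.real S₀ / g := by
          rw [integral_const, measureReal_restrict_apply_univ, smul_eq_mul]; ring
      _ ≤ ε₀ := by rw [div_le_iff₀ hg0]; exact hε₀
  have hi1 : Integrable (fun w => 1 / (tb - tc u w)) (μ.restrict S₁) := by
    refine Integrable.of_bound (Measurable.aestronglyMeasurable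
      (measurable_const.div (measurable_const.sub hct.measurable))) (1 / g) ?_
    filter_upwards [ae_restrict_mem mS₁] with w hw
    have hwt := hSt w hw.1
    rw [Real.norm_eq_abs, abs_of_nonneg (by apply div_nonneg <;> linarith)]
    exact one_div_le_one_div_of_le hg0 (by linarith)
  set m := ∫ w, 1 / (tb - tc u w) ∂(μ.restrict S₁) with hm
  have hbeta : ∫ x, β x * dirPotential δ u (μ.restrict S₁) x ∂μ ≤ m := by
    refine integral_mul_le_of_le hβ hβ₁ hβ0 hβ1 ?_
    filter_upwards [hβs] with x hx hx0
    have hxt := hx hx0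
    refine integral_mono_ae (integrable_dirKernel hδ hu _ x) hi1 ?_
    filter_upwards [ae_restrict_mem mS₁] with w hw
    have hwt := hSt w hw.1
    refine (dirKernel_le hu (by linarith)).trans ?_
    exact one_div_le_one_div_of_le (by linarith) (by linarith)
  have halpha : m + ε₁ / 8 ≤ ∫ x, α x * dirPotential δ u (μ.restrict S₁) x ∂μ := by
    refine le_integral_mul_of_le hα hα₁ hα0 hα1 ?_
    filter_upwards [hαs] with x hx hx0
    obtain ⟨hxS, hxt⟩ := hx hx0
    have hxt' := hSt x hxS
    set V : Set ℂ := {x | ta - g / 2 < tc u x} with hV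
    have mV : MeasurableSet V := measurableSet_lt measurable_const hct.measurable
    have hi2 : Integrable (V.indicator (fun _ => 1 / (8 * g))) (μ.restrict S₁) :=
      (integrable_const _).indicator mV
    have e : ∫ w, (1 / (tb - tc u w) + V.indicator (fun _ => 1 / (8 * g)) w) ∂(μ.restrict S₁) =
        m + μ.real (S₁ ∩ V) / (8 * g) := by
      rw [integral_add hi1 hi2, integral_indicator mV, setIntegral_const, smul_eq_mul,
        measureReal_restrict_apply mV, Set.inter_comm]
      ring
    have e2 : ε₁ / 8 ≤ μ.real (S₁ ∩ V) / (8 * g) := by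
      rw [div_le_div_iff₀ (by norm_num) (by positivity)]
      linarith
    refine (add_le_add_right e2 m).trans ?_
    rw [← e]
    refine integral_mono_ae (hi1.add hi2) (integrable_dirKernel hδ hu _ x) ?_
    filter_upwards [ae_restrict_mem mS₁] with w hw
    have hwt : tc u w ≤ ta - 2 * ρ := hw.2
    obtain ⟨k1, k2⟩ := le_dirKernel (δ := δ) hu hρ hg0 hδρ hh (x := x) (w := w) (by linarith)
      (hSy x hxS w hw.1)
    have hle : 1 / (tb - tc u w) ≤ 1 / (tc u x - tc u w + g) :=
      one_div_le_one_div_of_le (by linarith) (by linarith)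
    by_cases hwV : w ∈ V
    · have hwV' : ta - g / 2 < tc u w := hwV
      rw [Set.indicator_of_mem hwV]
      have := k2 (by linarith) hhρ
      linarith
    · rw [Set.indicator_of_notMem hwV]
      linarith
  rw [hexp]
  linarith


/-- Linear growth bounds the tail integral of `1 / |w - c|²`. -/
lemma IsNice.integral_inv_sq_le {C₀ : ℝ} (hC₀ : 0 < C₀) {μ : Measure ℂ} (hn : IsNice C₀ μ) {c : ℂ}
    {r : ℝ} (hr : 0 < r) {T : Set ℂ} (hT : ∀ w ∈ T, r ≤ ‖w - c‖) :
    ∫ w in T, 1 / ‖w - c‖ ^ 2 ∂μ ≤ 4 * C₀ / r := by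
  have hlin : ∫⁻ w in T, ENNReal.ofReal (1 / ‖w - c‖ ^ 2) ∂μ ≤ ENNReal.ofReal (4 * C₀ / r) := by
    set N : ℕ → Set ℂ := fun n => Metric.ball c (2 ^ (n + 1) * r) \ Metric.ball c (2 ^ n * r)
    have hsub : T ⊆ ⋃ n, N n := by
      intro w hw
      have h1 : 1 ≤ ‖w - c‖ / r := by rw [le_div_iff₀ hr, one_mul]; exact hT w hw
      obtain ⟨n, hn1, hn2⟩ := exists_nat_pow_near h1 one_lt_two
      rw [le_div_iff₀ hr] at hn1
      rw [div_lt_iff₀ hr] at hn2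
      refine Set.mem_iUnion.2 ⟨n, ?_, ?_⟩
      · rw [Metric.mem_ball, dist_eq_norm]; exact hn2
      · rw [Metric.mem_ball, dist_eq_norm, not_lt]; exact hn1
    have hpiece : ∀ n, ∫⁻ w in N n, ENNReal.ofReal (1 / ‖w - c‖ ^ 2) ∂μ ≤
        ENNReal.ofReal (2 * C₀ / r * (1 / 2) ^ n) := by
      intro n
      have hp : (0 : ℝ) < 2 ^ n := by positivity
      calc ∫⁻ w in N n, ENNReal.ofReal (1 / ‖w - c‖ ^ 2) ∂μ
          ≤ ∫⁻ w in N n, ENNReal.ofReal (1 / (2 ^ n * r) ^ 2) ∂μ := by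
            refine setLIntegral_mono' (measurableSet_ball.diff measurableSet_ball) fun w hw => ?_
            have h1 : 2 ^ n * r ≤ ‖w - c‖ := by
              have := hw.2
              rwa [Metric.mem_ball, dist_eq_norm, not_lt] at this
            refine ENNReal.ofReal_le_ofReal (one_div_le_one_div_of_le (by positivity) ?_)
            gcongr
        _ = ENNReal.ofReal (1 / (2 ^ n * r) ^ 2) * μ (N n) := by rw [setLIntegral_const]
        _ ≤ ENNReal.ofReal (1 / (2 ^ n * r) ^ 2) * ENNReal.ofReal (C₀ * (2 ^ (n + 1) * r)) := by
            gcongr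
            exact (measure_mono Set.sdiff_subset).trans (hn c _ (by positivity))
        _ = _ := by
            rw [← ENNReal.ofReal_mul (by positivity)]
            congr 1
            rw [div_pow, one_pow]
            field_simp
            ring
    calc ∫⁻ w in T, ENNReal.ofReal (1 / ‖w - c‖ ^ 2) ∂μ
        ≤ ∫⁻ w in ⋃ n, N n, ENNReal.ofReal (1 / ‖w - c‖ ^ 2) ∂μ := lintegral_mono_set hsub
      _ ≤ ∑' n, ∫⁻ w in N n, ENNReal.ofReal (1 / ‖w - c‖ ^ 2) ∂μ := lintegral_iUnion_le _ _
      _ ≤ ∑' n : ℕ, ENNReal.ofReal (2 * C₀ / r * (1 / 2) ^ n) := ENNReal.tsum_le_tsum hpiece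
      _ = ENNReal.ofReal (4 * C₀ / r) := by
          rw [← ENNReal.ofReal_tsum_of_nonneg (fun n => by positivity)
            (summable_geometric_two.mul_left _), tsum_mul_left, tsum_geometric_two]
          congr 1; ring
  by_cases hint : AEStronglyMeasurable (fun w => 1 / ‖w - c‖ ^ 2) (μ.restrict T)
  · rw [integral_eq_lintegral_of_nonneg_ae (Filter.Eventually.of_forall fun _ => by positivity) hint]
    exact ENNReal.toReal_le_of_le_ofReal (by positivity) hlin
  · rw [integral_non_aestronglyMeasurable hint]; positivity

lemma norm_cauchyKernel_sub_le {δ : ℝ} {x c w : ℂ} (hδ : 0 < δ) (h1 : ‖x - c‖ ≤ ‖w - c‖ / 2)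
    (h2 : δ ≤ ‖w - c‖ / 2) :
    ‖cauchyKernel δ (x - w) - cauchyKernel δ (c - w)‖ ≤ 2 * ‖x - c‖ * (1 / ‖w - c‖ ^ 2) := by
  have inv : ∀ v : ℂ, δ ≤ ‖v‖ → cauchyKernel δ v = v⁻¹ := by
    intro v hv
    rw [cauchyKernel, max_eq_right hv, Complex.inv_def, ← Complex.normSq_eq_norm_sq,
      Complex.ofReal_inv, div_eq_mul_inv]
  have hcw : ‖c - w‖ = ‖w - c‖ := norm_sub_rev _ _
  have hw : 0 < ‖w - c‖ := by linarith
  have hxw : ‖w - c‖ / 2 ≤ ‖x - w‖ := by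
    have e : w - c = (x - c) - (x - w) := by ring
    have := norm_sub_le (x - c) (x - w)
    rw [← e] at this
    linarith
  have hx0 : x - w ≠ 0 := norm_pos_iff.1 (by linarith)
  have hc0 : c - w ≠ 0 := norm_pos_iff.1 (by linarith)
  rw [inv _ (by linarith), inv _ (by linarith), inv_sub_inv hx0 hc0, norm_div, norm_mul, hcw]
  have e : ‖c - w - (x - w)‖ = ‖x - c‖ := by rw [← norm_neg]; congr 1; ring
  rw [e, mul_one_div, div_le_div_iff₀ (by nlinarith) (by positivity)]
  nlinarith [norm_nonneg (x - c), mul_le_mul_of_nonneg_left hxw (norm_nonneg (x - c))]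

/-- The potential of far away mass is almost constant. -/
lemma abs_dirPotential_sub_le {C₀ δ r : ℝ} (hC₀ : 0 < C₀) {μ : Measure ℂ} (hn : IsNice C₀ μ)
    {u : ℂ} (hu : ‖u‖ = 1) (hδ : 0 < δ) (hδr : δ ≤ r / 2) {T : Set ℂ} (hTm : MeasurableSet T)
    (hfin : μ T ≠ ⊤) {c x : ℂ} (hT : ∀ w ∈ T, r ≤ ‖w - c‖) (hx : ‖x - c‖ ≤ r / 2) :
    |dirPotential δ u (μ.restrict T) x - dirPotential δ u (μ.restrict T) c| ≤
      2 * ‖x - c‖ * (4 * C₀ / r) := by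
  have : IsFiniteMeasure (μ.restrict T) := ⟨by rwa [Measure.restrict_apply_univ, lt_top_iff_ne_top]⟩
  have hr : 0 < r := by linarith
  rw [dirPotential, dirPotential, ← integral_sub (integrable_dirKernel hδ hu _ x)
    (integrable_dirKernel hδ hu _ c), ← Real.norm_eq_abs]
  have hint : Integrable (fun w => 1 / ‖w - c‖ ^ 2) (μ.restrict T) := by
    refine Integrable.of_bound (Measurable.aestronglyMeasurable (by fun_prop)) (1 / r ^ 2) ?_
    filter_upwards [ae_restrict_mem hTm] with w hw
    rw [Real.norm_eq_abs, abs_of_nonneg (by positivity)]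
    refine one_div_le_one_div_of_le (by positivity) ?_
    have := hT w hw
    gcongr
  calc ‖∫ w in T, (dirKernel δ u x w - dirKernel δ u c w) ∂μ‖
      ≤ ∫ w in T, 2 * ‖x - c‖ * (1 / ‖w - c‖ ^ 2) ∂μ := by
        refine norm_integral_le_of_norm_le (hint.const_mul _) ?_
        filter_upwards [ae_restrict_mem hTm] with w hw
        have hw' := hT w hw
        rw [dirKernel, dirKernel, ← Complex.sub_re, ← mul_sub, Real.norm_eq_abs]
        refine (Complex.abs_re_le_norm _).trans ?_
        rw [norm_mul, hu, one_mul]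
        exact norm_cauchyKernel_sub_le hδ (by linarith) (by linarith)
    _ = 2 * ‖x - c‖ * ∫ w in T, 1 / ‖w - c‖ ^ 2 ∂μ := integral_const_mul _ _
    _ ≤ _ := by
        gcongr
        exact hn.integral_inv_sq_le hC₀ hr hT

/-- A tent function in the direction `u`, cut off in the orthogonal direction. -/
noncomputable def tent (u a : ℂ) (ρ h : ℝ) (x : ℂ) : ℝ :=
  max 0 (1 - |tc u (x - a)| / ρ - max 0 (|yc u (x - a)| - h) / ρ)

lemma abs_max_zero_sub_le (a b : ℝ) : |max 0 a - max 0 b| ≤ |a - b| := by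
  have := abs_max_sub_max_le_max 0 a 0 b
  simpa using this

lemma abs_tent_sub_le {u a : ℂ} (hu : ‖u‖ = 1) {ρ : ℝ} (hρ : 0 < ρ) (h : ℝ) (x w : ℂ) :
    |tent u a ρ h x - tent u a ρ h w| ≤ 2 / ρ * ‖x - w‖ := by
  have e0 : x - w = (x - a) - (w - a) := by ring
  have h1 : abs (|tc u (x - a)| - |tc u (w - a)|) ≤ ‖x - w‖ := by
    refine (abs_abs_sub_abs_le_abs_sub _ _).trans ?_
    rw [← tc_sub, ← e0]; exact abs_tc_le hu _
  have h2 : |max 0 (|yc u (x - a)| - h) - max 0 (|yc u (w - a)| - h)| ≤ ‖x - w‖ := by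
    refine (abs_max_zero_sub_le _ _).trans ?_
    rw [sub_sub_sub_cancel_right]
    refine (abs_abs_sub_abs_le_abs_sub _ _).trans ?_
    rw [← yc_sub, ← e0]; exact abs_yc_le hu _
  refine (abs_max_zero_sub_le _ _).trans ?_
  rw [abs_le] at *
  have e : 1 - |tc u (x - a)| / ρ - max 0 (|yc u (x - a)| - h) / ρ -
      (1 - |tc u (w - a)| / ρ - max 0 (|yc u (w - a)| - h) / ρ) =
      (-(|tc u (x - a)| - |tc u (w - a)|) -
        (max 0 (|yc u (x - a)| - h) - max 0 (|yc u (w - a)| - h))) / ρ := by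
    field_simp; ring
  rw [e, div_mul_eq_mul_div, ← neg_div]
  constructor <;> gcongr <;> linarith [h1.1, h1.2, h2.1, h2.2]

/-- Normalized tent functions. -/
lemma exists_normalized_tent {C₀ c₀ : ℝ} (hc₀ : 0 < c₀) {μ : Measure ℂ}
    (hn : IsNice C₀ μ) (hl : IsLowerADRegular c₀ μ) {u a : ℂ} (hu : ‖u‖ = 1)
    (ha : a ∈ μ.support) {ρ h : ℝ} (hρ : 0 < ρ) (hh : 0 ≤ h) :
    ∃ α : ℂ → ℝ, Integrable α μ ∧ (∀ x, 0 ≤ α x) ∧ ∫ x, α x ∂μ = 1 ∧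
      (∀ x, α x ≤ 8 / (c₀ * ρ)) ∧ (∀ x w, |α x - α w| ≤ 16 / (c₀ * ρ ^ 2) * ‖x - w‖) ∧
      (∀ x, α x ≠ 0 → |tc u (x - a)| < ρ ∧ |yc u (x - a)| < ρ + h) ∧
      (∀ x w, |yc u (x - a)| ≤ h → |yc u (w - a)| ≤ h → |tc u (w - a)| ≤ |tc u (x - a)| →
        α x ≤ α w) := by
  have := hn.isLocallyFiniteMeasure
  set φ := tent u a ρ h with hφ
  have hφ0 : ∀ x, 0 ≤ φ x := fun x => le_max_left _ _
  have hφ1 : ∀ x, φ x ≤ 1 := fun x => by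
    refine max_le zero_le_one ?_
    have : 0 ≤ |tc u (x - a)| / ρ := by positivity
    have : 0 ≤ max 0 (|yc u (x - a)| - h) / ρ := by positivity
    linarith
  have hlip := abs_tent_sub_le (a := a) hu hρ h
  have hcont : Continuous φ :=
    (LipschitzWith.of_dist_le' (K := 2 / ρ) fun x y => by
      rw [Real.dist_eq, dist_eq_norm]; exact hlip x y).continuous
  have hsupp : ∀ x, φ x ≠ 0 → |tc u (x - a)| < ρ ∧ |yc u (x - a)| < ρ + h := by
    intro x hx
    have hpos : 0 < 1 - |tc u (x - a)| / ρ - max 0 (|yc u (x - a)| - h) / ρ := by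
      by_contra! hneg
      exact hx (max_eq_left hneg)
    have h1 : 0 ≤ |tc u (x - a)| / ρ := by positivity
    have h2 : 0 ≤ max 0 (|yc u (x - a)| - h) / ρ := by positivity
    constructor
    · have : |tc u (x - a)| / ρ < 1 := by linarith
      rwa [div_lt_one hρ] at this
    · have : max 0 (|yc u (x - a)| - h) / ρ < 1 := by linarith
      rw [div_lt_one hρ] at this
      linarith [le_max_right 0 (|yc u (x - a)| - h)]
  have hcs : HasCompactSupport φ := by
    refine HasCompactSupport.intro (isCompact_closedBall a (2 * ρ + h)) fun x hx => ?_
    by_contra hne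
    obtain ⟨h1, h2⟩ := hsupp x hne
    refine hx ?_
    rw [Metric.mem_closedBall, dist_eq_norm]
    linarith [norm_le_tc_add_yc hu (x - a)]
  have hint : Integrable φ μ := hcont.integrable_of_hasCompactSupport hcs
  set m := ∫ x, φ x ∂μ with hm
  have hm_lower : c₀ * ρ / 8 ≤ m := by
    have hball : ∀ x ∈ Metric.ball a (ρ / 4), 1 / 2 ≤ φ x := by
      intro x hx
      rw [Metric.mem_ball, dist_eq_norm] at hx
      have h1 := (abs_tc_le hu (x - a)).trans hx.le
      have h2 := (abs_yc_le hu (x - a)).trans hx.le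
      refine le_trans ?_ (le_max_right _ _)
      have h3 : |tc u (x - a)| / ρ ≤ 1 / 4 := by rw [div_le_iff₀ hρ]; linarith
      have h4 : max 0 (|yc u (x - a)| - h) / ρ ≤ 1 / 4 := by
        rw [div_le_iff₀ hρ]; exact max_le (by positivity) (by linarith)
      linarith
    calc c₀ * ρ / 8 = 1 / 2 * (c₀ * (ρ / 4)) := by ring
      _ ≤ 1 / 2 * μ.real (Metric.ball a (ρ / 4)) := by
          gcongr; exact hl.le_real_ball hn ha (by positivity)
      _ = ∫ x in Metric.ball a (ρ / 4), (1 / 2 : ℝ) ∂μ := by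
          rw [setIntegral_const, smul_eq_mul, mul_comm]
      _ ≤ ∫ x in Metric.ball a (ρ / 4), φ x ∂μ :=
          setIntegral_mono_on (integrableOn_const (hn.measure_ball_lt_top _ _).ne)
            hint.integrableOn measurableSet_ball hball
      _ ≤ m := setIntegral_le_integral hint (Filter.Eventually.of_forall hφ0)
  have hm0 : 0 < m := lt_of_lt_of_le (by positivity) hm_lower
  have hinv : 1 / m ≤ 8 / (c₀ * ρ) := by
    rw [div_le_div_iff₀ hm0 (by positivity)]; linarith
  refine ⟨fun x => φ x / m, hint.div_const m, fun x => div_nonneg (hφ0 x) hm0.le, ?_, ?_, ?_, ?_, ?_⟩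
  · rw [integral_div, ← hm, div_self hm0.ne']
  · intro x
    refine le_trans ?_ hinv
    exact div_le_div_of_nonneg_right (hφ1 x) hm0.le
  · intro x w
    rw [← sub_div, abs_div, abs_of_pos hm0, div_eq_mul_one_div]
    calc |φ x - φ w| * (1 / m) ≤ 2 / ρ * ‖x - w‖ * (8 / (c₀ * ρ)) := by
          gcongr; exact hlip x w
      _ = _ := by field_simp; ring
  · intro x hx
    exact hsupp x fun h0 => hx (by simp [h0])
  · intro x w hx hw hxw
    refine div_le_div_of_nonneg_right ?_ hm0.le
    rw [hφ, tent, tent, max_eq_left (sub_nonpos.2 hx), max_eq_left (sub_nonpos.2 hw)]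
    refine max_le_max le_rfl ?_
    have := div_le_div_of_nonneg_right hxw hρ.le
    linarith


/-- Points of the support in a large disc around `Q`. -/
def nearSupport (D : ℝ) (μ : Measure ℂ) (Q : DyadicSquare) : Set ℂ :=
  μ.support ∩ Metric.closedBall Q.center (D * Q.side)

lemma measurableSet_nearSupport (D : ℝ) (μ : Measure ℂ) (Q : DyadicSquare) :
    MeasurableSet (nearSupport D μ Q) :=
  Measure.isClosed_support.measurableSet.inter Metric.isClosed_closedBall.measurableSet

lemma IsNice.measure_nearSupport_ne_top {C₀ : ℝ} {μ : Measure ℂ} (hn : IsNice C₀ μ) (D : ℝ)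
    (Q : DyadicSquare) : μ (nearSupport D μ Q) ≠ ⊤ := by
  refine measure_ne_top_of_subset (s := Metric.ball Q.center (D * Q.side + 1)) ?_
    (hn.measure_ball_lt_top _ _).ne
  rintro x ⟨-, hx⟩
  rw [Metric.mem_closedBall] at hx
  rw [Metric.mem_ball]
  linarith

/-- One side of a gap, seen from the square `Q`. -/
def gapSide (D : ℝ) (μ : Measure ℂ) (Q : DyadicSquare) (u a : ℂ) : Set ℂ :=
  nearSupport D μ Q ∩ {x | tc u x ≤ tc u a}

lemma measurableSet_gapSide (D : ℝ) (μ : Measure ℂ) (Q : DyadicSquare) (u a : ℂ) :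
    MeasurableSet (gapSide D μ Q u a) :=
  (measurableSet_nearSupport D μ Q).inter
    (measurableSet_le (continuous_tc u).measurable measurable_const)

lemma IsNice.measure_gapSide_ne_top {C₀ : ℝ} {μ : Measure ℂ} (hn : IsNice C₀ μ) (D : ℝ)
    (Q : DyadicSquare) (u a : ℂ) : μ (gapSide D μ Q u a) ≠ ⊤ :=
  measure_ne_top_of_subset Set.inter_subset_left (hn.measure_nearSupport_ne_top D Q)

/-- The one-sided estimate, for a flat piece of the support that ends at the gap. -/
lemma le_integral_potential_gapSide {C₀ c₀ τ θ D δ h ρ : ℝ} (hC₀ : 0 < C₀) (hc₀ : 0 < c₀)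
    (hτ : 0 < τ) (hθ : 0 < θ) (hθ1 : θ ≤ 1 / 4) (hθ2 : θ * (200 * C₀) ≤ c₀) (hD : 50 ≤ D)
    {μ : Measure ℂ} (hn : IsNice C₀ μ) (hl : IsLowerADRegular c₀ μ) {Q : DyadicSquare}
    (hρ : ρ = θ * τ * Q.side) (hhdef : h = ρ / 4) (hδ : 0 < δ) (hδρ : δ ≤ ρ)
    {u a b : ℂ} (hu : ‖u‖ = 1) (ha : a ∈ μ.support) (haQ : ‖a - Q.center‖ ≤ 32 * Q.side)
    (hgap : τ * Q.side ≤ tc u b - tc u a) (hgap' : tc u b - tc u a ≤ 20 * Q.side)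
    (hy : ∀ x ∈ nearSupport D μ Q, ∀ w ∈ nearSupport D μ Q, |yc u x - yc u w| ≤ h)
    (hdich : ∀ x ∈ nearSupport D μ Q, tc u x ≤ tc u a ∨ tc u b ≤ tc u x)
    {α β : ℂ → ℝ} (hα : Integrable α μ) (hβ : Integrable β μ) (hα0 : ∀ x, 0 ≤ α x)
    (hβ0 : ∀ x, 0 ≤ β x) (hα1 : ∫ x, α x ∂μ = 1) (hβ1 : ∫ x, β x ∂μ = 1)
    (hαs : ∀ x ∈ μ.support, α x ≠ 0 → x ∈ nearSupport D μ Q ∧ |tc u (x - a)| < ρ)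
    (hαm : ∀ x w, |yc u (x - a)| ≤ h → |yc u (w - a)| ≤ h → |tc u (w - a)| ≤ |tc u (x - a)| →
        α x ≤ α w)
    (hβs : ∀ x ∈ μ.support, β x ≠ 0 → x ∈ nearSupport D μ Q ∧ |tc u (x - b)| < ρ) :
    c₀ / 32 ≤ ∫ x, (α x - β x) * dirPotential δ u (μ.restrict (gapSide D μ Q u a)) x ∂μ := by
  have hs := Q.side_pos
  have hρ0 : 0 < ρ := hδ.trans_le hδρ
  set g := tc u b - tc u a with hg
  have hg0 : 0 < g := lt_of_lt_of_le (by positivity) hgap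
  have hρg : ρ ≤ θ * g := by
    rw [hρ, mul_assoc]; exact mul_le_mul_of_nonneg_left hgap hθ.le
  have hρg' : ρ ≤ g / 4 := by nlinarith
  have hsup : ∀ᵐ x ∂μ, x ∈ μ.support := Measure.support_mem_ae
  have haN : a ∈ nearSupport D μ Q := ⟨ha, by
    rw [Metric.mem_closedBall, dist_eq_norm]; nlinarith⟩
  have mS := measurableSet_gapSide D μ Q u a
  have fS := hn.measure_gapSide_ne_top D Q u a
  set S := gapSide D μ Q u a with hS
  have hct := continuous_tc u
  have hsub₀ : S ∩ {x | tc u a - 2 * ρ < tc u x} ⊆ Metric.ball a (4 * ρ) := by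
    rintro x ⟨⟨hx1, hx2⟩, hx3⟩
    rw [Set.mem_ofPred_eq] at hx2 hx3
    rw [Metric.mem_ball, dist_eq_norm]
    have h1 := norm_le_tc_add_yc hu (x - a)
    have h2 := hy x hx1 a haN
    rw [← yc_sub] at h2
    have h3 : |tc u (x - a)| ≤ 2 * ρ := by rw [tc_sub, abs_le]; constructor <;> linarith
    linarith
  have hm₀ : μ.real (S ∩ {x | tc u a - 2 * ρ < tc u x}) ≤ 4 * C₀ * θ * g := by
    calc μ.real (S ∩ {x | tc u a - 2 * ρ < tc u x}) ≤ μ.real (Metric.ball a (4 * ρ)) :=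
          measureReal_mono hsub₀ (hn.measure_ball_lt_top _ _).ne
      _ ≤ C₀ * (4 * ρ) := hn.real_ball_le hC₀ a (by positivity)
      _ ≤ C₀ * (4 * (θ * g)) := by gcongr
      _ = _ := by ring
  have hm₁ : (c₀ / 2 - 4 * C₀ * θ) * g ≤ μ.real (S ∩ {x | tc u x ≤ tc u a - 2 * ρ} ∩
      {x | tc u a - g / 2 < tc u x}) := by
    have hcov : (Metric.ball a (g / 2) ∩ μ.support : Set ℂ) ⊆
        (S ∩ {x | tc u a - 2 * ρ < tc u x}) ∪ (S ∩ {x | tc u x ≤ tc u a - 2 * ρ} ∩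
          {x | tc u a - g / 2 < tc u x}) := by
      rintro x ⟨hx1, hx2⟩
      rw [Metric.mem_ball, dist_eq_norm] at hx1
      have hxN : x ∈ nearSupport D μ Q := ⟨hx2, by
        rw [Metric.mem_closedBall, dist_eq_norm]
        have e : x - Q.center = (x - a) + (a - Q.center) := by ring
        rw [e]
        have := norm_add_le (x - a) (a - Q.center)
        nlinarith⟩
      have ht := (abs_tc_le hu (x - a)).trans_lt hx1
      rw [tc_sub, abs_lt] at ht
      have hxt : tc u x ≤ tc u a := by
        rcases hdich x hxN with h | h
        · exact h
        · linarith
      rcases lt_or_ge (tc u a - 2 * ρ) (tc u x) with h | h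
      · exact Or.inl ⟨⟨hxN, hxt⟩, h⟩
      · exact Or.inr ⟨⟨⟨hxN, hxt⟩, h⟩, show tc u a - g / 2 < tc u x by linarith⟩
    have hball : μ.real (Metric.ball a (g / 2) ∩ μ.support) = μ.real (Metric.ball a (g / 2)) :=
      measureReal_congr (inter_ae_eq_left_of_ae_eq_univ
        (Filter.eventuallyEq_univ.2 Measure.support_mem_ae))
    have h1 := hl.le_real_ball hn ha (r := g / 2) (by positivity)
    have h2 := (measureReal_mono (μ := μ) hcov (measure_ne_top_of_subset
      (s := S) (Set.union_subset Set.inter_subset_left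
        (Set.inter_subset_left.trans Set.inter_subset_left)) fS)).trans (measureReal_union_le _ _)
    rw [hball] at h2
    linarith
  have hmain := le_integral_potential_one_side (μ := μ) (S := S) (u := u) (δ := δ) (ρ := ρ)
    (h := h) (ta := tc u a) (tb := tc u b) (ε₀ := 4 * C₀ * θ) (ε₁ := c₀ / 2 - 4 * C₀ * θ)
    hδ hδρ (by linarith) (by rw [hhdef, ← hg]; nlinarith) (by linarith) hu mS fS
    (fun x hx => hx.2) (fun x hx w hw => hy x hx.1 w hw.1) hα hβ hα0 hβ0 hα1 hβ1 ?_ ?_ ?_ hm₀ hm₁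
  · refine le_trans ?_ hmain
    linarith
  · filter_upwards [hsup] with x hx hx0
    obtain ⟨h1, h2⟩ := hαs x hx hx0
    rw [tc_sub, abs_lt] at h2
    refine ⟨⟨h1, ?_⟩, by linarith⟩
    rcases hdich x h1 with h | h
    · exact h
    · linarith
  · intro x hx w hw hxw
    have hxt : tc u x ≤ tc u a := hx.2
    have hwt : tc u w ≤ tc u a := hw.2
    refine hαm x w ?_ ?_ ?_
    · rw [yc_sub]; exact hy x hx.1 a haN
    · rw [yc_sub]; exact hy w hw.1 a haN
    · rw [tc_sub, tc_sub, abs_of_nonpos (by linarith), abs_of_nonpos (by linarith)]; linarith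
  · filter_upwards [hsup] with x hx hx0
    obtain ⟨h1, h2⟩ := hβs x hx hx0
    rw [tc_sub, abs_lt] at h2
    rcases hdich x h1 with h | h
    · linarith
    · exact h

/-- A gap in a flat piece of the support is detected by the Cauchy transform. -/
lemma exists_molecule_of_gap {C₀ c₀ τ θ A D : ℝ} (hC₀ : 0 < C₀) (hc₀ : 0 < c₀)
    (hτ : 0 < τ) (hτ1 : τ < 1) (hθ : 0 < θ) (hθ1 : θ ≤ 1 / 4) (hθ2 : θ * (200 * C₀) ≤ c₀)
    (hA : A = 32 / (c₀ * (θ * τ) ^ 2)) (hD : 100 ≤ D)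
    (hD2 : 66 * C₀ * A * (264 * C₀) * 32 ≤ c₀ * D)
    {μ : Measure ℂ} (hn : IsNice C₀ μ) (hl : IsLowerADRegular c₀ μ) {Q : DyadicSquare}
    {u a b : ℂ} (hu : ‖u‖ = 1) (ha : a ∈ μ.support) (haQ : ‖a - Q.center‖ ≤ 32 * Q.side)
    (hb : b ∈ μ.support) (hbQ : ‖b - Q.center‖ ≤ 32 * Q.side)
    (hgap : τ * Q.side ≤ tc u b - tc u a) (hgap' : tc u b - tc u a ≤ 20 * Q.side)
    (hy : ∀ x ∈ nearSupport D μ Q, ∀ w ∈ nearSupport D μ Q,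
      |yc u x - yc u w| ≤ θ * τ * Q.side / 4)
    (hdich : ∀ x ∈ nearSupport D μ Q, tc u x ≤ tc u a ∨ tc u b ≤ tc u x) :
    ∃ ψ : ℂ → ℝ, IsMolecule A 33 μ Q ψ ∧
      ∀ (B : Set ℂ) (δ : ℝ), MeasurableSet B → μ B ≠ ⊤ →
        Metric.closedBall Q.center (D * Q.side) ⊆ B → 0 < δ → δ ≤ θ * τ * Q.side →
        c₀ / 32 ≤ ∫ x, dirPotential δ u (μ.restrict B) x * ψ x ∂μ := by
  have := hn.isLocallyFiniteMeasure
  have hs := Q.side_pos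
  have hθτ : θ * τ ≤ 1 / 4 := by nlinarith
  set ρ := θ * τ * Q.side with hρ
  have hρ0 : 0 < ρ := by positivity
  have hρs : ρ ≤ Q.side / 4 := by nlinarith
  set h := ρ / 4 with hh
  obtain ⟨α, hα, hα0, hα1, hαb, hαl, hαs, hαm⟩ :=
    exists_normalized_tent hc₀ hn hl hu ha hρ0 (show 0 ≤ h by positivity)
  obtain ⟨β, hβ, hβ0, hβ1, hβb, hβl, hβs, hβm⟩ :=
    exists_normalized_tent hc₀ hn hl hu hb hρ0 (show 0 ≤ h by positivity)
  have supp_aux : ∀ v : ℂ, ‖v - Q.center‖ ≤ 32 * Q.side → ∀ x : ℂ,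
      |tc u (x - v)| < ρ ∧ |yc u (x - v)| < ρ + h → ‖x - Q.center‖ ≤ 33 * Q.side := by
    intro v hv x ⟨h1, h2⟩
    have e : x - Q.center = (x - v) + (v - Q.center) := by ring
    rw [e]
    have h3 := norm_le_tc_add_yc hu (x - v)
    have h4 := norm_add_le (x - v) (v - Q.center)
    linarith
  have hαQ : ∀ x, α x ≠ 0 → ‖x - Q.center‖ ≤ 33 * Q.side := fun x hx =>
    supp_aux a haQ x (hαs x hx)
  have hβQ : ∀ x, β x ≠ 0 → ‖x - Q.center‖ ≤ 33 * Q.side := fun x hx =>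
    supp_aux b hbQ x (hβs x hx)
  have hA0 : 0 < A := by rw [hA]; positivity
  set ψ : ℂ → ℝ := fun x => α x - β x with hψ
  have hmol : IsMolecule A 33 μ Q ψ := by
    refine ⟨?_, ?_, ?_, ?_, a, ha, by linarith⟩
    · intro x
      have h1 : 8 / (c₀ * ρ) ≤ A / Q.side := by
        rw [hA, hρ, div_div, div_le_div_iff₀ (by positivity) (by positivity)]
        have : c₀ * (θ * τ) ^ 2 * Q.side ≤ c₀ * (θ * τ * Q.side) := by
          have : (θ * τ) ^ 2 ≤ θ * τ := by nlinarith [mul_pos hθ hτ]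
          calc c₀ * (θ * τ) ^ 2 * Q.side ≤ c₀ * (θ * τ) * Q.side := by gcongr
            _ = _ := by ring
        have h0 : 0 ≤ c₀ * (θ * τ * Q.side) := by positivity
        linarith
      rw [abs_le]
      constructor <;> linarith [hα0 x, hβ0 x, hαb x, hβb x]
    · intro x y
      have e : A / Q.side ^ 2 = 16 / (c₀ * ρ ^ 2) + 16 / (c₀ * ρ ^ 2) := by
        rw [hA, hρ]; field_simp; ring
      rw [e, add_mul]
      have e2 : ψ x - ψ y = (α x - α y) - (β x - β y) := by simp only [hψ]; ring
      rw [e2]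
      exact (abs_sub _ _).trans (add_le_add (hαl x y) (hβl x y))
    · intro x hx
      by_cases h0 : α x = 0
      · refine hβQ x fun h1 => hx ?_
        simp [hψ, h0, h1]
      · exact hαQ x h0
    · rw [integral_sub hα hβ, hα1, hβ1, sub_self]
  refine ⟨ψ, hmol, fun B δ hB hBfin hDB hδ hδρ => ?_⟩
  have nearOf : ∀ x ∈ μ.support, ‖x - Q.center‖ ≤ 33 * Q.side → x ∈ nearSupport D μ Q :=
    fun x hx hx' => ⟨hx, by rw [Metric.mem_closedBall, dist_eq_norm]; nlinarith⟩
  have hgab : 0 < tc u b - tc u a := lt_of_lt_of_le (by positivity) hgap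
  have hL := le_integral_potential_gapSide (μ := μ) (Q := Q) (u := u) (a := a) (b := b) (D := D)
    (h := h) (ρ := ρ) (δ := δ) hC₀ hc₀ hτ hθ hθ1 hθ2 (by linarith) hn hl hρ hh hδ hδρ hu ha haQ hgap
    hgap' hy hdich hα hβ hα0 hβ0 hα1 hβ1 (fun x hx h0 => ⟨nearOf x hx (hαQ x h0), (hαs x h0).1⟩)
    hαm (fun x hx h0 => ⟨nearOf x hx (hβQ x h0), (hβs x h0).1⟩)
  have hR := le_integral_potential_gapSide (μ := μ) (Q := Q) (u := -u) (a := b) (b := a) (D := D)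
    (h := h) (ρ := ρ) (δ := δ) (α := β) (β := α) hC₀ hc₀ hτ hθ hθ1 hθ2 (by linarith) hn hl hρ hh hδ
    hδρ (by rwa [norm_neg]) hb hbQ (by simp only [tc_neg]; linarith) (by simp only [tc_neg]; linarith)
    (fun x hx w hw => by
      rw [yc_neg, yc_neg, neg_sub_neg, abs_sub_comm]; exact hy x hx w hw)
    (fun x hx => by
      simp only [tc_neg]
      rcases hdich x hx with h | h
      · right; linarith
      · left; linarith)
    hβ hα hβ0 hα0 hβ1 hα1
    (fun x hx h0 => ⟨nearOf x hx (hβQ x h0), by rw [tc_neg, abs_neg]; exact (hβs x h0).1⟩)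
    (fun x w => by simp only [tc_neg, yc_neg, abs_neg]; exact hβm x w)
    (fun x hx h0 => ⟨nearOf x hx (hαQ x h0), by rw [tc_neg, abs_neg]; exact (hαs x h0).1⟩)
  set SL := gapSide D μ Q u a with hSL
  set SR := gapSide D μ Q (-u) b with hSR
  set T := B \ Metric.closedBall Q.center (D * Q.side) with hT
  have mT : MeasurableSet T := hB.diff Metric.isClosed_closedBall.measurableSet
  have mL : MeasurableSet SL := measurableSet_gapSide D μ Q u a
  have mR : MeasurableSet SR := measurableSet_gapSide D μ Q (-u) b
  have fT : μ T ≠ ⊤ := measure_ne_top_of_subset Set.sdiff_subset hBfin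
  have fL : μ SL ≠ ⊤ := hn.measure_gapSide_ne_top D Q u a
  have fR : μ SR ≠ ⊤ := hn.measure_gapSide_ne_top D Q (-u) b
  have iT : IsFiniteMeasure (μ.restrict T) :=
    ⟨by rwa [Measure.restrict_apply_univ, lt_top_iff_ne_top]⟩
  have iL : IsFiniteMeasure (μ.restrict SL) :=
    ⟨by rwa [Measure.restrict_apply_univ, lt_top_iff_ne_top]⟩
  have iR : IsFiniteMeasure (μ.restrict SR) :=
    ⟨by rwa [Measure.restrict_apply_univ, lt_top_iff_ne_top]⟩
  have hae : B =ᵐ[μ] ((SL ∪ SR) ∪ T : Set ℂ) := by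
    filter_upwards [Measure.support_mem_ae (μ := μ)] with x hx
    refine propext (show x ∈ B ↔ x ∈ SL ∪ SR ∪ T from ⟨fun hxB => ?_, ?_⟩)
    · by_cases hxc : x ∈ Metric.closedBall Q.center (D * Q.side)
      · have hxN : x ∈ nearSupport D μ Q := ⟨hx, hxc⟩
        rcases hdich x hxN with h | h
        · exact Or.inl (Or.inl ⟨hxN, h⟩)
        · refine Or.inl (Or.inr ⟨hxN, ?_⟩)
          rw [Set.mem_ofPred_eq, tc_neg, tc_neg]; linarith
      · exact Or.inr ⟨hxB, hxc⟩
    · rintro ((hx' | hx') | hx')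
      · exact hDB hx'.1.2
      · exact hDB hx'.1.2
      · exact hx'.1
  have dLR : Disjoint SL SR := by
    rw [Set.disjoint_left]
    rintro x ⟨-, h1⟩ ⟨-, h2⟩
    rw [Set.mem_ofPred_eq] at h1 h2
    rw [tc_neg, tc_neg] at h2
    linarith
  have dT : Disjoint (SL ∪ SR) T := by
    rw [Set.disjoint_left]
    rintro x (hx | hx) hxT
    · exact hxT.2 hx.1.2
    · exact hxT.2 hx.1.2
  have hsplit : ∀ x, dirPotential δ u (μ.restrict B) x =
      dirPotential δ u (μ.restrict SL) x - dirPotential δ (-u) (μ.restrict SR) x +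
        dirPotential δ u (μ.restrict T) x := by
    intro x
    have hk := fun (ν : Measure ℂ) [IsFiniteMeasure ν] => integrable_dirKernel hδ hu ν x
    have e : dirPotential δ (-u) (μ.restrict SR) x = -dirPotential δ u (μ.restrict SR) x := by
      simp only [dirPotential, dirKernel_neg, integral_neg]
    rw [e, Measure.restrict_congr_set hae, Measure.restrict_union dT mT,
      Measure.restrict_union dLR mR, sub_neg_eq_add]
    simp only [dirPotential]
    rw [integral_add_measure ((hk _).add_measure (hk _)) (hk _),
      integral_add_measure (hk _) (hk _)]
  have hψi : Integrable ψ μ := hα.sub hβ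
  have i1 := integrable_mul_dirPotential hδ hu (μ.restrict SL) hψi
  have i2 := integrable_mul_dirPotential hδ (u := -u) (by rwa [norm_neg]) (μ.restrict SR) hψi
  have i3 := integrable_mul_dirPotential hδ hu (μ.restrict T) hψi
  have hfar : |∫ x, ψ x * dirPotential δ u (μ.restrict T) x ∂μ| ≤ c₀ / 32 := by
    set z := Q.center
    have e : ∫ x, ψ x * dirPotential δ u (μ.restrict T) x ∂μ =
        ∫ x, (dirPotential δ u (μ.restrict T) x - dirPotential δ u (μ.restrict T) z) * ψ x ∂μ := by
      have : ∀ x, (dirPotential δ u (μ.restrict T) x - dirPotential δ u (μ.restrict T) z) * ψ x =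
          ψ x * dirPotential δ u (μ.restrict T) x -
            dirPotential δ u (μ.restrict T) z * ψ x := fun x => by ring
      simp_rw [this]
      rw [integral_sub i3 (hψi.const_mul _), integral_const_mul, hmol.mean]; simp
    rw [e]
    have hbound := hmol.abs_integral_le hC₀ (by norm_num) hn
      (g := fun x => dirPotential δ u (μ.restrict T) x - dirPotential δ u (μ.restrict T) z)
      (b := 2 * (33 * Q.side) * (4 * C₀ / (D * Q.side))) (by positivity) (fun x hx => by
        refine (abs_dirPotential_sub_le (r := D * Q.side) hC₀ hn hu hδ (by nlinarith) mT fT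
          (fun w hw => ?_) (by nlinarith)).trans (by gcongr)
        have := hw.2
        rw [Metric.mem_closedBall, dist_eq_norm, not_le] at this
        exact this.le)
    refine hbound.trans ?_
    have e2 : 2 * (33 : ℝ) * C₀ * A * (2 * (33 * Q.side) * (4 * C₀ / (D * Q.side))) =
        66 * C₀ * A * (264 * C₀) / D := by field_simp; ring
    rw [e2, div_le_div_iff₀ (by linarith) (by norm_num)]
    exact hD2
  have hexp : ∫ x, dirPotential δ u (μ.restrict B) x * ψ x ∂μ =
      ∫ x, (α x - β x) * dirPotential δ u (μ.restrict SL) x ∂μ +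
      ∫ x, (β x - α x) * dirPotential δ (-u) (μ.restrict SR) x ∂μ +
      ∫ x, ψ x * dirPotential δ u (μ.restrict T) x ∂μ := by
    have e2 : ∫ x, (β x - α x) * dirPotential δ (-u) (μ.restrict SR) x ∂μ =
        -∫ x, ψ x * dirPotential δ (-u) (μ.restrict SR) x ∂μ := by
      rw [← integral_neg]
      refine integral_congr_ae (Filter.Eventually.of_forall fun x => ?_)
      simp only [hψ]; ring
    rw [e2, ← sub_eq_add_neg, ← integral_sub i1 i2, ← integral_add (by exact i1.sub i2) i3]
    refine integral_congr_ae (Filter.Eventually.of_forall fun x => ?_)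
    simp only [hsplit, hψ]; ring
  rw [hexp]
  have := neg_le_of_abs_le hfar
  linarith


lemma isCarleson_iff_finset {C : ℝ} (hC : 0 ≤ C) (S : Set DyadicSquare) :
    IsCarleson C S ↔ ∀ (P : DyadicSquare) (F : Finset DyadicSquare),
      (∀ Q ∈ F, Q ∈ S ∧ Q.toSet ⊆ P.toSet) → ∑ Q ∈ F, Q.side ≤ C * P.side := by
  classical
  refine forall_congr' fun P => ?_
  have hCP : 0 ≤ C * P.side := mul_nonneg hC P.side_pos.le
  constructor
  · intro h F hF
    have h1 : ∑ Q ∈ F.attach.image (fun Q => (⟨Q.1, hF Q.1 Q.2⟩ :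
        {Q : DyadicSquare // Q ∈ S ∧ Q.toSet ⊆ P.toSet})), ENNReal.ofReal Q.1.side ≤
        ENNReal.ofReal (C * P.side) := (ENNReal.sum_le_tsum _).trans h
    rw [Finset.sum_image (fun a _ b _ hab => by
      have := congrArg (fun x => x.1) hab
      exact Subtype.ext this), Finset.sum_attach F (fun Q => ENNReal.ofReal Q.side),
      ← ENNReal.ofReal_sum_of_nonneg (fun Q _ => Q.side_pos.le)] at h1
    exact (ENNReal.ofReal_le_ofReal_iff hCP).1 h1
  · intro h
    rw [ENNReal.tsum_eq_iSup_sum]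
    refine iSup_le fun G => ?_
    rw [← ENNReal.ofReal_sum_of_nonneg (fun Q _ => Q.1.side_pos.le)]
    refine ENNReal.ofReal_le_ofReal ?_
    have := h (G.map (Function.Embedding.subtype _)) (fun Q hQ => by
      obtain ⟨Q', -, rfl⟩ := Finset.mem_map.1 hQ
      exact Q'.2)
    rwa [Finset.sum_map] at this

/-- A bad square that sees no non-flat triple contains a gap in a flat piece of the support. -/
lemma exists_gap_of_isBad {τ η D : ℝ} (hτ : 0 < τ) (hη : 0 < η) (hητ : η ≤ τ / 2) (hη1 : η ≤ 1)
    (hD : 100 ≤ D) {μ : Measure ℂ} {Q : DyadicSquare} (hQ : IsBad τ μ Q)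
    (hflat : ¬ HasNonflatTriple D (η / 2) μ Q) :
    ∃ u a b : ℂ, ‖u‖ = 1 ∧ a ∈ μ.support ∧ ‖a - Q.center‖ ≤ 32 * Q.side ∧ b ∈ μ.support ∧
      ‖b - Q.center‖ ≤ 32 * Q.side ∧ τ * Q.side ≤ tc u b - tc u a ∧
      tc u b - tc u a ≤ 20 * Q.side ∧
      (∀ x ∈ nearSupport D μ Q, ∀ w ∈ nearSupport D μ Q, |yc u x - yc u w| ≤ 2 * (η * Q.side)) ∧
      ∀ x ∈ nearSupport D μ Q, tc u x ≤ tc u a ∨ tc u b ≤ tc u x := by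
  have hs := Q.side_pos
  obtain ⟨ζ, ⟨hζQ, hζ⟩, ξ, ⟨hξQ, hξ⟩, hζξ, z, hz, hempty⟩ := hQ
  rw [Metric.mem_ball, dist_eq_norm] at hζQ hξQ
  have hd0 : 0 < ‖ξ - ζ‖ := by rw [norm_sub_rev]; linarith
  have hdC : (‖ξ - ζ‖ : ℂ) ≠ 0 := by exact_mod_cast hd0.ne'
  set u : ℂ := (ξ - ζ) / ‖ξ - ζ‖ with hu_def
  have hu : ‖u‖ = 1 := by
    rw [hu_def, norm_div, Complex.norm_real, norm_norm, div_self hd0.ne']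
  have hmul : ∀ w : ℂ, (starRingEnd ℂ) (ξ - ζ) * w =
      (‖ξ - ζ‖ : ℂ) * ((starRingEnd ℂ) u * w) := by
    intro w
    rw [hu_def, map_div₀, Complex.conj_ofReal]
    field_simp
  have huu : (starRingEnd ℂ) u * (ξ - ζ) = (‖ξ - ζ‖ : ℂ) := by
    have h1 := hmul (ξ - ζ)
    rw [mul_comm, Complex.mul_conj, Complex.normSq_eq_norm_sq] at h1
    refine mul_left_cancel₀ hdC ?_
    rw [← h1]; push_cast; ring
  have htξ : tc u ξ - tc u ζ = ‖ξ - ζ‖ := by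
    rw [← tc_sub, tc, huu, Complex.ofReal_re]
  have hyξ : yc u ξ - yc u ζ = 0 := by
    rw [← yc_sub, yc, huu, Complex.ofReal_im]
  have hd20 : ‖ξ - ζ‖ ≤ 20 * Q.side := by
    have e : ξ - ζ = (ξ - Q.center) - (ζ - Q.center) := by ring
    have := norm_sub_le (ξ - Q.center) (ζ - Q.center)
    rw [← e] at this
    linarith
  obtain ⟨θ, hθ0, hθ1, rfl⟩ : ∃ θ : ℝ, 0 ≤ θ ∧ θ ≤ 1 ∧ z = ζ + θ • (ξ - ζ) := by
    rw [segment_eq_image'] at hz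
    obtain ⟨θ, hθ, rfl⟩ := hz
    exact ⟨θ, hθ.1, hθ.2, rfl⟩
  set z := ζ + θ • (ξ - ζ) with hz_def
  have hzlin : (starRingEnd ℂ) u * (z - ζ) = ((θ * ‖ξ - ζ‖ : ℝ) : ℂ) := by
    have : z - ζ = (θ : ℂ) * (ξ - ζ) := by rw [hz_def, Complex.real_smul]; ring
    rw [this, mul_left_comm, huu]; push_cast; ring
  have htz : tc u z - tc u ζ = θ * ‖ξ - ζ‖ := by rw [← tc_sub, tc, hzlin, Complex.ofReal_re]
  have hyz : yc u z - yc u ζ = 0 := by rw [← yc_sub, yc, hzlin, Complex.ofReal_im]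
  have hstrip : ∀ w ∈ nearSupport D μ Q, |yc u w - yc u ζ| ≤ η * Q.side := by
    rintro w ⟨hw, hwQ⟩
    rw [Metric.mem_closedBall, dist_eq_norm] at hwQ
    by_contra! hlt
    refine hflat ⟨ζ, hζ, ξ, hξ, w, hw, by nlinarith, by nlinarith, hwQ, ?_, ?_, ?_, ?_⟩
    · nlinarith
    · have := abs_yc_le hu (ζ - w)
      rw [yc_sub, abs_sub_comm] at this
      nlinarith
    · have := abs_yc_le hu (ξ - w)
      have e : yc u ξ = yc u ζ := by linarith
      rw [yc_sub, e, abs_sub_comm] at this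
      nlinarith
    · have e : ((starRingEnd ℂ) (ξ - ζ) * (w - ζ)).im = ‖ξ - ζ‖ * (yc u w - yc u ζ) := by
        rw [hmul, Complex.im_ofReal_mul, ← yc_sub, yc]
      rw [e, abs_mul, abs_of_pos hd0]
      rw [norm_sub_rev] at hζξ
      calc η / 2 * Q.side ^ 2 = Q.side / 2 * (η * Q.side) := by ring
        _ ≤ _ := by gcongr
  have hηs : η * Q.side ≤ Q.side := by nlinarith
  have hητs : η * Q.side ≤ τ * Q.side / 2 := by nlinarith
  have hdich : ∀ w ∈ nearSupport D μ Q,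
      tc u w ≤ tc u z - τ * Q.side / 2 ∨ tc u z + τ * Q.side / 2 ≤ tc u w := by
    intro w hw
    by_contra! hlt
    have hmem : w ∈ Metric.ball z (τ * Q.side) ∩ μ.support := by
      refine ⟨?_, hw.1⟩
      rw [Metric.mem_ball, dist_eq_norm]
      have h1 := norm_le_tc_add_yc hu (w - z)
      have h2 : |tc u (w - z)| < τ * Q.side / 2 := by
        rw [tc_sub, abs_lt]; constructor <;> linarith [hlt.1, hlt.2]
      have h3 := hstrip w hw
      have h4 : yc u (w - z) = yc u w - yc u ζ := by rw [yc_sub]; linarith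
      rw [h4] at h1
      linarith
    rw [hempty] at hmem
    exact hmem
  have nearOf : ∀ w ∈ μ.support, ‖w - Q.center‖ ≤ 10 * Q.side → w ∈ nearSupport D μ Q :=
    fun w hw hw' => ⟨hw, by rw [Metric.mem_closedBall, dist_eq_norm]; nlinarith⟩
  have hζN := nearOf ζ hζ hζQ.le
  have hξN := nearOf ξ hξ hξQ.le
  have hτs : 0 < τ * Q.side := by positivity
  have hθd : 0 ≤ θ * ‖ξ - ζ‖ := by positivity
  have hθd' : θ * ‖ξ - ζ‖ ≤ ‖ξ - ζ‖ := by nlinarith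
  have hcompact : IsCompact (nearSupport D μ Q) :=
    (isCompact_closedBall _ _).inter_left Measure.isClosed_support
  have hct := continuous_tc u
  obtain ⟨a, ⟨haN, haz⟩, hamax⟩ := (hcompact.inter_right
    (isClosed_le hct continuous_const : IsClosed {w | tc u w ≤ tc u z - τ * Q.side / 2})).exists_isMaxOn
    ⟨ζ, hζN, (hdich ζ hζN).resolve_right (by linarith)⟩ hct.continuousOn
  obtain ⟨b, ⟨hbN, hbz⟩, hbmin⟩ := (hcompact.inter_right
    (isClosed_le continuous_const hct : IsClosed {w | tc u z + τ * Q.side / 2 ≤ tc u w})).exists_isMinOn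
    ⟨ξ, hξN, (hdich ξ hξN).resolve_left (by linarith)⟩ hct.continuousOn
  rw [Set.mem_ofPred_eq] at haz hbz
  have hζa : tc u ζ ≤ tc u a := hamax ⟨hζN, (hdich ζ hζN).resolve_right (by linarith)⟩
  have hbξ : tc u b ≤ tc u ξ := hbmin ⟨hξN, (hdich ξ hξN).resolve_left (by linarith)⟩
  refine ⟨u, a, b, hu, haN.1, ?_, hbN.1, ?_, by linarith, by linarith, ?_, ?_⟩
  · have e : a - Q.center = (a - ζ) + (ζ - Q.center) := by ring
    rw [e]
    have h1 := norm_add_le (a - ζ) (ζ - Q.center)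
    have h2 := norm_le_tc_add_yc hu (a - ζ)
    have h3 := hstrip a haN
    have h4 : |tc u (a - ζ)| ≤ 20 * Q.side := by
      rw [tc_sub, abs_le]; constructor <;> linarith
    rw [yc_sub] at h2
    linarith
  · have e : b - Q.center = (b - ξ) + (ξ - Q.center) := by ring
    rw [e]
    have h1 := norm_add_le (b - ξ) (ξ - Q.center)
    have h2 := norm_le_tc_add_yc hu (b - ξ)
    have h3 := hstrip b hbN
    have h4 : |tc u (b - ξ)| ≤ 20 * Q.side := by
      rw [tc_sub, abs_le]; constructor <;> linarith
    have h5 : yc u (b - ξ) = yc u b - yc u ζ := by rw [yc_sub]; linarith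
    rw [h5] at h2
    linarith
  · intro x hx w hw
    have e : yc u x - yc u w = (yc u x - yc u ζ) - (yc u w - yc u ζ) := by ring
    rw [e]
    exact (abs_sub _ _).trans (by linarith [hstrip x hx, hstrip w hw])
  · intro x hx
    rcases hdich x hx with h | h
    · exact Or.inl (hamax ⟨hx, h⟩)
    · exact Or.inr (hbmin ⟨hx, h⟩)

lemma dirPotential_eq {δ : ℝ} (hδ : 0 < δ) (u : ℂ) (ν : Measure ℂ) [IsFiniteMeasure ν] (x : ℂ) :
    dirPotential δ u ν x = u.re * (∫ y, cauchyKernel δ (x - y) ∂ν).re -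
      u.im * (∫ y, cauchyKernel δ (x - y) ∂ν).im := by
  have h := integral_re (𝕜 := ℂ) ((integrable_cauchyKernel hδ ν x).const_mul u)
  simp only [RCLike.re_to_complex] at h
  rw [dirPotential]
  simp only [dirKernel]
  rw [h, integral_const_mul, Complex.mul_re]

/-- The bad squares of a good AD-regular measure form a Carleson family. -/
theorem exists_isCarleson_badSquares {τ C₀ c₀ : ℝ} (hτ : 0 < τ) (hτ1 : τ < 1) (hC₀ : 0 < C₀)
    (hc₀ : 0 < c₀) :
    ∃ C : ℝ, 0 < C ∧ ∀ μ : Measure ℂ, IsGood C₀ μ → IsLowerADRegular c₀ μ →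
      IsCarleson C (badSquares τ μ) := by
  classical
  set θ : ℝ := min (1 / 4) (c₀ / (200 * C₀)) with hθ_def
  have hθ : 0 < θ := lt_min (by norm_num) (by positivity)
  have hθ1 : θ ≤ 1 / 4 := min_le_left _ _
  have hθ2 : θ * (200 * C₀) ≤ c₀ := by
    rw [← le_div_iff₀ (by positivity)]; exact min_le_right _ _
  set A : ℝ := 32 / (c₀ * (θ * τ) ^ 2) with hA
  have hA0 : 0 < A := by positivity
  set D : ℝ := 100 + 66 * C₀ * A * (264 * C₀) * 32 / c₀ with hD_def
  have hD : 100 ≤ D := by rw [hD_def]; exact le_add_of_nonneg_right (by positivity)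
  have hD2 : 66 * C₀ * A * (264 * C₀) * 32 ≤ c₀ * D := by
    rw [hD_def, mul_add, mul_div_cancel₀ _ hc₀.ne']
    linarith
  set η : ℝ := θ * τ / 8 with hη_def
  have hη : 0 < η := by positivity
  have hητ : η ≤ τ / 2 := by rw [hη_def]; nlinarith
  have hη1 : η ≤ 1 := by linarith
  obtain ⟨C₁, hC₁, hnonflat⟩ := exists_sum_side_nonflat_le (D := D) (s := η / 2) hC₀ hc₀
    (by linarith) (by positivity) (by linarith)
  obtain ⟨M, hM, hriesz⟩ := exists_riesz_system (R := 33) hC₀ hc₀ hA0 (by norm_num)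
  set C₂ : ℝ := M * (C₀ ^ 2 * (C₀ * (D + 2))) / (c₀ / 32) ^ 2 with hC₂
  have hC₂0 : 0 < C₂ := by positivity
  refine ⟨C₁ + C₂, by positivity, fun μ hg hl => ?_⟩
  rw [isCarleson_iff_finset (by positivity)]
  intro P F hF
  have hn := hg.1
  have := hn.isLocallyFiniteMeasure
  have hPs := P.side_pos
  have hPQ : ∀ Q ∈ F, Q.side ≤ P.side ∧ ‖Q.center - P.center‖ ≤ P.side := fun Q hQ =>
    ⟨DyadicSquare.side_le_of_subset (hF Q hQ).2,
      DyadicSquare.norm_sub_center_le ((hF Q hQ).2 Q.center_mem)⟩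
  rw [← Finset.sum_filter_add_sum_filter_not F (fun Q => HasNonflatTriple D (η / 2) μ Q)]
  have h1 := hnonflat μ hg hl P (F.filter (fun Q => HasNonflatTriple D (η / 2) μ Q))
    (fun Q hQ => by
      obtain ⟨h, h'⟩ := Finset.mem_filter.1 hQ
      exact ⟨h', hPQ Q h⟩)
  set G := F.filter (fun Q => ¬ HasNonflatTriple D (η / 2) μ Q) with hG
  suffices h2 : ∑ Q ∈ G, Q.side ≤ C₂ * P.side by rw [add_mul]; linarith
  set B := Metric.ball P.center ((D + 2) * P.side) with hB
  have hBfin : μ B ≠ ⊤ := (hn.measure_ball_lt_top _ _).ne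
  have iB : IsFiniteMeasure (μ.restrict B) :=
    ⟨by rwa [Measure.restrict_apply_univ, lt_top_iff_ne_top]⟩
  obtain ⟨δ, hδ, hδG⟩ := exists_pos_le_side G (s := θ * τ) (by positivity)
  set f : ℂ → ℂ := fun x => ∫ y, cauchyKernel δ (x - y) ∂(μ.restrict B) with hf
  obtain ⟨hf2, hfint⟩ := hg.memLp_and_integral_sq_le hC₀ hδ measurableSet_ball hBfin
  have key : ∀ Q ∈ G, ∃ ψ : ℂ → ℝ, IsMolecule A 33 μ Q ψ ∧
      (c₀ / 32) ^ 2 ≤ (∫ x, (f x).re * ψ x ∂μ) ^ 2 + (∫ x, (f x).im * ψ x ∂μ) ^ 2 := by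
    intro Q hQ
    obtain ⟨hQF, hflat⟩ := Finset.mem_filter.1 hQ
    have hQs := Q.side_pos
    obtain ⟨u, a, b, hu, ha, haQ, hb, hbQ, hgap, hgap', hy, hdich⟩ :=
      exists_gap_of_isBad hτ hη hητ hη1 hD (hF Q hQF).1 hflat
    obtain ⟨ψ, hψ, hest⟩ := exists_molecule_of_gap (D := D) hC₀ hc₀ hτ hτ1 hθ hθ1 hθ2 hA hD hD2 hn hl
      hu ha haQ hb hbQ hgap hgap' (fun x hx w hw => (hy x hx w hw).trans (le_of_eq (by
        rw [hη_def]; ring))) hdich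
    refine ⟨ψ, hψ, ?_⟩
    have h3 := hest B δ measurableSet_ball hBfin (fun x hx => by
      rw [Metric.mem_closedBall, dist_eq_norm] at hx
      rw [hB, Metric.mem_ball, dist_eq_norm]
      obtain ⟨p1, p2⟩ := hPQ Q hQF
      have e : x - P.center = (x - Q.center) + (Q.center - P.center) := by ring
      rw [e]
      have := norm_add_le (x - Q.center) (Q.center - P.center)
      have : D * Q.side ≤ D * P.side := by gcongr
      nlinarith) hδ (hδG Q hQ)
    have i1 : Integrable (fun x => (f x).re * ψ x) μ := hf2.re.integrable_mul hψ.memLp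
    have i2 : Integrable (fun x => (f x).im * ψ x) μ := hf2.im.integrable_mul hψ.memLp
    have e : ∫ x, dirPotential δ u (μ.restrict B) x * ψ x ∂μ =
        u.re * (∫ x, (f x).re * ψ x ∂μ) - u.im * ∫ x, (f x).im * ψ x ∂μ := by
      rw [← integral_const_mul, ← integral_const_mul,
        ← integral_sub (i1.const_mul _) (i2.const_mul _)]
      refine integral_congr_ae (Filter.Eventually.of_forall fun x => ?_)
      simp only [dirPotential_eq hδ, hf]; ring
    rw [e] at h3
    have hu2 : u.re ^ 2 + u.im ^ 2 = 1 := by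
      have := Complex.sq_norm u
      rw [hu, Complex.normSq_apply] at this
      linarith
    set X := ∫ x, (f x).re * ψ x ∂μ
    set Y := ∫ x, (f x).im * ψ x ∂μ
    have h4 : (c₀ / 32) ^ 2 ≤ (u.re * X - u.im * Y) ^ 2 := by gcongr
    have h5 : (u.re * X - u.im * Y) ^ 2 + (u.re * Y + u.im * X) ^ 2 =
        (u.re ^ 2 + u.im ^ 2) * (X ^ 2 + Y ^ 2) := by ring
    rw [hu2, one_mul] at h5
    have := sq_nonneg (u.re * Y + u.im * X)
    linarith
  choose! ψ hψ hest using key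
  have r1 := hriesz μ hn hl G ψ hψ (fun x => (f x).re) hf2.re
  have r2 := hriesz μ hn hl G ψ hψ (fun x => (f x).im) hf2.im
  have hsum : (∑ Q ∈ G, Q.side) * (c₀ / 32) ^ 2 ≤
      M * (∫ x, (f x).re ^ 2 ∂μ) + M * ∫ x, (f x).im ^ 2 ∂μ := by
    refine le_trans ?_ (add_le_add r1 r2)
    rw [Finset.sum_mul, ← Finset.sum_add_distrib]
    refine Finset.sum_le_sum fun Q hQ => ?_
    rw [← mul_add]
    exact mul_le_mul_of_nonneg_left (hest Q hQ) Q.side_pos.le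
  have hnorm : (∫ x, (f x).re ^ 2 ∂μ) + ∫ x, (f x).im ^ 2 ∂μ = ∫ x, ‖f x‖ ^ 2 ∂μ := by
    have j1 : Integrable (fun x => (f x).re ^ 2) μ := hf2.re.integrable_sq
    have j2 : Integrable (fun x => (f x).im ^ 2) μ := hf2.im.integrable_sq
    rw [← integral_add j1 j2]
    refine integral_congr_ae (Filter.Eventually.of_forall fun x => ?_)
    simp only [Complex.sq_norm, Complex.normSq_apply]; ring
  rw [← mul_add, hnorm] at hsum
  have hfin : (∑ Q ∈ G, Q.side) * (c₀ / 32) ^ 2 ≤ M * (C₀ ^ 2 * (C₀ * ((D + 2) * P.side))) := by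
    refine hsum.trans (mul_le_mul_of_nonneg_left (hfint.trans ?_) hM.le)
    gcongr
    exact hn.real_ball_le hC₀ _ (by positivity)
  rw [hC₂, div_mul_eq_mul_div, le_div_iff₀ (by positivity)]
  linarith


/-- Length of the polygonal path through the points of a list. -/
noncomputable def pathLength : List ℂ → ℝ
  | [] => 0
  | [_] => 0
  | x :: y :: l => ‖x - y‖ + pathLength (y :: l)

lemma pathLength_nonneg : ∀ l : List ℂ, 0 ≤ pathLength l
  | [] => le_rfl
  | [_] => le_rfl
  | _ :: y :: l => add_nonneg (norm_nonneg _) (pathLength_nonneg (y :: l))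

lemma pathLength_detour (x y : ℂ) (l₂ : List ℂ) : ∀ l₁ : List ℂ,
    pathLength (l₁ ++ x :: y :: x :: l₂) = pathLength (l₁ ++ x :: l₂) + 2 * ‖x - y‖
  | [] => by
    simp only [List.nil_append, pathLength]
    rw [norm_sub_rev y x]; ring
  | [z] => by
    simp only [List.singleton_append, pathLength]
    rw [norm_sub_rev y x]; ring
  | z :: w :: l => by
    have := pathLength_detour x y l₂ (w :: l)
    simp only [List.cons_append, pathLength] at this ⊢
    linarith

/-- A connected finite graph has a tour of length at most twice its total edge length. -/
lemma exists_tour (𝓔 : Finset (ℂ × ℂ)) (r : ℂ) :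
    ∃ l : List ℂ, pathLength l ≤ 2 * ∑ e ∈ 𝓔, ‖e.1 - e.2‖ ∧
      ∀ v, Relation.ReflTransGen (fun x y => (x, y) ∈ 𝓔 ∨ (y, x) ∈ 𝓔) r v → v ∈ l := by
  classical
  set good : Finset (Finset (ℂ × ℂ)) := 𝓔.powerset.filter (fun 𝓕 => ∃ l : List ℂ, r ∈ l ∧
    pathLength l ≤ 2 * ∑ e ∈ 𝓕, ‖e.1 - e.2‖ ∧ ∀ e ∈ 𝓕, e.1 ∈ l ∧ e.2 ∈ l) with hgood
  have hne : good.Nonempty := ⟨∅, by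
    rw [hgood, Finset.mem_filter]
    exact ⟨Finset.empty_mem_powerset _, [r], by simp, by simp [pathLength], by simp⟩⟩
  obtain ⟨𝓕, h𝓕, hmax⟩ := good.exists_max_image Finset.card hne
  obtain ⟨hsub, l, hr, hlen, hl⟩ := Finset.mem_filter.1 h𝓕
  rw [Finset.mem_powerset] at hsub
  refine ⟨l, hlen.trans ?_, fun v hv => ?_⟩
  · have := Finset.sum_le_sum_of_subset_of_nonneg hsub
      (f := fun e : ℂ × ℂ => ‖e.1 - e.2‖) (fun _ _ _ => norm_nonneg _)
    linarith
  have step : ∀ x y : ℂ, x ∈ l → ∀ e ∈ 𝓔, (e = (x, y) ∨ e = (y, x)) → y ∈ l := by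
    intro x y hx e he hexy
    by_cases heF : e ∈ 𝓕
    · rcases hexy with rfl | rfl
      · exact (hl _ heF).2
      · exact (hl _ heF).1
    · exfalso
      obtain ⟨l₁, l₂, rfl⟩ := List.append_of_mem hx
      have hmono : ∀ w ∈ l₁ ++ x :: l₂, w ∈ l₁ ++ x :: y :: x :: l₂ := by
        intro w hw
        simp only [List.mem_append, List.mem_cons] at hw ⊢
        tauto
      have hnorm : ‖e.1 - e.2‖ = ‖x - y‖ := by
        rcases hexy with rfl | rfl
        · rfl
        · exact norm_sub_rev _ _
      have hnew : insert e 𝓕 ∈ good := by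
        rw [hgood, Finset.mem_filter, Finset.mem_powerset]
        refine ⟨Finset.insert_subset he hsub, l₁ ++ x :: y :: x :: l₂, hmono _ hr, ?_, ?_⟩
        · rw [pathLength_detour, Finset.sum_insert heF, hnorm]; linarith
        · intro e' he'
          rcases Finset.mem_insert.1 he' with rfl | he'
          · rcases hexy with rfl | rfl <;> simp
          · exact ⟨hmono _ (hl _ he').1, hmono _ (hl _ he').2⟩
      have := hmax _ hnew
      rw [Finset.card_insert_of_notMem heF] at this
      omega
  induction hv with
  | refl => exact hr
  | tail _ hbc ih =>
    rcases hbc with h | h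
    · exact step _ _ ih _ h (Or.inl rfl)
    · exact step _ _ ih _ h (Or.inr rfl)

/-- Arc length parametrization of the vertices of a polygonal path. -/
lemma exists_parametrization : ∀ (x : ℂ) (l : List ℂ), ∃ Γ : Set (ℝ × ℂ),
    (∀ p ∈ Γ, 0 ≤ p.1 ∧ p.1 ≤ pathLength (x :: l)) ∧
    (∀ p ∈ Γ, ∀ q ∈ Γ, ‖p.2 - q.2‖ ≤ |p.1 - q.1|) ∧ (0, x) ∈ Γ ∧
    ∀ y ∈ x :: l, ∃ t, (t, y) ∈ Γ
  | x, [] => ⟨{(0, x)}, by simp [pathLength], by simp, by simp, by simp⟩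
  | x, y :: l => by
    obtain ⟨Γ, h1, h2, h3, h4⟩ := exists_parametrization y l
    have key : ∀ p ∈ Γ, ‖x - p.2‖ ≤ p.1 + ‖x - y‖ := by
      intro p hp
      have e1 := h2 _ h3 _ hp
      simp only [zero_sub, abs_neg, abs_of_nonneg (h1 p hp).1] at e1
      have e : x - p.2 = (x - y) + (y - p.2) := by ring
      rw [e]
      linarith [norm_add_le (x - y) (y - p.2)]
    refine ⟨insert (0, x) ((fun p : ℝ × ℂ => (p.1 + ‖x - y‖, p.2)) '' Γ), ?_, ?_, by simp, ?_⟩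
    · rintro p (rfl | ⟨p, hp, rfl⟩)
      · exact ⟨le_rfl, pathLength_nonneg _⟩
      · obtain ⟨e1, e2⟩ := h1 p hp
        simp only [pathLength]
        exact ⟨by positivity, by linarith⟩
    · rintro p (rfl | ⟨p, hp, rfl⟩) q (rfl | ⟨q, hq, rfl⟩)
      · simp
      · have := key q hq
        have h0 := (h1 q hq).1
        simp only [zero_sub, abs_neg]
        rwa [abs_of_nonneg (by positivity)]
      · have := key p hp
        have h0 := (h1 p hp).1
        simp only [sub_zero]
        rwa [abs_of_nonneg (by positivity), norm_sub_rev]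
      · simpa using h2 p hp q hq
    · intro z hz
      rcases List.mem_cons.1 hz with rfl | hz
      · exact ⟨0, by simp⟩
      · obtain ⟨t, ht⟩ := h4 z hz
        exact ⟨t + ‖x - y‖, Or.inr ⟨(t, z), ht, rfl⟩⟩

/-- The vertices of a path of length `≤ L` lie in the image of a Lipschitz map. -/
lemma exists_lipschitz_of_list {l : List ℂ} {L : ℝ} (hL : 0 < L) (hl : pathLength l ≤ L) :
    ∃ F : Set.Icc (0 : ℝ) 1 → ℂ,
      LipschitzWith (lipschitzExtensionConstant ℂ * L.toNNReal) F ∧ ∀ x ∈ l, x ∈ Set.range F := by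
  rcases l with - | ⟨x₀, l⟩
  · exact ⟨fun _ => 0, LipschitzWith.const' 0 |>.weaken zero_le, by simp⟩
  obtain ⟨Γ, h1, h2, -, h4⟩ := exists_parametrization x₀ l
  set S : Set (Set.Icc (0 : ℝ) 1) := {t | ∃ y, (L * t.1, y) ∈ Γ} with hS
  have hex : ∀ t : Set.Icc (0 : ℝ) 1, ∃ y, t ∈ S → (L * t.1, y) ∈ Γ := fun t => by
    by_cases ht : t ∈ S
    · obtain ⟨y, hy⟩ := ht
      exact ⟨y, fun _ => hy⟩
    · exact ⟨0, fun h => absurd h ht⟩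
  choose g hg using hex
  have hlip : LipschitzOnWith L.toNNReal g S := by
    refine LipschitzOnWith.of_dist_le_mul fun s hs t ht => ?_
    have := h2 _ (hg s hs) _ (hg t ht)
    simp only at this
    rw [← mul_sub, abs_mul, abs_of_pos hL] at this
    rwa [dist_eq_norm, Real.coe_toNNReal _ hL.le, Subtype.dist_eq, Real.dist_eq]
  obtain ⟨F, hF, hFg⟩ := hlip.extend_finite_dimension
  refine ⟨F, hF, fun x hx => ?_⟩
  obtain ⟨t, ht⟩ := h4 x hx
  obtain ⟨t0, t1⟩ := h1 _ ht
  simp only at t0 t1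
  set s : Set.Icc (0 : ℝ) 1 := ⟨t / L, by positivity, by rw [div_le_one hL]; linarith⟩ with hs
  have hLs : L * s.1 = t := by rw [hs]; field_simp
  have hsS : s ∈ S := ⟨x, by rwa [hLs]⟩
  refine ⟨s, ?_⟩
  rw [← hFg hsS]
  have e1 := hg s hsS
  rw [hLs] at e1
  have := h2 _ e1 _ ht
  simp only [sub_self, abs_zero] at this
  exact sub_eq_zero.1 (norm_le_zero_iff.1 this)

/-- Limits of Lipschitz curves: if curves with a common Lipschitz constant come arbitrarily close
to each point of a bounded set, then some such curve passes through all of its points. -/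
lemma exists_lipschitz_of_approx {K : ℝ≥0} {E : Set ℂ} (hE : E.Nonempty)
    (F : ℕ → Set.Icc (0 : ℝ) 1 → ℂ) (hF : ∀ n, LipschitzWith K (F n)) {ε : ℕ → ℝ}
    (hε : Filter.Tendsto ε Filter.atTop (nhds 0))
    (happ : ∀ n, ∀ x ∈ E, ∃ t, ‖F n t - x‖ ≤ ε n) :
    ∃ G : Set.Icc (0 : ℝ) 1 → ℂ, LipschitzWith K G ∧ E ⊆ Set.range G := by
  obtain ⟨x₀, hx₀⟩ := hE
  set 𝒰 : Ultrafilter ℕ := Filter.hyperfilter ℕ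
  have hU : (𝒰 : Filter ℕ) ≤ Filter.atTop := Nat.hyperfilter_le_atTop
  obtain ⟨b, hb⟩ := hε.bddAbove_range
  have hball : ∀ n t, F n t ∈ Metric.closedBall x₀ (K + b) := by
    intro n t
    obtain ⟨s, hs⟩ := happ n x₀ hx₀
    have h1 := (hF n).dist_le_mul t s
    have h2 : dist t s ≤ 1 := by
      rw [Subtype.dist_eq, Real.dist_eq, abs_le]
      constructor <;> linarith [t.2.1, t.2.2, s.2.1, s.2.2]
    have h3 : ε n ≤ b := hb ⟨n, rfl⟩
    rw [← dist_eq_norm] at hs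
    rw [Metric.mem_closedBall]
    have h4 : (K : ℝ) * dist t s ≤ K := mul_le_of_le_one_right K.2 h2
    linarith [dist_triangle (F n t) (F n s) x₀]
  have hlim : ∀ t, ∃ y, Filter.Tendsto (fun n => F n t) 𝒰 (nhds y) := by
    intro t
    obtain ⟨y, -, hy⟩ := (isCompact_closedBall x₀ (K + b)).ultrafilter_le_nhds
      (𝒰.map fun n => F n t) (by
        rw [Filter.le_principal_iff]
        exact (Filter.univ_mem' fun n => hball n t :
          (fun n => F n t) ⁻¹' Metric.closedBall x₀ (K + b) ∈ (𝒰 : Filter ℕ)))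
    exact ⟨y, hy⟩
  choose G hG using hlim
  have hGlip : LipschitzWith K G := by
    refine LipschitzWith.of_dist_le_mul fun s t => ?_
    exact le_of_tendsto ((hG s).dist (hG t)) (Filter.Eventually.of_forall fun n =>
      (hF n).dist_le_mul s t)
  refine ⟨G, hGlip, fun x hx => ?_⟩
  choose t ht using fun n => happ n x hx
  obtain ⟨s, -, hs⟩ := (isCompact_univ (X := Set.Icc (0 : ℝ) 1)).ultrafilter_le_nhds (𝒰.map t)
    (by simp)
  refine ⟨s, ?_⟩
  have h1 : Filter.Tendsto (fun n => dist (G s) (F n s) + (K * dist s (t n) + ε n)) 𝒰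
      (nhds (0 + (K * 0 + 0))) := by
    refine Filter.Tendsto.add ?_ (Filter.Tendsto.add (Filter.Tendsto.const_mul _ ?_) (hε.mono_left hU))
    · have := (tendsto_const_nhds (x := G s)).dist (hG s)
      rwa [dist_self] at this
    · have : Filter.Tendsto t 𝒰 (nhds s) := hs
      have := (tendsto_const_nhds (x := s)).dist this
      rwa [dist_self] at this
  have h2 : dist (G s) x ≤ 0 + (K * 0 + 0) := by
    refine ge_of_tendsto h1 (Filter.Eventually.of_forall fun n => ?_)
    have e1 := dist_triangle4 (G s) (F n s) (F n (t n)) x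
    have e2 := (hF n).dist_le_mul s (t n)
    have e3 := ht n
    rw [← dist_eq_norm] at e3
    linarith
  rw [mul_zero, add_zero, add_zero] at h2
  exact dist_le_zero.1 h2


/-- Connectivity of the net: points of the net can be joined through edges between close points of
the finest scale `m`, edges to the finest scale, and edges inside bad squares. -/
lemma reflTransGen_net {τ : ℝ} (hτ : τ < 1 / 16) {μ : Measure ℂ} {e : DyadicSquare → ℂ}
    (he : ∀ S : DyadicSquare, (μ.support ∩ S.toSet).Nonempty → e S ∈ μ.support ∩ S.toSet)
    {m J : ℤ} {z₀ : ℂ} {ρ : ℝ} {Rel : ℂ → ℂ → Prop} (hsymm : ∀ x y, Rel x y → Rel y x)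
    (hρ : (2 : ℝ) ^ J ≤ ρ)
    (H1 : ∀ S S' : DyadicSquare, S.j = m → S'.j = m → (μ.support ∩ S.toSet).Nonempty →
      (μ.support ∩ S'.toSet).Nonempty → ‖e S - z₀‖ ≤ 12 * ρ → ‖e S' - z₀‖ ≤ 12 * ρ →
      ‖e S - e S'‖ ≤ 36 * (2 : ℝ) ^ m → Rel (e S) (e S'))
    (H2 : ∀ S : DyadicSquare, m ≤ S.j → S.j ≤ J → (μ.support ∩ S.toSet).Nonempty →
      ‖e S - z₀‖ ≤ 10 * ρ → Rel (e S) (e (DyadicSquare.ofPoint m (e S))))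
    (H3 : ∀ Q S S' : DyadicSquare, IsBad τ μ Q → m ≤ Q.j → Q.j ≤ J → ‖Q.center - z₀‖ ≤ 12 * ρ →
      S.j = Q.j - 3 → S'.j = Q.j - 3 → (μ.support ∩ S.toSet).Nonempty →
      (μ.support ∩ S'.toSet).Nonempty → ‖e S - Q.center‖ ≤ 3 * Q.side →
      ‖e S' - Q.center‖ ≤ 3 * Q.side → Rel (e S) (e S')) :
    ∀ (i : ℕ) (S S' : DyadicSquare), m + 5 + i ≤ J → m ≤ S.j → S.j ≤ J → m ≤ S'.j → S'.j ≤ J →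
      (μ.support ∩ S.toSet).Nonempty → (μ.support ∩ S'.toSet).Nonempty →
      ‖e S - e S'‖ < (2 : ℝ) ^ (m + 5 + i) → ‖e S - z₀‖ ≤ 10 * ρ - 4 * (2 : ℝ) ^ (m + 5 + i) →
      ‖e S' - z₀‖ ≤ 10 * ρ - 4 * (2 : ℝ) ^ (m + 5 + i) →
      Relation.ReflTransGen Rel (e S) (e S') := by
  have hcell : ∀ (j : ℤ) (x : ℂ), x ∈ μ.support →
      (μ.support ∩ (DyadicSquare.ofPoint j x).toSet).Nonempty := fun j x hx =>
    ⟨x, hx, DyadicSquare.mem_ofPoint j x⟩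
  have hclose : ∀ (j : ℤ) (x : ℂ), x ∈ μ.support →
      ‖x - e (DyadicSquare.ofPoint j x)‖ ≤ 3 / 2 * (2 : ℝ) ^ j := fun j x hx =>
    DyadicSquare.norm_sub_le_of_mem (DyadicSquare.mem_ofPoint j x) (he _ (hcell j x hx)).2
  have hm0 : (0 : ℝ) < 2 ^ m := zpow_pos two_pos _
  have hρ0 : 0 < ρ := (zpow_pos two_pos J).trans_le hρ
  have tri : ∀ a b c : ℂ, ‖a - c‖ ≤ ‖a - b‖ + ‖b - c‖ := norm_sub_le_norm_sub_add_norm_sub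
  intro i
  induction i with
  | zero =>
    intro S S' hJ hmS hSJ hmS' hSJ' hS hS' hd hz hz'
    have e5 : (2 : ℝ) ^ (m + 5 + ((0 : ℕ) : ℤ)) = 32 * 2 ^ m := by
      rw [Nat.cast_zero, add_zero, zpow_add₀ two_ne_zero]; norm_num; ring
    rw [e5] at hd hz hz'
    have heS := he S hS
    have heS' := he S' hS'
    have c1 := hclose m _ heS.1
    have c2 := hclose m _ heS'.1
    have s1 := H2 S hmS hSJ hS (by linarith)
    have s2 := H2 S' hmS' hSJ' hS' (by linarith)
    have t1 := tri (e (DyadicSquare.ofPoint m (e S))) (e S) (e (DyadicSquare.ofPoint m (e S')))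
    have t2 := tri (e S) (e S') (e (DyadicSquare.ofPoint m (e S')))
    have t3 := tri (e (DyadicSquare.ofPoint m (e S))) (e S) z₀
    have t4 := tri (e (DyadicSquare.ofPoint m (e S'))) (e S') z₀
    rw [norm_sub_rev (e (DyadicSquare.ofPoint m (e S))) (e S)] at t1 t3
    rw [norm_sub_rev (e (DyadicSquare.ofPoint m (e S'))) (e S')] at t4
    have s3 := H1 _ _ (DyadicSquare.ofPoint_j m (e S)) (DyadicSquare.ofPoint_j m (e S'))
      (hcell m _ heS.1) (hcell m _ heS'.1) (by linarith) (by linarith) (by linarith)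
    exact ((Relation.ReflTransGen.single s1).tail s3).tail (hsymm _ _ s2)
  | succ i ih =>
    intro S S' hJ hmS hSJ hmS' hSJ' hS hS' hd hz hz'
    set j : ℤ := m + 5 + ((i + 1 : ℕ) : ℤ) with hj
    set ℓ : ℝ := (2 : ℝ) ^ j with hℓ
    have hℓ0 : 0 < ℓ := zpow_pos two_pos _
    have hhalf : (2 : ℝ) ^ (m + 5 + (i : ℤ)) = ℓ / 2 := by
      have : j = m + 5 + (i : ℤ) + 1 := by rw [hj]; push_cast; ring
      rw [hℓ, this, zpow_add_one₀ two_ne_zero (m + 5 + (i : ℤ))]; ring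
    have hml : (2 : ℝ) ^ m ≤ ℓ / 64 := by
      have h1 : (2 : ℝ) ^ (m + 6) ≤ 2 ^ j := zpow_le_zpow_right₀ one_le_two (by rw [hj]; omega)
      rw [zpow_add₀ two_ne_zero] at h1
      norm_num at h1
      linarith
    have hℓρ : ℓ ≤ ρ := (zpow_le_zpow_right₀ one_le_two hJ).trans hρ
    rw [hhalf] at ih
    have heS := he S hS
    have heS' := he S' hS'
    by_cases hnear : ‖e S - e S'‖ < ℓ / 2
    · exact ih S S' (by omega) hmS hSJ hmS' hSJ' hS hS' hnear (by linarith) (by linarith)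
    push Not at hnear
    set Q := DyadicSquare.ofPoint j (e S) with hQ
    have hQside : Q.side = ℓ := rfl
    have hcQ : ‖e S - Q.center‖ ≤ ℓ := DyadicSquare.norm_sub_center_le (DyadicSquare.mem_ofPoint j _)
    have hcQ' : ‖e S' - Q.center‖ ≤ 2 * ℓ := by
      have := tri (e S') (e S) Q.center
      rw [norm_sub_rev (e S') (e S)] at this
      linarith
    by_cases hbad : IsBad τ μ Q
    · have h3 : (2 : ℝ) ^ (j - 3) = ℓ / 8 := by
        rw [zpow_sub₀ two_ne_zero]; norm_num [hℓ]
      have c1 := hclose (j - 3) _ heS.1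
      have c2 := hclose (j - 3) _ heS'.1
      rw [h3] at c1 c2
      set T := DyadicSquare.ofPoint (j - 3) (e S)
      set T' := DyadicSquare.ofPoint (j - 3) (e S')
      have t1 := tri (e T) (e S) z₀
      have t2 := tri (e T') (e S') z₀
      have t3 := tri (e T) (e S) Q.center
      have t4 := tri (e T') (e S') Q.center
      have t5 := tri Q.center (e S) z₀
      rw [norm_sub_rev (e T) (e S)] at t1 t3
      rw [norm_sub_rev (e T') (e S')] at t2 t4
      rw [norm_sub_rev Q.center (e S)] at t5
      have hmT : m ≤ T.j := by
        change m ≤ j - 3; rw [hj]; push_cast; omega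
      have hTJ : T.j ≤ J := by change j - 3 ≤ J; omega
      have p1 := ih S T (by omega) hmS hSJ hmT hTJ hS (hcell _ _ heS.1) (by linarith) (by linarith)
        (by linarith)
      have p2 := ih T' S' (by omega) hmT hTJ hmS' hSJ' (hcell _ _ heS'.1) hS'
        (by rw [norm_sub_rev]; linarith) (by linarith) (by linarith)
      have p3 := H3 Q T T' hbad (by change m ≤ j; rw [hj]; push_cast; omega) hJ (by linarith) rfl rfl
        (hcell _ _ heS.1) (hcell _ _ heS'.1) (by linarith) (by linarith)
      exact (p1.tail p3).trans p2
    · have hgood : ∀ z ∈ segment ℝ (e S) (e S'), ∃ w ∈ μ.support, ‖w - z‖ ≤ ℓ / 16 := by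
        intro z hz
        by_contra! hno
        refine hbad ⟨e S, ⟨?_, heS.1⟩, e S', ⟨?_, heS'.1⟩, hnear, z, hz, ?_⟩
        · rw [Metric.mem_ball, dist_eq_norm, hQside]; linarith
        · rw [Metric.mem_ball, dist_eq_norm, hQside]; linarith
        · rw [Set.eq_empty_iff_forall_notMem]
          rintro w ⟨hw, hwE⟩
          rw [Metric.mem_ball, dist_eq_norm, hQside] at hw
          have := hno w hwE
          nlinarith
      set x : ℕ → ℂ := fun k => e S + ((k : ℝ) / 8) • (e S' - e S) with hx
      have hxseg : ∀ k ≤ 8, x k ∈ segment ℝ (e S) (e S') := by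
        intro k hk
        rw [segment_eq_image']
        refine ⟨(k : ℝ) / 8, ⟨by positivity, ?_⟩, rfl⟩
        have : (k : ℝ) ≤ 8 := by exact_mod_cast hk
        linarith
      have hpt : ∀ k, ∃ w, k ≤ 8 → w ∈ μ.support ∧ ‖w - x k‖ ≤ ℓ / 16 := by
        intro k
        by_cases hk : k ≤ 8
        · obtain ⟨w, hw⟩ := hgood _ (hxseg k hk)
          exact ⟨w, fun _ => hw⟩
        · exact ⟨0, fun h => absurd h hk⟩
      choose w hw using hpt
      set T : ℕ → DyadicSquare := fun k => DyadicSquare.ofPoint m (w k) with hT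
      have hTm : ∀ k, m ≤ (T k).j := fun k => le_rfl
      have hmJ : m ≤ J := by omega
      have hTcell : ∀ k ≤ 8, (μ.support ∩ (T k).toSet).Nonempty := fun k hk =>
        hcell m _ (hw k hk).1
      have hTx : ∀ k ≤ 8, ‖e (T k) - x k‖ ≤ ℓ / 16 + 3 / 128 * ℓ := by
        intro k hk
        have t := tri (e (T k)) (w k) (x k)
        have c := hclose m _ (hw k hk).1
        rw [norm_sub_rev] at c
        linarith [(hw k hk).2]
      have hdS : ‖e S' - e S‖ < ℓ := by rwa [norm_sub_rev]
      have hxS : ∀ k ≤ 8, ‖x k - e S‖ ≤ ℓ := by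
        intro k hk
        have : (k : ℝ) / 8 ≤ 1 := by
          have : (k : ℝ) ≤ 8 := by exact_mod_cast hk
          linarith
        simp only [hx, add_sub_cancel_left]
        rw [norm_smul, Real.norm_eq_abs, abs_of_nonneg (by positivity)]
        exact (mul_le_of_le_one_left (norm_nonneg _) this).trans hdS.le
      have hxx : ∀ k, ‖x k - x (k + 1)‖ ≤ ℓ / 8 := by
        intro k
        have : x k - x (k + 1) = -((1 / 8 : ℝ) • (e S' - e S)) := by
          simp only [hx, Complex.real_smul]; push_cast; ring
        rw [this, norm_neg, norm_smul]
        norm_num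
        linarith
      have hTz : ∀ k ≤ 8, ‖e (T k) - z₀‖ ≤ 10 * ρ - 4 * (ℓ / 2) := by
        intro k hk
        have t1 := tri (e (T k)) (x k) z₀
        have t2 := tri (x k) (e S) z₀
        linarith [hTx k hk, hxS k hk]
      have hx0 : x 0 = e S := by simp [hx]
      have hx8 : x 8 = e S' := by
        have : ((8 : ℕ) : ℝ) / 8 = 1 := by norm_num
        simp only [hx, this, one_smul]; ring
      have hchain : ∀ k ≤ 8, Relation.ReflTransGen Rel (e S) (e (T k)) := by
        intro k
        induction k with
        | zero =>
          intro h0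
          refine ih S (T 0) (by omega) hmS hSJ (hTm 0) hmJ hS (hTcell 0 h0) ?_ (by linarith)
            (hTz 0 h0)
          have := hTx 0 h0
          rw [hx0, norm_sub_rev] at this
          linarith
        | succ k ihk =>
          intro hk
          refine (ihk (by omega)).trans (ih (T k) (T (k + 1)) (by omega) (hTm k) hmJ (hTm _) hmJ
            (hTcell k (by omega)) (hTcell _ hk) ?_ (hTz k (by omega)) (hTz _ hk))
          have t1 := tri (e (T k)) (x k) (e (T (k + 1)))
          have t2 := tri (x k) (x (k + 1)) (e (T (k + 1)))
          rw [norm_sub_rev (x (k + 1)) (e (T (k + 1)))] at t2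
          linarith [hTx k (by omega), hTx (k + 1) hk, hxx k]
      refine (hchain 8 le_rfl).trans (ih (T 8) S' (by omega) (hTm 8) hmJ hmS' hSJ'
        (hTcell 8 le_rfl) hS' ?_ (hTz 8 le_rfl) (by linarith))
      have := hTx 8 le_rfl
      rw [hx8] at this
      linarith


lemma sum_biUnion_le {ι α : Type*} [DecidableEq α] (s : Finset ι) (t : ι → Finset α) {f : α → ℝ}
    (hf : ∀ x, 0 ≤ f x) : ∑ x ∈ s.biUnion t, f x ≤ ∑ i ∈ s, ∑ x ∈ t i, f x := by
  classical
  have h : s.biUnion t = (s.sigma t).image (fun p => p.2) := by ext x; simp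
  rw [h, Finset.sum_sigma']
  exact Finset.sum_image_le_of_nonneg fun u _ => hf u

lemma sum_union_le {α : Type*} [DecidableEq α] (s t : Finset α) {f : α → ℝ}
    (hf : ∀ x, 0 ≤ f x) : ∑ x ∈ s ∪ t, f x ≤ ∑ x ∈ s, f x + ∑ x ∈ t, f x := by
  rw [← Finset.sum_union_inter]
  exact le_add_of_nonneg_right (Finset.sum_nonneg fun x _ => hf x)

/-- The squares of scale `j` which meet the support and have centre in a given disc. -/
lemma exists_finset_meeting (μ : Measure ℂ) (j : ℤ) (x : ℂ) (ρ : ℝ) :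
    ∃ F : Finset DyadicSquare, ∀ S, S ∈ F ↔
      S.j = j ∧ ‖S.center - x‖ ≤ ρ ∧ (μ.support ∩ S.toSet).Nonempty := by
  classical
  refine ⟨(DyadicSquare.finite_near j x ρ).toFinset.filter
    (fun S => (μ.support ∩ S.toSet).Nonempty), fun S => ?_⟩
  rw [Finset.mem_filter, Set.Finite.mem_toFinset, Set.mem_ofPred_eq, and_assoc]

/-- A choice of a point of the support in each dyadic square that meets it. -/
def IsNet (μ : Measure ℂ) (e : DyadicSquare → ℂ) : Prop :=
  ∀ S : DyadicSquare, (μ.support ∩ S.toSet).Nonempty → e S ∈ μ.support ∩ S.toSet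

lemma exists_isNet (μ : Measure ℂ) : ∃ e, IsNet μ e := by
  have h : ∀ S : DyadicSquare, ∃ x, (μ.support ∩ S.toSet).Nonempty → x ∈ μ.support ∩ S.toSet := by
    intro S
    by_cases hS : (μ.support ∩ S.toSet).Nonempty
    · exact ⟨hS.some, fun _ => hS.some_mem⟩
    · exact ⟨0, fun h => absurd h hS⟩
  choose e he using h
  exact ⟨e, he⟩

lemma IsNet.norm_sub_center_le {μ : Measure ℂ} {e : DyadicSquare → ℂ} (he : IsNet μ e)
    {S : DyadicSquare} (hS : (μ.support ∩ S.toSet).Nonempty) : ‖e S - S.center‖ ≤ S.side :=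
  DyadicSquare.norm_sub_center_le (he S hS).2

lemma card_meeting_mul_le {C₀ c₀ : ℝ} (hC₀ : 0 < C₀) (hc₀ : 0 < c₀) {μ : Measure ℂ}
    (hn : IsNice C₀ μ) (hl : IsLowerADRegular c₀ μ) {e : DyadicSquare → ℂ} (he : IsNet μ e)
    {j J : ℤ} (hj : j ≤ J) {z₀ : ℂ} {F : Finset DyadicSquare}
    (hF : ∀ S ∈ F, S.j = j ∧ ‖S.center - z₀‖ ≤ 14 * (2 : ℝ) ^ J ∧
      (μ.support ∩ S.toSet).Nonempty) :
    F.card * (2 : ℝ) ^ j ≤ 416 * (C₀ / c₀) * (2 : ℝ) ^ J := by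
  have h2 : (2 : ℝ) ^ j ≤ 2 ^ J := zpow_le_zpow_right₀ one_le_two hj
  have h := card_mul_le_of_near_support hC₀ hn hl (F := F) (j := j) (x := z₀) (K := 1)
    (ρ := 14 * (2 : ℝ) ^ J) zero_le_one (by positivity) (fun S hS => by
      obtain ⟨hSj, hSz, hSne⟩ := hF S hS
      refine ⟨hSj, ⟨e S, (he S hSne).1, ?_⟩, hSz⟩
      rw [one_mul, ← hSj]
      exact he.norm_sub_center_le hSne)
  have h3 : F.card * (c₀ * (2 : ℝ) ^ j) ≤ 416 * C₀ * 2 ^ J := by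
    refine h.trans ?_
    nlinarith
  have h4 : 416 * (C₀ / c₀) * (2 : ℝ) ^ J = 416 * C₀ * 2 ^ J / c₀ := by ring
  rw [h4, le_div_iff₀ hc₀]
  linarith

/-- The edges between close points of the finest scale. -/
lemma exists_edges_finest {C₀ c₀ : ℝ} (hC₀ : 0 < C₀) (hc₀ : 0 < c₀) {μ : Measure ℂ}
    (hn : IsNice C₀ μ) (hl : IsLowerADRegular c₀ μ) {e : DyadicSquare → ℂ} (he : IsNet μ e)
    {m J : ℤ} (hm : m ≤ J) (z₀ : ℂ) :
    ∃ 𝓔 : Finset (ℂ × ℂ),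
      ∑ p ∈ 𝓔, ‖p.1 - p.2‖ ≤ 36 * 77 ^ 2 * (416 * (C₀ / c₀) * (2 : ℝ) ^ J) ∧
      ∀ S S' : DyadicSquare, S.j = m → S'.j = m → (μ.support ∩ S.toSet).Nonempty →
        (μ.support ∩ S'.toSet).Nonempty → ‖e S - z₀‖ ≤ 12 * (2 : ℝ) ^ J →
        ‖e S' - z₀‖ ≤ 12 * (2 : ℝ) ^ J → ‖e S - e S'‖ ≤ 36 * (2 : ℝ) ^ m → (e S, e S') ∈ 𝓔 := by
  classical
  have h2 : (2 : ℝ) ^ m ≤ 2 ^ J := zpow_le_zpow_right₀ one_le_two hm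
  have hm0 : (0 : ℝ) < 2 ^ m := zpow_pos two_pos _
  obtain ⟨N, hN⟩ := exists_finset_meeting μ m z₀ (14 * (2 : ℝ) ^ J)
  set G : DyadicSquare → Finset DyadicSquare :=
    fun S => N.filter (fun S' => ‖e S - e S'‖ ≤ 36 * (2 : ℝ) ^ m) with hG
  have hcen : ∀ S, S.j = m → (μ.support ∩ S.toSet).Nonempty → ‖e S - S.center‖ ≤ 2 ^ m :=
    fun S hS hne => hS ▸ he.norm_sub_center_le hne
  have hGcard : ∀ S ∈ N, ((G S).card : ℝ) ≤ 77 ^ 2 := by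
    intro S hS
    have := DyadicSquare.card_le_of_near (F := G S) (j := m) (x := S.center) (K := 38) (by norm_num)
      (fun S' hS' => by
        rw [hG, Finset.mem_filter] at hS'
        obtain ⟨h1, h3⟩ := hS'
        rw [hN] at h1 hS
        refine ⟨h1.1, ?_⟩
        have a := hcen S hS.1 hS.2.2
        have b := hcen S' h1.1 h1.2.2
        have t1 := norm_sub_le_norm_sub_add_norm_sub S'.center (e S') S.center
        have t2 := norm_sub_le_norm_sub_add_norm_sub (e S') (e S) S.center
        rw [norm_sub_rev S'.center (e S')] at t1
        rw [norm_sub_rev (e S') (e S)] at t2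
        linarith)
    norm_num at this ⊢
    exact this
  refine ⟨N.biUnion (fun S => (G S).image (fun S' => (e S, e S'))), ?_, ?_⟩
  · calc _ ≤ ∑ S ∈ N, ∑ p ∈ (G S).image (fun S' => (e S, e S')), ‖p.1 - p.2‖ :=
          sum_biUnion_le _ _ fun _ => norm_nonneg _
      _ ≤ ∑ S ∈ N, ∑ S' ∈ G S, ‖e S - e S'‖ := Finset.sum_le_sum fun S _ =>
          Finset.sum_image_le_of_nonneg (f := fun p : ℂ × ℂ => ‖p.1 - p.2‖)
            fun _ _ => norm_nonneg _
      _ ≤ ∑ S ∈ N, 77 ^ 2 * (36 * (2 : ℝ) ^ m) := Finset.sum_le_sum fun S hS => by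
          refine (Finset.sum_le_card_nsmul _ _ (36 * (2 : ℝ) ^ m) fun S' hS' =>
            (Finset.mem_filter.1 hS').2).trans ?_
          rw [nsmul_eq_mul]
          exact mul_le_mul_of_nonneg_right (hGcard S hS) (by positivity)
      _ = 36 * 77 ^ 2 * (N.card * (2 : ℝ) ^ m) := by
          rw [Finset.sum_const, nsmul_eq_mul]; ring
      _ ≤ _ := by
          refine mul_le_mul_of_nonneg_left ?_ (by norm_num)
          exact card_meeting_mul_le hC₀ hc₀ hn hl he hm fun S hS => (hN S).1 hS
  · intro S S' hS hS' hne hne' hz hz' hd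
    have key : ∀ T, T.j = m → (μ.support ∩ T.toSet).Nonempty → ‖e T - z₀‖ ≤ 12 * (2 : ℝ) ^ J →
        T ∈ N := by
      intro T hT hTne hTz
      rw [hN]
      refine ⟨hT, ?_, hTne⟩
      have t := norm_sub_le_norm_sub_add_norm_sub T.center (e T) z₀
      rw [norm_sub_rev T.center (e T)] at t
      linarith [hcen T hT hTne]
    rw [Finset.mem_biUnion]
    exact ⟨S, key S hS hne hz, Finset.mem_image.2
      ⟨S', Finset.mem_filter.2 ⟨key S' hS' hne' hz', hd⟩, rfl⟩⟩

/-- The edges from points of all scales to points of the finest scale. -/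
lemma exists_edges_vertical {C₀ c₀ : ℝ} (hC₀ : 0 < C₀) (hc₀ : 0 < c₀) {μ : Measure ℂ}
    (hn : IsNice C₀ μ) (hl : IsLowerADRegular c₀ μ) {e : DyadicSquare → ℂ} (he : IsNet μ e)
    {m J : ℤ} (n : ℕ) (hm : m + n = J) (z₀ : ℂ) :
    ∃ 𝓔 : Finset (ℂ × ℂ),
      ∑ p ∈ 𝓔, ‖p.1 - p.2‖ ≤ 3 * (416 * (C₀ / c₀) * (2 : ℝ) ^ J) ∧
      ∀ S : DyadicSquare, m ≤ S.j → S.j ≤ J → (μ.support ∩ S.toSet).Nonempty →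
        ‖e S - z₀‖ ≤ 10 * (2 : ℝ) ^ J → (e S, e (DyadicSquare.ofPoint m (e S))) ∈ 𝓔 := by
  classical
  have hm0 : (0 : ℝ) < 2 ^ m := zpow_pos two_pos _
  have hJ0 : (0 : ℝ) < 2 ^ J := zpow_pos two_pos _
  choose N hN using fun j => exists_finset_meeting μ j z₀ (14 * (2 : ℝ) ^ J)
  set D : ℝ := 416 * (C₀ / c₀) * (2 : ℝ) ^ J with hD
  have hD0 : 0 ≤ D := by positivity
  set f : DyadicSquare → ℂ × ℂ := fun S => (e S, e (DyadicSquare.ofPoint m (e S))) with hf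
  refine ⟨(Finset.range (n + 1)).biUnion (fun i => (N (m + i)).image f), ?_, ?_⟩
  · calc _ ≤ ∑ i ∈ Finset.range (n + 1), ∑ p ∈ (N (m + i)).image f, ‖p.1 - p.2‖ :=
          sum_biUnion_le _ _ fun _ => norm_nonneg _
      _ ≤ ∑ i ∈ Finset.range (n + 1), ∑ S ∈ N (m + i), ‖(f S).1 - (f S).2‖ :=
          Finset.sum_le_sum fun i _ =>
          Finset.sum_image_le_of_nonneg (f := fun p : ℂ × ℂ => ‖p.1 - p.2‖)
            fun _ _ => norm_nonneg _
      _ ≤ ∑ i ∈ Finset.range (n + 1), 3 / 2 * D * (1 / 2) ^ i :=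
          Finset.sum_le_sum fun i hi => by
          have hi' : m + i ≤ J := by rw [Finset.mem_range] at hi; omega
          have hS : ∀ S ∈ N (m + i), ‖(f S).1 - (f S).2‖ ≤ 3 / 2 * (2 : ℝ) ^ m := by
            intro S hS
            have h1 := he S ((hN _ _).1 hS).2.2
            have hmem := DyadicSquare.mem_ofPoint m (e S)
            exact DyadicSquare.norm_sub_le_of_mem hmem (he _ ⟨e S, h1.1, hmem⟩).2
          refine (Finset.sum_le_card_nsmul _ _ _ hS).trans ?_
          have hc := card_meeting_mul_le hC₀ hc₀ hn hl he hi' fun S hS => (hN _ S).1 hS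
          rw [nsmul_eq_mul]
          rw [zpow_add₀ two_ne_zero, zpow_natCast, ← mul_assoc] at hc
          rw [one_div, inv_pow, ← div_eq_mul_inv, le_div_iff₀ (by positivity)]
          linarith
      _ = 3 / 2 * D * ∑ i ∈ Finset.range (n + 1), (1 / 2 : ℝ) ^ i := by rw [Finset.mul_sum]
      _ ≤ 3 / 2 * D * 2 := by
          gcongr
          exact sum_geometric_two_le _
      _ = 3 * D := by ring
  · intro S hmS hSJ hne hz
    obtain ⟨i, hi⟩ := Int.le.dest hmS
    rw [Finset.mem_biUnion]
    refine ⟨i, Finset.mem_range.2 (by omega), Finset.mem_image.2 ⟨S, ?_, rfl⟩⟩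
    rw [hN]
    refine ⟨hi.symm, ?_, hne⟩
    have t := norm_sub_le_norm_sub_add_norm_sub S.center (e S) z₀
    rw [norm_sub_rev S.center (e S)] at t
    have hside : S.side ≤ 2 ^ J := zpow_le_zpow_right₀ one_le_two hSJ
    linarith [he.norm_sub_center_le hne]

lemma sum_side_le_of_isCarleson {C : ℝ} (hC : 0 < C) {𝓑 : Set DyadicSquare} (hB : IsCarleson C 𝓑)
    {J : ℤ} {z₀ : ℂ} {F : Finset DyadicSquare}
    (hF : ∀ Q ∈ F, Q ∈ 𝓑 ∧ Q.j ≤ J ∧ ‖Q.center - z₀‖ ≤ 12 * (2 : ℝ) ^ J) :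
    ∑ Q ∈ F, Q.side ≤ 27 ^ 2 * C * (2 : ℝ) ^ J := by
  classical
  have hJ0 : (0 : ℝ) < 2 ^ J := zpow_pos two_pos _
  rw [isCarleson_iff_finset hC.le] at hB
  set a : DyadicSquare → DyadicSquare := fun Q => DyadicSquare.ofPoint J Q.center with ha
  have hcard : ((F.image a).card : ℝ) ≤ (2 * 13 + 1) ^ 2 :=
    DyadicSquare.card_le_of_near (j := J) (x := z₀) (by norm_num) (fun P hP => by
      obtain ⟨Q, hQ, rfl⟩ := Finset.mem_image.1 hP
      refine ⟨rfl, ?_⟩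
      have h1 : ‖Q.center - (a Q).center‖ ≤ 2 ^ J :=
        DyadicSquare.norm_sub_center_le (DyadicSquare.mem_ofPoint J _)
      have t := norm_sub_le_norm_sub_add_norm_sub (a Q).center Q.center z₀
      rw [norm_sub_rev (a Q).center Q.center] at t
      linarith [(hF Q hQ).2.2])
  rw [← Finset.sum_fiberwise_of_maps_to (fun Q hQ => Finset.mem_image_of_mem a hQ)]
  refine (Finset.sum_le_card_nsmul _ _ (C * (2 : ℝ) ^ J) ?_).trans ?_
  · intro P hP
    have hside : P.side = 2 ^ J := by
      obtain ⟨Q, -, rfl⟩ := Finset.mem_image.1 hP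
      rfl
    rw [← hside]
    refine hB P _ fun Q hQ => ?_
    obtain ⟨h1, rfl⟩ := Finset.mem_filter.1 hQ
    exact ⟨(hF Q h1).1, DyadicSquare.subset_ofPoint (hF Q h1).2.1⟩
  · rw [nsmul_eq_mul]
    refine (mul_le_mul_of_nonneg_right hcard (mul_pos hC hJ0).le).trans (le_of_eq ?_)
    ring

/-- The edges inside the bad squares. -/
lemma exists_edges_bad {τ C : ℝ} (hC : 0 < C) {μ : Measure ℂ}
    (hB : IsCarleson C (badSquares τ μ)) {e : DyadicSquare → ℂ} (he : IsNet μ e)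
    (m J : ℤ) (z₀ : ℂ) :
    ∃ 𝓔 : Finset (ℂ × ℂ),
      ∑ p ∈ 𝓔, ‖p.1 - p.2‖ ≤ 65 ^ 4 * 10 * (27 ^ 2 * C * (2 : ℝ) ^ J) ∧
      ∀ Q S S' : DyadicSquare, IsBad τ μ Q → m ≤ Q.j → Q.j ≤ J →
        ‖Q.center - z₀‖ ≤ 12 * (2 : ℝ) ^ J →
        S.j = Q.j - 3 → S'.j = Q.j - 3 → (μ.support ∩ S.toSet).Nonempty →
        (μ.support ∩ S'.toSet).Nonempty → ‖e S - Q.center‖ ≤ 3 * Q.side →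
        ‖e S' - Q.center‖ ≤ 3 * Q.side → (e S, e S') ∈ 𝓔 := by
  classical
  have hfin : {Q : DyadicSquare | IsBad τ μ Q ∧ (m ≤ Q.j ∧ Q.j ≤ J) ∧
      ‖Q.center - z₀‖ ≤ 12 * (2 : ℝ) ^ J}.Finite := by
    refine ((Set.finite_Icc m J).biUnion fun j _ =>
      DyadicSquare.finite_near j z₀ (12 * (2 : ℝ) ^ J)).subset ?_
    rintro Q ⟨-, hj, hz⟩
    exact Set.mem_biUnion hj ⟨rfl, hz⟩
  choose N hN using fun Q : DyadicSquare =>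
    exists_finset_meeting μ (Q.j - 3) Q.center (4 * Q.side)
  have h8 : ∀ Q : DyadicSquare, (2 : ℝ) ^ (Q.j - 3) = Q.side / 8 := fun Q => by
    rw [zpow_sub₀ two_ne_zero]; norm_num [DyadicSquare.side]
  have hcard : ∀ Q, ((N Q).card : ℝ) ≤ 65 ^ 2 := by
    intro Q
    have := DyadicSquare.card_le_of_near (F := N Q) (j := Q.j - 3) (x := Q.center) (K := 32)
      (by norm_num) (fun S hS => by
        rw [hN] at hS
        refine ⟨hS.1, hS.2.1.trans (le_of_eq ?_)⟩
        rw [h8]; ring)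
    norm_num at this ⊢
    exact this
  have hcen : ∀ Q S : DyadicSquare, S.j = Q.j - 3 → (μ.support ∩ S.toSet).Nonempty →
      ‖e S - S.center‖ ≤ Q.side / 8 := fun Q S hS hne => by
    rw [← h8, ← hS]; exact he.norm_sub_center_le hne
  refine ⟨hfin.toFinset.biUnion (fun Q => (N Q ×ˢ N Q).image (Prod.map e e)), ?_, ?_⟩
  · calc _ ≤ ∑ Q ∈ hfin.toFinset, ∑ p ∈ (N Q ×ˢ N Q).image (Prod.map e e), ‖p.1 - p.2‖ :=
          sum_biUnion_le _ _ fun _ => norm_nonneg _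
      _ ≤ ∑ Q ∈ hfin.toFinset, ∑ p ∈ N Q ×ˢ N Q, ‖e p.1 - e p.2‖ :=
          Finset.sum_le_sum fun Q _ =>
          Finset.sum_image_le_of_nonneg (f := fun p : ℂ × ℂ => ‖p.1 - p.2‖)
            fun _ _ => norm_nonneg _
      _ ≤ ∑ Q ∈ hfin.toFinset, 65 ^ 4 * 10 * Q.side := Finset.sum_le_sum fun Q _ => by
          have hs := Q.side_pos
          refine (Finset.sum_le_card_nsmul _ _ (10 * Q.side) ?_).trans ?_
          · rintro ⟨S, S'⟩ hp
            rw [Finset.mem_product] at hp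
            obtain ⟨a1, a2, a3⟩ := (hN _ _).1 hp.1
            obtain ⟨b1, b2, b3⟩ := (hN _ _).1 hp.2
            have c1 := hcen Q S a1 a3
            have c2 := hcen Q S' b1 b3
            simp only at *
            have t1 := norm_sub_le_norm_sub_add_norm_sub (e S) S.center (e S')
            have t2 := norm_sub_le_norm_sub_add_norm_sub S.center Q.center (e S')
            have t3 := norm_sub_le_norm_sub_add_norm_sub Q.center S'.center (e S')
            rw [norm_sub_rev S'.center (e S'), norm_sub_rev Q.center S'.center] at t3
            linarith
          · rw [nsmul_eq_mul, Finset.card_product]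
            push_cast
            have : ((N Q).card : ℝ) * (N Q).card ≤ 65 ^ 2 * 65 ^ 2 :=
              mul_le_mul (hcard Q) (hcard Q) (Nat.cast_nonneg _) (by positivity)
            nlinarith
      _ = 65 ^ 4 * 10 * ∑ Q ∈ hfin.toFinset, Q.side := by rw [Finset.mul_sum]
      _ ≤ _ := by
          refine mul_le_mul_of_nonneg_left ?_ (by norm_num)
          refine sum_side_le_of_isCarleson (z₀ := z₀) hC hB fun Q hQ => ?_
          rw [Set.Finite.mem_toFinset] at hQ
          exact ⟨hQ.1, hQ.2.1.2, hQ.2.2⟩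
  · intro Q S S' hbad hmQ hQJ hz hS hS' hne hne' hd hd'
    have hs := Q.side_pos
    have key : ∀ T : DyadicSquare, T.j = Q.j - 3 → (μ.support ∩ T.toSet).Nonempty →
        ‖e T - Q.center‖ ≤ 3 * Q.side → T ∈ N Q := by
      intro T hT hTne hTz
      rw [hN]
      refine ⟨hT, ?_, hTne⟩
      have t := norm_sub_le_norm_sub_add_norm_sub T.center (e T) Q.center
      rw [norm_sub_rev T.center (e T)] at t
      linarith [hcen Q T hT hTne]
    rw [Finset.mem_biUnion]
    refine ⟨Q, hfin.mem_toFinset.2 ⟨hbad, ⟨hmQ, hQJ⟩, hz⟩, Finset.mem_image.2 ⟨(S, S'), ?_, rfl⟩⟩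
    exact Finset.mem_product.2 ⟨key S hS hne hd, key S' hS' hne' hd'⟩


/-- The constant in the length of the tours of the nets. -/
noncomputable def tourConstant (C₀ c₀ C : ℝ) : ℝ :=
  4 * (36 * 77 ^ 2 * (416 * (C₀ / c₀)) + 3 * (416 * (C₀ / c₀)) + 65 ^ 4 * 10 * (27 ^ 2 * C))

/-- Approximation of the support in a square by curves of controlled length, at every scale. -/
lemma exists_lipschitz_near {τ C₀ c₀ C : ℝ} (hτ : τ < 1 / 16) (hC₀ : 0 < C₀) (hc₀ : 0 < c₀)
    (hC : 0 < C) {μ : Measure ℂ} (hn : IsNice C₀ μ) (hl : IsLowerADRegular c₀ μ)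
    (hB : IsCarleson C (badSquares τ μ)) {Q : DyadicSquare}
    (hQ : (μ.support ∩ Q.toSet).Nonempty) (n : ℕ) :
    ∃ F : Set.Icc (0 : ℝ) 1 → ℂ, LipschitzWith
      (lipschitzExtensionConstant ℂ * (tourConstant C₀ c₀ C * Q.side).toNNReal) F ∧
      ∀ x ∈ μ.support ∩ Q.toSet, ∃ t, ‖F t - x‖ ≤ 3 / 2 * Q.side * (1 / 2) ^ n := by
  classical
  obtain ⟨e, he⟩ := exists_isNet μ
  set J : ℤ := Q.j + 1 with hJ
  set m : ℤ := J - 5 - n with hm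
  have hs := Q.side_pos
  have hJs : (2 : ℝ) ^ J = 2 * Q.side := by
    rw [hJ, zpow_add_one₀ two_ne_zero]; exact mul_comm _ _
  have hms : (2 : ℝ) ^ m ≤ Q.side * (1 / 2) ^ n / 16 := by
    rw [hm, zpow_sub₀ two_ne_zero, zpow_sub₀ two_ne_zero, hJs, zpow_natCast, one_div, inv_pow]
    refine le_of_eq ?_
    norm_num
    ring
  have hn1 : ((1 : ℝ) / 2) ^ n ≤ 1 := pow_le_one₀ (by norm_num) (by norm_num)
  have hms' : (2 : ℝ) ^ m ≤ Q.side / 16 := by nlinarith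
  obtain ⟨𝓔₁, s1, h1⟩ := exists_edges_finest hC₀ hc₀ hn hl he (m := m) (J := J) (by omega) Q.center
  obtain ⟨𝓔₂, s2, h2⟩ := exists_edges_vertical hC₀ hc₀ hn hl he (m := m) (J := J) (5 + n)
    (by push_cast; omega) Q.center
  obtain ⟨𝓔₃, s3, h3⟩ := exists_edges_bad hC hB he m J Q.center
  have hlen : 2 * ∑ p ∈ 𝓔₁ ∪ 𝓔₂ ∪ 𝓔₃, ‖p.1 - p.2‖ ≤ tourConstant C₀ c₀ C * Q.side := by
    have u1 := sum_union_le (𝓔₁ ∪ 𝓔₂) 𝓔₃ (f := fun p => ‖p.1 - p.2‖) fun _ => norm_nonneg _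
    have u2 := sum_union_le 𝓔₁ 𝓔₂ (f := fun p => ‖p.1 - p.2‖) fun _ => norm_nonneg _
    rw [hJs] at s1 s2 s3
    rw [tourConstant]
    linarith
  obtain ⟨x₀, hx₀⟩ := hQ
  set S₀ := DyadicSquare.ofPoint m x₀ with hS₀
  obtain ⟨l, hl1, hl2⟩ := exists_tour (𝓔₁ ∪ 𝓔₂ ∪ 𝓔₃) (e S₀)
  have hL : 0 < tourConstant C₀ c₀ C * Q.side := by
    rw [tourConstant]; positivity
  obtain ⟨F, hF, hF'⟩ := exists_lipschitz_of_list hL (hl1.trans hlen)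
  refine ⟨F, hF, fun x hx => ?_⟩
  have hcell : ∀ y ∈ μ.support ∩ Q.toSet, (μ.support ∩ (DyadicSquare.ofPoint m y).toSet).Nonempty :=
    fun y hy => ⟨y, hy.1, DyadicSquare.mem_ofPoint m y⟩
  have hnet : ∀ y ∈ μ.support ∩ Q.toSet,
      ‖e (DyadicSquare.ofPoint m y) - y‖ ≤ 3 / 2 * (2 : ℝ) ^ m := fun y hy =>
    DyadicSquare.norm_sub_le_of_mem (he _ (hcell y hy)).2 (DyadicSquare.mem_ofPoint m y)
  have hcen : ∀ y ∈ μ.support ∩ Q.toSet,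
      ‖e (DyadicSquare.ofPoint m y) - Q.center‖ ≤ 12 * Q.side := by
    intro y hy
    have t := norm_sub_le_norm_sub_add_norm_sub (e (DyadicSquare.ofPoint m y)) y Q.center
    linarith [hnet y hy, DyadicSquare.norm_sub_center_le hy.2]
  set S := DyadicSquare.ofPoint m x with hS
  have hcast : m + 5 + (n : ℤ) = J := by omega
  have hpath : Relation.ReflTransGen
      (fun x y => (x, y) ∈ 𝓔₁ ∪ 𝓔₂ ∪ 𝓔₃ ∨ (y, x) ∈ 𝓔₁ ∪ 𝓔₂ ∪ 𝓔₃) (e S₀) (e S) := by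
    refine reflTransGen_net hτ he (m := m) (J := J) (z₀ := Q.center) (ρ := 2 ^ J)
      (fun x y => Or.symm) le_rfl ?_ ?_ ?_ n S₀ S hcast.le le_rfl (by change m ≤ J; omega) le_rfl
      (by change m ≤ J; omega) (hcell x₀ hx₀) (hcell x hx) ?_ ?_ ?_
    · intro T T' a1 a2 a3 a4 a5 a6 a7
      exact Or.inl (Finset.mem_union_left _ (Finset.mem_union_left _ (h1 T T' a1 a2 a3 a4 a5 a6 a7)))
    · intro T a1 a2 a3 a4
      exact Or.inl (Finset.mem_union_left _ (Finset.mem_union_right _ (h2 T a1 a2 a3 a4)))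
    · intro R T T' a1 a2 a3 a4 a5 a6 a7 a8 a9 a10
      exact Or.inl (Finset.mem_union_right _ (h3 R T T' a1 a2 a3 a4 a5 a6 a7 a8 a9 a10))
    · rw [hcast, hJs]
      have t1 := norm_sub_le_norm_sub_add_norm_sub (e S₀) x₀ (e S)
      have t2 := norm_sub_le_norm_sub_add_norm_sub x₀ x (e S)
      rw [norm_sub_rev x (e S)] at t2
      linarith [hnet x hx, hnet x₀ hx₀, DyadicSquare.norm_sub_le_of_mem hx₀.2 hx.2]
    · rw [hcast, hJs]
      linarith [hcen x₀ hx₀]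
    · rw [hcast, hJs]
      linarith [hcen x hx]
  obtain ⟨t, ht⟩ := hF' _ (hl2 _ hpath)
  refine ⟨t, ?_⟩
  rw [ht]
  have : 0 < Q.side * (1 / 2) ^ n := by positivity
  linarith [hnet x hx]

/-- The support of a regular measure whose bad squares form a Carleson family is uniformly
rectifiable. -/
theorem exists_isUniformlyRectifiable {τ C₀ c₀ C : ℝ} (hτ : τ < 1 / 16) (hC₀ : 0 < C₀)
    (hc₀ : 0 < c₀) (hC : 0 < C) :
    ∃ M : ℝ, 0 < M ∧ ∀ μ : Measure ℂ, IsNice C₀ μ → IsLowerADRegular c₀ μ →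
      IsCarleson C (badSquares τ μ) → IsUniformlyRectifiable M μ.support := by
  have hT : 0 < tourConstant C₀ c₀ C := by rw [tourConstant]; positivity
  refine ⟨lipschitzExtensionConstant ℂ * tourConstant C₀ c₀ C,
    mul_pos (lipschitzExtensionConstant_pos ℂ) hT, fun μ hn hl hB Q => ?_⟩
  rcases (μ.support ∩ Q.toSet).eq_empty_or_nonempty with hE | hE
  · exact ⟨fun _ => 0, LipschitzWith.const' 0 |>.weaken zero_le, by simp [hE]⟩
  choose F hF hF' using exists_lipschitz_near hτ hC₀ hc₀ hC hn hl hB hE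
  have hK : lipschitzExtensionConstant ℂ * (tourConstant C₀ c₀ C * Q.side).toNNReal =
      (lipschitzExtensionConstant ℂ * tourConstant C₀ c₀ C * Q.side).toNNReal := by
    rw [mul_assoc, Real.toNNReal_mul NNReal.zero_le_coe, Real.toNNReal_coe]
  rw [← hK]
  refine exists_lipschitz_of_approx hE F hF ?_ hF'
  have := tendsto_pow_atTop_nhds_zero_of_lt_one (r := (1 / 2 : ℝ)) (by norm_num) (by norm_num)
  simpa using this.const_mul (3 / 2 * Q.side)

end CauchyUR

theorem mainTheorem4 (τ C₀ c₀ : ℝ) (hτ : 0 < τ) (hτ' : τ < 1) (hC₀ : 0 < C₀) (hc₀ : 0 < c₀) :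
    (∃ C : ℝ, 0 < C ∧ ∀ μ : MeasureTheory.Measure ℂ,
      CauchyUR.IsGood C₀ μ → CauchyUR.IsLowerADRegular c₀ μ →
        CauchyUR.IsCarleson C (CauchyUR.badSquares τ μ)) ∧
    (τ < 1 / 16 → ∀ C : ℝ, 0 < C → ∃ M : ℝ, 0 < M ∧ ∀ μ : MeasureTheory.Measure ℂ,
      CauchyUR.IsNice C₀ μ → CauchyUR.IsLowerADRegular c₀ μ →
        CauchyUR.IsCarleson C (CauchyUR.badSquares τ μ) →
          CauchyUR.IsUniformlyRectifiable M μ.support) := by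
  refine ⟨CauchyUR.exists_isCarleson_badSquares hτ hτ' hC₀ hc₀, fun hτ16 C hC => ?_⟩
  exact CauchyUR.exists_isUniformlyRectifiable hτ16 hC₀ hc₀ hC
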